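/- Definitions. Let $n,\Delta\ge 1$ be integers. A simplex in $\mathbb R^n$ is the convex hull of $n+1$ affinely independent points. It is empty if it contains no point of $\mathbb Z^n$; it is a lattice-simplex if all its vertices lie in $\mathbb Z^n$; a lattice-simplex $S$ is empty if $S\cap\mathbb Z^n$ is exactly its set of vertices. For an integer matrix $A$, $\Delta(A)$ denotes the maximum absolute value of the minors of $A$ of order $\operatorname{rank}A$, and $A$ is $\Delta$-modular if $\Delta(A)\le\Delta$. A simplex is $\Delta$-modular if it equals $\{x\in\mathbb R^n : Ax\le b\}$ for some $\Delta$-modular $A\in\mathbb Z^{(n+1)\times n}$ and some $b\in\mathbb Z^{n+1}$. Two simplices are unimodular equivalent if one is the image of the other under a map $x\mapsto Ux+x_0$ with $U\in\mathbb Z^{n\times n}$, $|\det U|=1$, $x_0\in\mathbb Z^n$. A system $\binom{H}{c^\top}x\le\binom{h}{c_0}$ with $A=\binom{H}{c^\top}\in\mathbb Z^{(n+1)\times n}$, $h\in\mathbb Z^n$, $c_0\in\mathbb Z$, is normalized if: (1) $A$ is in Hermite normal form (that is, $H$ is lower triangular with $H_{ii}>0$ and $0\le H_{ij}<H_{ii}$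 for $j<i$) and $|\det H|=\Delta(A)$; (2) $H=\begin{pmatrix} I_s&0\\ B&T\end{pmatrix}$ with $s+k=n$, $k\le\log_2\Delta$, where $I_s$ is the $s\times s$ identity matrix, the columns of $B$ are lexicographically sorted, and $T\in\mathbb Z^{k\times k}$ is lower triangular with all $T_{ii}\ge 2$; (3) $0\le h_i<H_{ii}$ for all $i$; (4) for each inequality of the system, the gcd of its coefficients and its right-hand side is $1$; (5) $c=-H^\top t$ for some $t\in(0,1]^n$; (6) all entries of $A$ have absolute value at most $\Delta$. Lemma. There is an algorithm that, for given $n,\Delta\ge1$, constructs two families $\mathscr S$ and $\mathscr L$ of simplices in $\mathbb R^n$ such that: (i) each simplex of $\mathscr S$ and of $\mathscr L$ is defined by a normalized system with a $\Delta$-modular matrix, and so is $\Delta$-modular; (ii) the simplices of $\mathscr S$ are empty, and every $\Delta$-modular empty simplex in $\mathbb R^n$ is unimodular equivalent to a simplex of $\mathscr S$; (iii) the simplices of $\mathscr L$ are empty lattice-simplices, and every $\Delta$-modular empty lattice-simplex in $\mathbb R^n$ is unimodular equivalent to a simplex of $\mathscr L$. The running time of the algorithm is at most $$\binom{n+\Delta-1}{\Delta-1}\cdot\Delta^{\log_2\Delta}\cdot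 p(n,\Delta)$$ for a polynomial $p$ with coefficients in $\mathbb Z_{\ge0}$ that does not depend on $n$ and $\Delta$. It is also at most $C\cdot\bigl(C\cdot\frac{n+\Delta}{\Delta}\bigr)^{\Delta-1}\cdot n^{C}$ for an absolute constant $C$, and for each fixed $\Delta$ it is bounded by a polynomial in $n$. In particular, for each fixed $\Delta$, the number of unimodular equivalence classes of $\Delta$-modular empty lattice-simplices in $\mathbb R^n$ is bounded by a polynomial in $n$. -/

import Mathlib

namespace EmptySimplices

/-! ### Simplices, lattice-simplices, unimodular equivalence -/

/-- The set `ℤⁿ` of points of `ℝⁿ` with integer coordinates. -/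
def integerPoints (n : ℕ) : Set (Fin n → ℝ) :=
  Set.range fun (z : Fin n → ℤ) (i : Fin n) => (z i : ℝ)

/-- `S` is a (full-dimensional, closed) simplex of `ℝⁿ`: the convex hull of `n + 1` affinely
independent points. -/
def IsSimplex {n : ℕ} (S : Set (Fin n → ℝ)) : Prop :=
  ∃ s : Affine.Simplex ℝ (Fin n → ℝ) n, S = convexHull ℝ (Set.range s.points)

/-- An empty simplex: a simplex without integer points. -/
def IsEmptySimplex {n : ℕ} (S : Set (Fin n → ℝ)) : Prop :=
  IsSimplex S ∧ S ∩ integerPoints n = ∅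

/-- A lattice-simplex: a simplex all of whose vertices are integer points. -/
def IsLatticeSimplex {n : ℕ} (S : Set (Fin n → ℝ)) : Prop :=
  IsSimplex S ∧ S.extremePoints ℝ ⊆ integerPoints n

/-- An empty lattice-simplex: a lattice-simplex whose only integer points are its vertices. -/
def IsEmptyLatticeSimplex {n : ℕ} (S : Set (Fin n → ℝ)) : Prop :=
  IsLatticeSimplex S ∧ S ∩ integerPoints n = S.extremePoints ℝ

/-- `S` and `S'` are unimodular equivalent: `S'` is the image of `S` under `x ↦ U x + x₀`, with `U`
an integer matrix of determinant `±1` and `x₀` an integer vector. -/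
def UnimodularEquiv {n : ℕ} (S S' : Set (Fin n → ℝ)) : Prop :=
  ∃ (U : Matrix (Fin n) (Fin n) ℤ) (x₀ : Fin n → ℤ), IsUnit U.det ∧
    (fun (x : Fin n → ℝ) (i : Fin n) => ∑ j, (U i j : ℝ) * x j + (x₀ i : ℝ)) '' S = S'

/-! ### Sub-determinants and systems of inequalities -/

/-- `Δ_k(A)`: the maximum absolute value of the determinants of the `k × k` sub-matrices of `A`. -/
noncomputable def maxMinor {m n : ℕ} (k : ℕ) (A : Matrix (Fin m) (Fin n) ℤ) : ℕ :=
  Finset.univ.sup fun IJ : (Fin k ↪o Fin m) × (Fin k ↪o Fin n) =>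
    (A.submatrix IJ.1 IJ.2).det.natAbs

/-- `Δ(A) = Δ_{rank A}(A)`. -/
noncomputable def bigDelta {m n : ℕ} (A : Matrix (Fin m) (Fin n) ℤ) : ℕ :=
  maxMinor (A.map (Int.cast : ℤ → ℚ)).rank A

/-- `A` is `Δ`-modular. -/
def IsDeltaModular {m n : ℕ} (Δ : ℕ) (A : Matrix (Fin m) (Fin n) ℤ) : Prop :=
  bigDelta A ≤ Δ

/-- A system `A x ≤ b` of `n + 1` inequalities in `n` variables, with integer data. -/
structure IneqSystem (n : ℕ) where
  /-- the matrix `A` -/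
  mat : Matrix (Fin (n + 1)) (Fin n) ℤ
  /-- the right-hand side `b` -/
  rhs : Fin (n + 1) → ℤ

/-- The set of real solutions of the system. -/
def IneqSystem.solutions {n : ℕ} (σ : IneqSystem n) : Set (Fin n → ℝ) :=
  {x | ∀ i, ∑ j, (σ.mat i j : ℝ) * x j ≤ (σ.rhs i : ℝ)}

/-- The set `S` can be defined by a system `A x ≤ b` with a `Δ`-modular matrix `A`. -/
def IsDeltaModularSet {n : ℕ} (Δ : ℕ) (S : Set (Fin n → ℝ)) : Prop :=
  ∃ σ : IneqSystem n, IsDeltaModular Δ σ.mat ∧ σ.solutions = S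

/-- The first `n` rows `H` of the matrix of the system. -/
def IneqSystem.H {n : ℕ} (σ : IneqSystem n) : Matrix (Fin n) (Fin n) ℤ :=
  σ.mat.submatrix Fin.castSucc id

/-- The last row `c` of the matrix of the system. -/
def IneqSystem.c {n : ℕ} (σ : IneqSystem n) : Fin n → ℤ :=
  σ.mat (Fin.last n)

/-- The first `n` entries `h` of the right-hand side; the last one is `c₀`. -/
def IneqSystem.h {n : ℕ} (σ : IneqSystem n) : Fin n → ℤ :=
  fun i => σ.rhs i.castSucc

/-- Normalized systems. The first four fields say that `(H; cᵀ)` is in Hermite normal form and that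
`|det H| = Δ(A)`. -/
structure IneqSystem.IsNormalized {n : ℕ} (Δ : ℕ) (σ : IneqSystem n) : Prop where
  lower : ∀ i j, i < j → σ.H i j = 0
  diag_pos : ∀ i, 0 < σ.H i i
  reduced : ∀ i j, j < i → 0 ≤ σ.H i j ∧ σ.H i j < σ.H i i
  det_eq : σ.H.det.natAbs = bigDelta σ.mat
  /-- `H = (I_s 0; B T)` with `s + k = n`, `k ≤ log₂ Δ`, lexicographically sorted columns of `B`,
  lower triangular `T` and `T_ii ≥ 2`. -/
  block : ∃ (s k : ℕ) (hsk : s + k = n)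
    (B : Matrix (Fin k) (Fin s) ℤ) (T : Matrix (Fin k) (Fin k) ℤ),
    σ.H.submatrix (finSumFinEquiv.trans (finCongr hsk)) (finSumFinEquiv.trans (finCongr hsk)) =
      Matrix.fromBlocks 1 0 B T ∧
    (k : ℝ) ≤ Real.logb 2 Δ ∧
    Monotone (fun j : Fin s => toLex fun i : Fin k => B i j) ∧
    (∀ i j, i < j → T i j = 0) ∧
    (∀ i, 2 ≤ T i i)
  rhs_reduced : ∀ i, 0 ≤ σ.h i ∧ σ.h i < σ.H i i
  /-- The coefficients and the right-hand side of each inequality have gcd `1`. -/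
  gcd_eq_one : ∀ i, Int.gcd (Finset.univ.gcd (σ.mat i)) (σ.rhs i) = 1
  /-- `c = -Hᵀ t` for some `t ∈ (0, 1]ⁿ`. -/
  c_mem : ∃ t : Fin n → ℝ, (∀ i, 0 < t i ∧ t i ≤ 1) ∧
    ∀ j, (σ.c j : ℝ) = ∑ i, -(σ.H i j : ℝ) * t i
  entry_le : ∀ i j, |σ.mat i j| ≤ (Δ : ℤ)

/-- The unimodular equivalence classes of `Δ`-modular empty lattice-simplices of `ℝⁿ`. -/
def emptyLatticeSimplexClasses (n Δ : ℕ) : Set (Set (Set (Fin n → ℝ))) :=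
  {K | ∃ S : Set (Fin n → ℝ), IsEmptyLatticeSimplex S ∧ IsDeltaModularSet Δ S ∧
    K = {S' | UnimodularEquiv S S'}}

/-! ### Algorithms and their running time

The machine model is a structured pointer machine. Its data are integers and pairs (cons cells); a
datum is passed around by reference, so that projections and the creation of a cell cost one step,
while an operation on two integers costs `(1 + ℓ) * (1 + ℓ')` steps when these have `ℓ` and `ℓ'`
binary digits. A program maps a datum to a datum; iteration is by unbounded loops. -/

/-- Data: integers and pairs. -/
inductive Datum : Type where
  | num (z : ℤ)
  | pair (a b : Datum)

/-- Integer operations. -/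
inductive ArithOp : Type where
  | add | sub | mul | div | mod | le

/-- The value of an integer operation; `le` returns `1` or `0`. -/
def ArithOp.eval : ArithOp → ℤ → ℤ → ℤ
  | .add, a, b => a + b
  | .sub, a, b => a - b
  | .mul, a, b => a * b
  | .div, a, b => a / b
  | .mod, a, b => a % b
  | .le, a, b => if a ≤ b then 1 else 0

/-- The number of binary digits of `|z|`. -/
def bitLength (z : ℤ) : ℕ := z.natAbs.size

/-- Programs. -/
inductive Program : Type where
  /-- return the input -/
  | id
  /-- return the fixed integer `z` -/
  | const (z : ℤ)
  /-- first component of a pair -/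
  | fst
  /-- second component of a pair -/
  | snd
  /-- return `1` on integers and `0` on pairs -/
  | isNum
  /-- apply an operation to a pair of integers -/
  | arith (o : ArithOp)
  /-- run `p` and `q` on the input and pair the results -/
  | pair (p q : Program)
  /-- run `p`, then run `q` on its result -/
  | seq (p q : Program)
  /-- run `p` if `c` returns a nonzero integer, `q` if `c` returns `0` -/
  | ite (c p q : Program)
  /-- as long as `c` returns a nonzero integer, replace the datum by the result of `p` -/
  | loop (c p : Program)

/-- `Runs P x y t`: on input `x`, the program `P` halts with output `y` after `t` steps. -/
inductive Runs : Program → Datum → Datum → ℕ → Prop where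
  | id (x : Datum) : Runs .id x x 1
  | const (z : ℤ) (x : Datum) : Runs (.const z) x (.num z) 1
  | fst (a b : Datum) : Runs .fst (.pair a b) a 1
  | snd (a b : Datum) : Runs .snd (.pair a b) b 1
  | isNum_num (z : ℤ) : Runs .isNum (.num z) (.num 1) 1
  | isNum_pair (a b : Datum) : Runs .isNum (.pair a b) (.num 0) 1
  | arith (o : ArithOp) (a b : ℤ) :
      Runs (.arith o) (.pair (.num a) (.num b)) (.num (o.eval a b))
        ((1 + bitLength a) * (1 + bitLength b))
  | pair {p q : Program} {x y z : Datum} {t u : ℕ} :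
      Runs p x y t → Runs q x z u → Runs (.pair p q) x (.pair y z) (t + u + 1)
  | seq {p q : Program} {x y z : Datum} {t u : ℕ} :
      Runs p x y t → Runs q y z u → Runs (.seq p q) x z (t + u + 1)
  | ite_true {c p q : Program} {x y : Datum} {z : ℤ} {t u : ℕ} :
      Runs c x (.num z) t → z ≠ 0 → Runs p x y u → Runs (.ite c p q) x y (t + u + 1)
  | ite_false {c p q : Program} {x y : Datum} {t u : ℕ} :
      Runs c x (.num 0) t → Runs q x y u → Runs (.ite c p q) x y (t + u + 1)
  | loop_stop {c p : Program} {x : Datum} {t : ℕ} :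
      Runs c x (.num 0) t → Runs (.loop c p) x x (t + 1)
  | loop_step {c p : Program} {x y w : Datum} {z : ℤ} {t u v : ℕ} :
      Runs c x (.num z) t → z ≠ 0 → Runs p x y u → Runs (.loop c p) y w v →
        Runs (.loop c p) x w (t + u + v + 1)

/-- A list as a datum: nested pairs, ended by the integer `0`. -/
def encodeList {α : Type} (enc : α → Datum) : List α → Datum
  | [] => .num 0
  | a :: l => .pair (enc a) (encodeList enc l)

/-- A system `A x ≤ b` as a datum: the list of the rows of `A`, paired with the list `b`. -/
def encodeSystem {n : ℕ} (σ : IneqSystem n) : Datum :=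
  .pair
    (encodeList (fun row : Fin n → ℤ => encodeList Datum.num (List.ofFn row)) (List.ofFn σ.mat))
    (encodeList Datum.num (List.ofFn σ.rhs))

end EmptySimplices

open EmptySimplices

namespace EmptySimplices

/-! Normalization (`exists_isCanonical`). Among the `n + 1` inequalities of a simplex, made
primitive, choose `n` whose determinant has maximal absolute value `δ ≤ Δ`; call their matrix `H`
and the remaining row `c`. Cramer's rule and maximality give `c = -Hᵀ t` with `|t_i| ≤ 1`, and
boundedness of the simplex forces `t_i > 0`. Unimodular column operations bring `H` into Hermite
normal form. A simultaneous permutation of rows and columns puts the indices with diagonal entry `1`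
first and sorts their columns. An integer translation reduces `h` modulo the diagonal. Hence it
suffices to enumerate `H`, the integer vector `τ = δ t`, the reduced vector `h` and a right-hand
side `c₀` bounded by `Δ`.

Enumeration (`Node.expand`, `exists_reachable_node`). The matrix grows from its lower right corner.
The diagonal entries `≥ 2` come first; their product is at most `Δ`, so there are at most `log₂ Δ`
of them. After that there are only unit columns, each given by one of the `δ` reduced vectors. As
these columns are sorted, only their multiset matters, which yields a binomial coefficient instead
of a power `δ ^ n`. `Node.Valid.pot` turns this into a bound for the size of the search tree.

Testing (`mem_layers`, `emptyOk_iff`, `latticeOk_iff`). In the slack coordinates `y = h - H x` the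
simplex is `y ≥ 0`, `τ y ≤ R` with `R = δ c₀ + τ h`, and the integer points are the `y` congruent to
`h` modulo the lattice `H ℤⁿ`. The quotient `ℤⁿ / H ℤⁿ` has only `δ` elements, represented by the
reduced vectors. A dynamic program over the value `τ y` finds which classes contain a nonnegative
`y` of each value, and this decides emptiness. Membership in the lattice is tested by duality
against all admissible `τ`, of which there are `δ` as well (`inLat_iff`).

Running time. The parameters `n` and `Δ` may enter polynomially, so all work at one node is measured
in the unary size of the node (`PolyTime`), and this size is polynomial in `n` and `Δ`
(`Node.Valid.sz_le`). A depth-first search costs the number of nodes times such a polynomial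
(`exists_program_search`). The explicit bounds are then estimates of `(n + Δ - 1).choose (Δ - 1) * Δ
^ log₂ Δ`. The number of equivalence classes is at most the length of the second output list. This
length is bounded by the running time, because a step raises the height of a datum by at most one
(`Runs.height_le`). -/

/-- The number of nodes of a datum, every integer being counted in unary. -/
def Datum.size : Datum → ℕ
  | .num z => z.natAbs + 1
  | .pair a b => a.size + b.size + 1

/-- Types whose elements are represented by data. -/
class Enc (α : Type) where
  /-- the datum that represents an element -/
  enc : α → Datum

open EmptySimplices.Enc (enc)

instance : Enc ℤ := ⟨.num⟩
instance : Enc ℕ := ⟨fun n => .num n⟩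
instance : Enc Bool := ⟨fun b => .num (cond b 1 0)⟩
instance {α β : Type} [Enc α] [Enc β] : Enc (α × β) := ⟨fun p => .pair (enc p.1) (enc p.2)⟩
instance {α : Type} [Enc α] : Enc (List α) := ⟨encodeList enc⟩

/-- The unary size of the datum that represents `a`. -/
def sz {α : Type} [Enc α] (a : α) : ℕ := (enc a).size

/-! ### Sizes of encoded data. -/

section basic
variable {α β γ δ X : Type} [Enc α] [Enc β] [Enc γ] [Enc δ] [Enc X]

lemma Datum.size_pos (d : Datum) : 1 ≤ d.size := by
  cases d <;> simp [Datum.size]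

lemma sz_pos (a : α) : 1 ≤ sz a := Datum.size_pos _

lemma sz_int (z : ℤ) : sz z = z.natAbs + 1 := rfl
lemma sz_nat (n : ℕ) : sz n = n + 1 := by simp [sz, enc, Datum.size]
lemma sz_bool (b : Bool) : sz b ≤ 2 := by cases b <;> simp [sz, enc, Datum.size]
lemma sz_prod (a : α) (b : β) : sz (a, b) = sz a + sz b + 1 := rfl
lemma sz_nil : sz ([] : List α) = 1 := rfl
lemma sz_cons (a : α) (l : List α) : sz (a :: l) = sz a + sz l + 1 := rfl

lemma sz_append (l m : List α) : sz (l ++ m) + 1 = sz l + sz m := by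
  induction l with
  | nil => simp [sz_nil]; omega
  | cons a l ih => simp only [List.cons_append, sz_cons]; omega

lemma sz_reverse (l : List α) : sz l.reverse = sz l := by
  induction l with
  | nil => rfl
  | cons a l ih =>
    have := sz_append l.reverse [a]
    simp only [List.reverse_cons, sz_cons, sz_nil] at *
    omega

lemma length_lt_sz (l : List α) : l.length < sz l := by
  induction l with
  | nil => simp [sz_nil]
  | cons a l ih => simp only [List.length_cons, sz_cons]; omega

lemma sz_le_of_mem {a : α} {l : List α} (h : a ∈ l) : sz a ≤ sz l := by
  induction l with
  | nil => simp at h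
  | cons b l ih =>
    rcases List.mem_cons.1 h with rfl | h
    · simp only [sz_cons]; omega
    · have := ih h; simp only [sz_cons]; omega

lemma sz_list_le {l : List α} {m : ℕ} (h : ∀ a ∈ l, sz a ≤ m) : sz l ≤ l.length * (m + 1) + 1 := by
  induction l with
  | nil => simp [sz_nil]
  | cons b l ih =>
    have h1 := ih fun a ha => h a (List.mem_cons_of_mem _ ha)
    have h2 := h b List.mem_cons_self
    simp only [List.length_cons, sz_cons, add_mul]; omega

lemma sz_suffix_le {l m : List α} (h : l <:+ m) : sz l ≤ sz m := by
  obtain ⟨k, rfl⟩ := h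
  have := sz_append k l
  have := sz_pos k
  omega

lemma sz_prefix_le {l m : List α} (h : l <+: m) : sz l ≤ sz m := by
  obtain ⟨k, rfl⟩ := h
  have := sz_append l k
  have := sz_pos k
  omega

/-! ### Polynomially bounded functions -/

/-- `g` is bounded by a polynomial in the size of its argument. -/
def PolyBdd (g : α → ℕ) : Prop := ∃ C, ∀ a, g a ≤ (sz a + 1) ^ C

lemma PolyBdd.mono {g g' : α → ℕ} (h : PolyBdd g') (hg : ∀ a, g a ≤ g' a) : PolyBdd g := by
  obtain ⟨C, hC⟩ := h
  exact ⟨C, fun a => (hg a).trans (hC a)⟩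

/-- Sizes are at least `1`, so the base `sz a + 1` is at least `2`. This is why the single exponent
in `PolyBdd` can absorb constants, and factors `2` in sums. -/
lemma PolyBdd.const (k : ℕ) : PolyBdd fun _ : α => k :=
  ⟨k, fun a => (Nat.lt_two_pow_self).le.trans (Nat.pow_le_pow_left (Nat.succ_le_succ (sz_pos a)) _)⟩

lemma PolyBdd.self : PolyBdd fun a : α => sz a := ⟨1, fun a => by simp⟩

lemma PolyBdd.mul {g g' : α → ℕ} (h : PolyBdd g) (h' : PolyBdd g') :
    PolyBdd fun a => g a * g' a := by
  obtain ⟨C, hC⟩ := h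
  obtain ⟨D, hD⟩ := h'
  exact ⟨C + D, fun a => by rw [pow_add]; exact Nat.mul_le_mul (hC a) (hD a)⟩

lemma PolyBdd.add {g g' : α → ℕ} (h : PolyBdd g) (h' : PolyBdd g') :
    PolyBdd fun a => g a + g' a := by
  obtain ⟨C, hC⟩ := h
  obtain ⟨D, hD⟩ := h'
  refine ⟨C + D + 1, fun a => ?_⟩
  have hb : 1 ≤ sz a + 1 := by omega
  have h1 : (sz a + 1) ^ C ≤ (sz a + 1) ^ (C + D) := Nat.pow_le_pow_right hb (by omega)
  have h2 : (sz a + 1) ^ D ≤ (sz a + 1) ^ (C + D) := Nat.pow_le_pow_right hb (by omega)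
  have h3 : 2 ≤ sz a + 1 := by have := sz_pos a; omega
  calc g a + g' a ≤ (sz a + 1) ^ (C + D) * 2 := by have := hC a; have := hD a; omega
    _ ≤ _ := by rw [pow_succ]; exact Nat.mul_le_mul_left _ h3

lemma PolyBdd.pow {g : α → ℕ} (h : PolyBdd g) (k : ℕ) : PolyBdd fun a => g a ^ k := by
  obtain ⟨C, hC⟩ := h
  exact ⟨C * k, fun a => by rw [pow_mul]; exact Nat.pow_le_pow_left (hC a) _⟩

lemma PolyBdd.comp {g : β → ℕ} {f : α → β} (hg : PolyBdd g) (hf : PolyBdd fun a => sz (f a)) :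
    PolyBdd fun a => g (f a) := by
  obtain ⟨C, hC⟩ := hg
  exact ((hf.add (.const 1)).pow C).mono fun a => hC _

/-! ### Functions computable in polynomial time -/

/-- `f` is computed by a program whose running time and output size are bounded by a polynomial in
the unary size of the input. -/
@[fun_prop]
def PolyTime (f : α → β) : Prop :=
  ∃ (P : Program) (T : α → ℕ), PolyBdd T ∧ PolyBdd (fun a => sz (f a)) ∧
    ∀ a, ∃ t ≤ T a, Runs P (enc a) (enc (f a)) t

lemma PolyTime.bdd {f : α → β} (h : PolyTime f) : PolyBdd fun a => sz (f a) := by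
  obtain ⟨P, T, h1, h2, h3⟩ := h
  exact h2

@[fun_prop]
theorem PolyTime.id : PolyTime fun a : α => a :=
  ⟨.id, fun _ => 1, .const 1, .self, fun _ => ⟨1, le_rfl, .id _⟩⟩

@[fun_prop]
theorem PolyTime.comp {f : β → γ} {g : α → β} (hf : PolyTime f) (hg : PolyTime g) :
    PolyTime fun a => f (g a) := by
  obtain ⟨P, T, h1, h2, h3⟩ := hf
  obtain ⟨Q, S, k1, k2, k3⟩ := hg
  refine ⟨.seq Q P, fun a => S a + T (g a) + 1, (k1.add (h1.comp k2)).add (.const 1), h2.comp k2,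
    fun a => ?_⟩
  obtain ⟨t, ht, r⟩ := k3 a
  obtain ⟨u, hu, r'⟩ := h3 (g a)
  exact ⟨t + u + 1, by dsimp only; omega, .seq r r'⟩

lemma exists_program_const (d : Datum) : ∃ P t, ∀ x, Runs P x d t := by
  induction d with
  | num z => exact ⟨.const z, 1, fun x => .const z x⟩
  | pair a b iha ihb =>
    obtain ⟨P, t, h⟩ := iha
    obtain ⟨Q, u, k⟩ := ihb
    exact ⟨.pair P Q, _, fun x => .pair (h x) (k x)⟩

@[fun_prop]
theorem PolyTime.const (b : β) : PolyTime fun _ : α => b := by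
  obtain ⟨P, t, h⟩ := exists_program_const (enc b)
  exact ⟨P, fun _ => t, .const t, .const _, fun a => ⟨t, le_rfl, h _⟩⟩

@[fun_prop]
theorem PolyTime.prodMk {f : α → β} {g : α → γ} (hf : PolyTime f) (hg : PolyTime g) :
    PolyTime fun a => (f a, g a) := by
  obtain ⟨P, T, h1, h2, h3⟩ := hf
  obtain ⟨Q, S, k1, k2, k3⟩ := hg
  refine ⟨.pair P Q, fun a => T a + S a + 1, (h1.add k1).add (.const 1),
    (h2.add k2).add (.const 1), fun a => ?_⟩
  obtain ⟨t, ht, r⟩ := h3 a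
  obtain ⟨u, hu, r'⟩ := k3 a
  exact ⟨t + u + 1, by dsimp only; omega, .pair r r'⟩

theorem polyTime_fst : PolyTime fun a : α × β => a.1 :=
  ⟨.fst, fun _ => 1, .const 1, PolyBdd.self.mono fun a => by
    obtain ⟨a, b⟩ := a; simp only [sz_prod]; omega, fun a => ⟨1, le_rfl, .fst _ _⟩⟩

theorem polyTime_snd : PolyTime fun a : α × β => a.2 :=
  ⟨.snd, fun _ => 1, .const 1, PolyBdd.self.mono fun a => by
    obtain ⟨a, b⟩ := a; simp only [sz_prod]; omega, fun a => ⟨1, le_rfl, .snd _ _⟩⟩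

@[fun_prop]
theorem PolyTime.fst {f : α → β × γ} (hf : PolyTime f) : PolyTime fun a => (f a).1 :=
  polyTime_fst.comp hf

@[fun_prop]
theorem PolyTime.snd {f : α → β × γ} (hf : PolyTime f) : PolyTime fun a => (f a).2 :=
  polyTime_snd.comp hf

@[fun_prop]
theorem PolyTime.cond {c : α → Bool} {f g : α → β} (hc : PolyTime c) (hf : PolyTime f)
    (hg : PolyTime g) : PolyTime fun a => bif c a then f a else g a := by
  obtain ⟨R, U, l1, l2, l3⟩ := hc
  obtain ⟨P, T, h1, h2, h3⟩ := hf
  obtain ⟨Q, S, k1, k2, k3⟩ := hg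
  refine ⟨.ite R P Q, fun a => U a + (T a + S a) + 1, (l1.add (h1.add k1)).add (.const 1),
    (h2.add k2).mono fun a => by
      dsimp only; cases c a <;> simp only [cond_true, cond_false] <;> omega, fun a => ?_⟩
  obtain ⟨t, ht, r⟩ := h3 a
  obtain ⟨u, hu, r'⟩ := k3 a
  obtain ⟨v, hv, r''⟩ := l3 a
  cases hca : c a
  · rw [hca] at r''
    exact ⟨v + u + 1, by dsimp only; omega, by simpa [hca] using .ite_false r'' r'⟩
  · rw [hca] at r''
    exact ⟨v + t + 1, by dsimp only; omega, by simpa [hca] using .ite_true r'' (by simp) r⟩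

/-! ### Arithmetic -/

lemma bitLength_lt (z : ℤ) : bitLength z ≤ z.natAbs :=
  Nat.size_le.2 Nat.lt_two_pow_self

/-- The product of the unary sizes bounds the cost, since a bit length is at most the absolute
value. It also bounds all results; for `mod` the case `b = 0` returns `a`. -/
theorem polyTime_arith (o : ArithOp) : PolyTime fun p : ℤ × ℤ => o.eval p.1 p.2 := by
  refine ⟨.arith o, fun p => (sz p.1) * (sz p.2), polyTime_fst.bdd.mul polyTime_snd.bdd,
    ((PolyBdd.const 2).mul (polyTime_fst.bdd.mul polyTime_snd.bdd)).mono fun p => ?_, fun p =>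
      ⟨_, ?_, .arith o p.1 p.2⟩⟩
  · obtain ⟨a, b⟩ := p
    simp only [sz_int]
    have hm : (a.natAbs + 1) * (b.natAbs + 1) =
        a.natAbs * b.natAbs + a.natAbs + b.natAbs + 1 := by ring
    rw [hm]
    have key : (o.eval a b).natAbs ≤ a.natAbs * b.natAbs + a.natAbs + b.natAbs + 1 := by
      cases o <;> simp only [ArithOp.eval]
      · have := Int.natAbs_add_le a b
        omega
      · have := Int.natAbs_sub_le a b
        omega
      · rw [Int.natAbs_mul]
        omega
      · have := Int.natAbs_ediv_le_natAbs a b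
        omega
      · rcases eq_or_ne b 0 with rfl | hb
        · simp
        · have h1 := Int.emod_nonneg a hb
          have h2 := Int.emod_lt_abs a hb
          rw [Int.abs_eq_natAbs] at h2
          omega
      · split_ifs <;> simp
    omega
  · simp only [sz_int]
    have h1 := bitLength_lt p.1
    have h2 := bitLength_lt p.2
    exact Nat.mul_le_mul (by omega) (by omega)

@[fun_prop]
theorem PolyTime.add {f g : α → ℤ} (hf : PolyTime f) (hg : PolyTime g) :
    PolyTime fun a => f a + g a := (polyTime_arith .add).comp (hf.prodMk hg)

@[fun_prop]
theorem PolyTime.sub {f g : α → ℤ} (hf : PolyTime f) (hg : PolyTime g) :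
    PolyTime fun a => f a - g a := (polyTime_arith .sub).comp (hf.prodMk hg)

@[fun_prop]
theorem PolyTime.mul {f g : α → ℤ} (hf : PolyTime f) (hg : PolyTime g) :
    PolyTime fun a => f a * g a := (polyTime_arith .mul).comp (hf.prodMk hg)

@[fun_prop]
theorem PolyTime.div {f g : α → ℤ} (hf : PolyTime f) (hg : PolyTime g) :
    PolyTime fun a => f a / g a := (polyTime_arith .div).comp (hf.prodMk hg)

@[fun_prop]
theorem PolyTime.mod {f g : α → ℤ} (hf : PolyTime f) (hg : PolyTime g) :
    PolyTime fun a => f a % g a := (polyTime_arith .mod).comp (hf.prodMk hg)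

@[fun_prop]
theorem PolyTime.neg {f : α → ℤ} (hf : PolyTime f) : PolyTime fun a => - f a := by
  simpa using (PolyTime.const (α := α) (0 : ℤ)).sub hf

/-- Comparison of integers. -/
def zle (a b : ℤ) : Bool := decide (a ≤ b)

/-- Equality of integers. -/
def zeq (a b : ℤ) : Bool := zle a b && zle b a

lemma zle_iff (a b : ℤ) : zle a b = true ↔ a ≤ b := by simp [zle]
lemma zeq_iff (a b : ℤ) : zeq a b = true ↔ a = b := by simp only [zeq, zle, Bool.and_eq_true, decide_eq_true_eq]; omega

/-- Functions with the same encodings are computed by the same programs. -/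
lemma PolyTime.of_enc {f : α → β} {g : α → γ} (hf : PolyTime f) (h : ∀ a, enc (f a) = enc (g a)) :
    PolyTime g := by
  obtain ⟨P, T, h1, h2, h3⟩ := hf
  refine ⟨P, T, h1, h2.mono fun a => ?_, fun a => ?_⟩
  · simp [sz, h]
  · rw [← h]; exact h3 a

@[fun_prop]
theorem PolyTime.zle {f g : α → ℤ} (hf : PolyTime f) (hg : PolyTime g) :
    PolyTime fun a => zle (f a) (g a) := by
  refine ((polyTime_arith .le).comp (hf.prodMk hg)).of_enc fun a => ?_
  by_cases h : f a ≤ g a <;> simp [ArithOp.eval, EmptySimplices.zle, enc, h]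

@[fun_prop]
theorem PolyTime.and {f g : α → Bool} (hf : PolyTime f) (hg : PolyTime g) :
    PolyTime fun a => f a && g a := by
  have : PolyTime fun a => bif f a then g a else false := by fun_prop
  refine this.of_enc fun a => ?_
  cases f a <;> rfl

@[fun_prop]
theorem PolyTime.or {f g : α → Bool} (hf : PolyTime f) (hg : PolyTime g) :
    PolyTime fun a => f a || g a := by
  have : PolyTime fun a => bif f a then true else g a := by fun_prop
  refine this.of_enc fun a => ?_
  cases f a <;> rfl

@[fun_prop]
theorem PolyTime.not {f : α → Bool} (hf : PolyTime f) : PolyTime fun a => !(f a) := by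
  have : PolyTime fun a => bif f a then false else true := by fun_prop
  refine this.of_enc fun a => ?_
  cases f a <;> rfl

@[fun_prop]
theorem PolyTime.zeq {f g : α → ℤ} (hf : PolyTime f) (hg : PolyTime g) :
    PolyTime fun a => zeq (f a) (g a) := by
  unfold EmptySimplices.zeq; fun_prop

@[fun_prop]
theorem PolyTime.natCast {f : α → ℕ} (hf : PolyTime f) : PolyTime fun a => (f a : ℤ) :=
  hf.of_enc fun _ => rfl

@[fun_prop]
theorem PolyTime.toNat {f : α → ℤ} (hf : PolyTime f) : PolyTime fun a => (f a).toNat := by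
  have : PolyTime fun a => bif EmptySimplices.zle 0 (f a) then f a else 0 := by fun_prop
  refine this.of_enc fun a => ?_
  by_cases h : 0 ≤ f a
  · simp [EmptySimplices.zle, h, enc]
  · simp [EmptySimplices.zle, h, enc, Int.toNat_of_nonpos (not_le.1 h).le]

@[fun_prop]
theorem PolyTime.natAdd {f g : α → ℕ} (hf : PolyTime f) (hg : PolyTime g) :
    PolyTime fun a => f a + g a := by
  have : PolyTime fun a => (f a : ℤ) + g a := by fun_prop
  exact this.of_enc fun a => by simp [enc]

@[fun_prop]
theorem PolyTime.natMul {f g : α → ℕ} (hf : PolyTime f) (hg : PolyTime g) :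
    PolyTime fun a => f a * g a := by
  have : PolyTime fun a => (f a : ℤ) * g a := by fun_prop
  exact this.of_enc fun a => by simp [enc]

/-! ### Lists -/

@[fun_prop]
theorem PolyTime.cons {f : α → β} {g : α → List β} (hf : PolyTime f) (hg : PolyTime g) :
    PolyTime fun a => f a :: g a := (hf.prodMk hg).of_enc fun _ => rfl

@[fun_prop]
theorem PolyTime.isEmpty {f : α → List β} (hf : PolyTime f) : PolyTime fun a => (f a).isEmpty := by
  have : PolyTime fun l : List β => l.isEmpty := by
    refine ⟨.isNum, fun _ => 1, .const 1, (PolyBdd.const 2).mono fun _ => sz_bool _, fun l =>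
      ⟨1, le_rfl, ?_⟩⟩
    cases l
    · exact .isNum_num _
    · exact .isNum_pair _ _
  exact this.comp hf

theorem polyTime_tail : PolyTime fun l : List β => l.tail := by
  refine ⟨.ite .isNum .id .snd, fun _ => 3, .const _, PolyBdd.self.mono fun a => ?_, fun l =>
      ⟨3, le_rfl, ?_⟩⟩
  · cases a
    · exact le_rfl
    · simp only [List.tail_cons, sz_cons]; omega
  · cases l
    · exact .ite_true (.isNum_num _) (by simp) (.id _)
    · exact .ite_false (.isNum_pair _ _) (.snd _ _)

@[fun_prop]
theorem PolyTime.tail {f : α → List β} (hf : PolyTime f) : PolyTime fun a => (f a).tail :=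
  polyTime_tail.comp hf

theorem polyTime_headD : PolyTime fun p : List β × β => p.1.headD p.2 := by
  refine ⟨.ite (.seq .fst .isNum) .snd (.seq .fst .fst), fun _ => 10, .const _,
    PolyBdd.self.mono fun a => ?_, fun l => ?_⟩
  · obtain ⟨_ | ⟨a, l⟩, b⟩ := a
    · simp only [List.headD_nil, sz_prod]; omega
    · simp only [List.headD_cons, sz_prod, sz_cons]; omega
  · obtain ⟨_ | ⟨a, l⟩, b⟩ := l
    · exact ⟨_, by norm_num, .ite_true (.seq (.fst _ _) (.isNum_num _)) (by simp) (.snd _ _)⟩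
    · exact ⟨_, by norm_num, .ite_false (.seq (.fst _ _) (.isNum_pair _ _)) (.seq (.fst _ _) (.fst _ _))⟩

@[fun_prop]
theorem PolyTime.headD {f : α → List β} {g : α → β} (hf : PolyTime f) (hg : PolyTime g) :
    PolyTime fun a => (f a).headD (g a) := polyTime_headD.comp (hf.prodMk hg)

end basic
end EmptySimplices

namespace EmptySimplices
open EmptySimplices.Enc (enc)
section lists
variable {α β γ σ X : Type} [Enc α] [Enc β] [Enc γ] [Enc σ] [Enc X]

/-- Does not return `0` iff the input is a pair. -/
def Program.isPair : Program := .ite .isNum (.const 0) (.const 1)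

lemma runs_isPair_nil : Runs .isPair (enc ([] : List α)) (.num 0) 3 :=
  .ite_true (.isNum_num _) (by simp) (.const _ _)

lemma runs_isPair_cons (a : α) (l : List α) : Runs .isPair (enc (a :: l)) (.num 1) 3 :=
  .ite_false (.isNum_pair _ _) (.const _ _)

/-- Folds `P` over a list: the state is `(x, (s, l))` with an environment `x`, an accumulator `s`
and a list `l`. -/
def Program.fold (P : Program) : Program :=
  .seq (.loop (.seq .snd (.seq .snd .isPair))
    (.pair .fst (.pair (.seq (.pair .fst (.pair (.seq .snd .fst) (.seq .snd (.seq .snd .fst)))) P)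
      (.seq .snd (.seq .snd .snd))))) (.seq .snd .fst)

/-- `K` has to bound the cost of the body only at the accumulators that occur in the run, which are
the folds over prefixes of `l`. -/
lemma runs_fold {f : X → σ → α → σ} {P : Program} {T : X × σ × α → ℕ}
    (hP : ∀ p, ∃ t ≤ T p, Runs P (enc p) (enc (f p.1 p.2.1 p.2.2)) t) (K : ℕ) (x : X) (l : List α)
    (s : σ) (hK : ∀ l' a, l' ++ [a] <+: l → T (x, l'.foldl (f x) s, a) ≤ K) :
    ∃ t ≤ (l.length + 1) * (K + 50), Runs P.fold (enc (x, s, l)) (enc (l.foldl (f x) s)) t := by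
  suffices h : ∃ t ≤ l.length * (K + 50) + 10, Runs (.loop (.seq .snd (.seq .snd .isPair))
    (.pair .fst (.pair (.seq (.pair .fst (.pair (.seq .snd .fst) (.seq .snd (.seq .snd .fst)))) P)
      (.seq .snd (.seq .snd .snd))))) (enc (x, s, l)) (enc (x, l.foldl (f x) s, ([] : List α))) t by
    obtain ⟨t, ht, r⟩ := h
    exact ⟨t + (1 + 1 + 1) + 1, by rw [add_mul]; omega, .seq r (.seq (.snd _ _) (.fst _ _))⟩
  induction l generalizing s with
  | nil =>
    exact ⟨_, by norm_num, Runs.loop_stop (.seq (.snd _ _) (.seq (.snd _ _) runs_isPair_nil))⟩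
  | cons a l ih =>
    obtain ⟨t, ht, r⟩ := ih (f x s a) fun l' b hb => by
      simpa using hK (a :: l') b (by simpa using hb)
    obtain ⟨u, hu, r'⟩ := hP (x, s, a)
    have hu' : u ≤ K := hu.trans (hK [] a (by simp))
    refine ⟨_, ?_, .loop_step (.seq (.snd _ _) (.seq (.snd _ _) (runs_isPair_cons a l)))
      one_ne_zero (.pair (.fst _ _) (.pair (.seq (.pair (.fst _ _) (.pair (.seq (.snd _ _) (.fst _ _))
        (.seq (.snd _ _) (.seq (.snd _ _) (.fst _ _))))) r')
        (.seq (.snd _ _) (.seq (.snd _ _) (.snd _ _))))) r⟩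
    simp only [List.length_cons, add_mul]
    omega

/-- Folding over a list takes polynomial time when the accumulator stays polynomially bounded. -/
theorem PolyTime.foldl {f : X → σ → α → σ} {s : X → σ} {l : X → List α}
    (hf : PolyTime fun p : X × σ × α => f p.1 p.2.1 p.2.2) (hs : PolyTime s) (hl : PolyTime l)
    {B : X → ℕ} (hB : PolyBdd B) (hb : ∀ x l', l' <+: l x → sz (l'.foldl (f x) (s x)) ≤ B x) :
    PolyTime fun x => (l x).foldl (f x) (s x) := by
  obtain ⟨P, T, ⟨C, hC⟩, h2, h3⟩ := hf
  have hin : PolyTime fun x => (x, s x, l x) := by fun_prop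
  obtain ⟨Q, U, k1, k2, k3⟩ := hin
  -- The body is applied to the environment, an accumulator and a list element; the last two have
  -- sizes at most `B x` and `sz (l x)`.
  have hK : PolyBdd fun x => (sz x + (B x + sz (l x) + 1) + 1 + 1) ^ C :=
    (((PolyBdd.self.add ((hB.add hl.bdd).add (.const 1))).add (.const 1)).add (.const 1)).pow C
  refine ⟨.seq Q P.fold, fun x => U x + (sz (l x) * ((sz x + (B x + sz (l x) + 1) + 1 + 1) ^ C + 50)) + 1,
    (k1.add (hl.bdd.mul (hK.add (.const 50)))).add (.const 1), hB.mono fun x => hb x _ List.prefix_rfl,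
    fun x => ?_⟩
  obtain ⟨u, hu, r⟩ := k3 x
  obtain ⟨t, ht, r'⟩ := runs_fold (f := f) h3 ((sz x + (B x + sz (l x) + 1) + 1 + 1) ^ C) x (l x) (s x)
    fun l' a h => (hC _).trans (Nat.pow_le_pow_left (by
      have h1 := hb x l' ((List.prefix_append l' [a]).trans h)
      have h2 : sz a ≤ sz (l x) := sz_le_of_mem (h.subset (by simp))
      simp only [sz_prod]
      omega) _)
  have := Nat.mul_le_mul_right ((sz x + (B x + sz (l x) + 1) + 1 + 1) ^ C + 50)
    (length_lt_sz (l x))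
  rw [Nat.succ_eq_add_one] at this
  exact ⟨u + t + 1, by dsimp only; omega, .seq r r'⟩

@[fun_prop]
theorem PolyTime.reverseAux {f g : X → List α} (hf : PolyTime f) (hg : PolyTime g) :
    PolyTime fun x => (f x).reverseAux (g x) := by
  have h : ∀ l m : List α, l.foldl (fun s a => a :: s) m = l.reverseAux m := fun l m => by
    induction l generalizing m with
    | nil => rfl
    | cons a l ih => simp [ih, List.reverseAux]
  simp only [← h]
  refine PolyTime.foldl (f := fun _ s a => a :: s) (by fun_prop) hg hf (hf.bdd.add hg.bdd)
    fun x l' hl' => ?_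
  rw [h, List.reverseAux_eq]
  have h1 := sz_append l'.reverse (g x)
  have h2 := sz_prefix_le hl'
  rw [sz_reverse] at h1
  omega

@[fun_prop]
theorem PolyTime.reverse {f : X → List α} (hf : PolyTime f) : PolyTime fun x => (f x).reverse := by
  exact hf.reverseAux (.const [])

@[fun_prop]
theorem PolyTime.append {f g : X → List α} (hf : PolyTime f) (hg : PolyTime g) :
    PolyTime fun x => f x ++ g x := by
  have : ∀ x, f x ++ g x = (f x).reverse.reverseAux (g x) := fun x => by simp [List.reverseAux_eq]
  simp only [this]
  fun_prop

lemma sz_flatMap_le {α : Type} {f : α → List β} {l : List α} {m : ℕ} (h : ∀ a ∈ l, sz (f a) ≤ m) :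
    sz (l.flatMap f) ≤ l.length * m + 1 := by
  induction l with
  | nil => simp [sz_nil]
  | cons a l ih =>
    have h1 := ih fun a ha => h a (List.mem_cons_of_mem _ ha)
    have h2 := h a List.mem_cons_self
    have h3 := sz_append (f a) (l.flatMap f)
    simp only [List.flatMap_cons, List.length_cons, add_mul]
    omega

@[fun_prop]
theorem PolyTime.flatMap {l : X → List α} {f : X → α → List β} (hl : PolyTime l)
    (hf : PolyTime fun p : X × α => f p.1 p.2) : PolyTime fun x => (l x).flatMap (f x) := by
  -- Pushing elements onto the accumulator produces the result in reverse order, so one final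
  -- reversal is needed.
  have h : ∀ (x : X) (l : List α) (s : List β),
      l.foldl (fun s a => (f x a).reverseAux s) s = (l.flatMap (f x)).reverse ++ s := fun x l => by
    induction l with
    | nil => simp
    | cons a l ih =>
      intro s
      rw [List.foldl_cons, ih, List.reverseAux_eq, List.flatMap_cons, List.reverse_append,
        List.append_assoc]
  have h' : ∀ x, (l x).flatMap (f x) =
      ((l x).foldl (fun s a => (f x a).reverseAux s) []).reverse := fun x => by
    rw [h, List.append_nil, List.reverse_reverse]
  simp only [h']
  refine PolyTime.reverse ?_
  have hf' : PolyTime fun p : X × List β × α => f p.1 p.2.2 :=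
    hf.comp (f := fun p : X × α => f p.1 p.2) (g := fun p : X × List β × α => (p.1, p.2.2)) (by fun_prop)
  obtain ⟨C, hC⟩ := hf.bdd
  refine PolyTime.foldl (f := fun x s a => (f x a).reverseAux s) (by fun_prop) (.const [])
    hl (B := fun x => sz (l x) * (sz x + sz (l x) + 1 + 1) ^ C + 1)
    ((hl.bdd.mul ((((PolyBdd.self.add hl.bdd).add (.const 1)).add (.const 1)).pow C)).add (.const 1))
    fun x l' hl' => ?_
  rw [h, List.append_nil, sz_reverse]
  refine (sz_flatMap_le (m := (sz x + sz (l x) + 1 + 1) ^ C) fun a ha => (hC (x, a)).trans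
    (Nat.pow_le_pow_left ?_ _)).trans ?_
  · have := sz_le_of_mem (hl'.subset ha)
    simp only [sz_prod]
    omega
  · gcongr
    exact hl'.length_le.trans (length_lt_sz _).le

@[fun_prop]
theorem PolyTime.map {l : X → List α} {f : X → α → β} (hl : PolyTime l)
    (hf : PolyTime fun p : X × α => f p.1 p.2) : PolyTime fun x => (l x).map (f x) := by
  have : ∀ x, (l x).map (f x) = (l x).flatMap fun a => [f x a] := fun x =>
    List.map_eq_flatMap
  simp only [this]
  fun_prop

@[fun_prop]
theorem PolyTime.filter {l : X → List α} {f : X → α → Bool} (hl : PolyTime l)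
    (hf : PolyTime fun p : X × α => f p.1 p.2) : PolyTime fun x => (l x).filter (f x) := by
  have : ∀ x, (l x).filter (f x) = (l x).flatMap fun a => bif f x a then [a] else [] := fun x => by
    induction l x with
    | nil => rfl
    | cons a l ih => cases h : f x a <;> simp [h, ih]
  simp only [this]
  fun_prop

@[fun_prop]
theorem PolyTime.any {l : X → List α} {f : X → α → Bool} (hl : PolyTime l)
    (hf : PolyTime fun p : X × α => f p.1 p.2) : PolyTime fun x => (l x).any (f x) := by
  have : ∀ x, (l x).any (f x) = !((l x).filter (f x)).isEmpty := fun x => by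
    rw [Bool.eq_iff_iff]; simp
  simp only [this]
  fun_prop

@[fun_prop]
theorem PolyTime.all {l : X → List α} {f : X → α → Bool} (hl : PolyTime l)
    (hf : PolyTime fun p : X × α => f p.1 p.2) : PolyTime fun x => (l x).all (f x) := by
  have : ∀ x, (l x).all (f x) = !(l x).any fun a => !f x a := fun x =>
    List.all_eq_not_any_not
  simp only [this]
  fun_prop

@[fun_prop]
theorem PolyTime.sum {l : X → List ℤ} (hl : PolyTime l) : PolyTime fun x => (l x).sum := by
  have : ∀ x, (l x).sum = (l x).foldl (fun s a => s + a) 0 := fun x => by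
    rw [List.sum_eq_foldl]
  simp only [this]
  refine PolyTime.foldl (f := fun _ s a => s + a) (by fun_prop) (.const 0) hl (B := fun x => sz (l x)) hl.bdd
    fun x l' hl' => (le_trans ?_ (sz_prefix_le hl'))
  rw [← List.sum_eq_foldl]
  clear hl'
  induction l' with
  | nil => simp [sz_nil, sz_int]
  | cons a l ih =>
    simp only [List.sum_cons, sz_cons, sz_int] at *
    omega

/-- Replaces `(i, l)` by `(i - 1, (i - 1) :: l)` as long as `i` is positive, beginning with an empty
list. -/
def Program.range : Program :=
  .seq (.pair .id (.const 0)) (.seq (.loop (.seq (.pair (.const 1) .fst) (.arith .le))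
    (.seq (.pair (.seq (.pair .fst (.const 1)) (.arith .sub)) .snd) (.pair .fst (.pair .fst .snd)))) .snd)

theorem polyTime_range : PolyTime List.range := by
  refine ⟨.range, fun n => (sz n + 1) * (6 * sz n + 50) + 50,
    ((PolyBdd.self.add (.const 1)).mul (((PolyBdd.const 6).mul .self).add (.const 50))).add (.const 50),
    (PolyBdd.self.mul (PolyBdd.self.add (.const 1))).mono fun n => ?_, fun n => ?_⟩
  · refine (sz_list_le (m := n) fun a ha => ?_).trans ?_
    · have := List.mem_range.1 ha
      rw [sz_nat]; omega
    · rw [List.length_range, sz_nat]; nlinarith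
  · suffices h : ∀ i ≤ n, ∀ l : List ℕ, ∃ t ≤ i * (6 * sz n + 30) + 20,
        Runs (.loop (.seq (.pair (.const 1) .fst) (.arith .le))
          (.seq (.pair (.seq (.pair .fst (.const 1)) (.arith .sub)) .snd)
            (.pair .fst (.pair .fst .snd))))
        (enc (i, l)) (enc (0, List.range i ++ l)) t by
      obtain ⟨t, ht, r⟩ := h n le_rfl []
      have r' : Runs .snd (enc (0, List.range n ++ ([] : List ℕ))) (enc (List.range n)) 1 := by
        rw [List.append_nil]; exact .snd _ _
      refine ⟨_, ?_, .seq (.pair (.id _) (.const _ _)) (.seq r r')⟩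
      simp only [sz_nat] at *
      nlinarith
    intro i
    induction i with
    | zero =>
      intro _ l
      refine ⟨_, ?_, Runs.loop_stop (.seq (.pair (.const _ _) (.fst _ _)) (.arith .le _ _))⟩
      simp [bitLength]
    | succ i ih =>
      intro hi l
      obtain ⟨t, ht, r⟩ := ih (by omega) (i :: l)
      have h1 := Runs.arith .le 1 ((i + 1 : ℕ) : ℤ)
      have h2 := Runs.arith .sub ((i + 1 : ℕ) : ℤ) 1
      have e1 : ArithOp.le.eval 1 ((i + 1 : ℕ) : ℤ) = 1 := by simp [ArithOp.eval]
      have e2 : ArithOp.sub.eval ((i + 1 : ℕ) : ℤ) 1 = (i : ℕ) := by simp [ArithOp.eval]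
      rw [e1] at h1
      rw [e2] at h2
      have h3 := bitLength_lt ((i + 1 : ℕ) : ℤ)
      rw [Int.natAbs_natCast] at h3
      have e3 : bitLength 1 = 1 := by simp [bitLength]
      rw [show List.range (i + 1) ++ l = List.range i ++ i :: l by simp [List.range_succ]]
      refine ⟨_, ?_, .loop_step (.seq (.pair (.const _ _) (.fst _ _)) h1) one_ne_zero
        (.seq (.pair (.seq (.pair (.fst _ _) (.const _ _)) h2) (.snd _ _))
          (.pair (.fst _ _) (.pair (.fst _ _) (.snd _ _)))) r⟩
      rw [e3]
      simp only [sz_nat, add_mul] at *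
      omega

@[fun_prop]
theorem PolyTime.range {f : X → ℕ} (hf : PolyTime f) : PolyTime fun x => List.range (f x) :=
  polyTime_range.comp hf

@[fun_prop]
theorem PolyTime.length {f : X → List α} (hf : PolyTime f) : PolyTime fun x => (f x).length := by
  have : PolyTime fun x => ((f x).map fun _ => (1 : ℤ)).sum := by fun_prop
  exact this.of_enc fun x => by simp [enc]

@[fun_prop]
theorem PolyTime.drop {n : X → ℕ} {f : X → List α} (hn : PolyTime n) (hf : PolyTime f) :
    PolyTime fun x => (f x).drop (n x) := by
  have h : ∀ (l : List α) m, (List.range m).foldl (fun s _ => s.tail) l = l.drop m := fun l m => by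
    induction m with
    | zero => simp
    | succ m ih => simp [List.range_succ, ih]
  simp only [← h]
  refine PolyTime.foldl (l := fun x => List.range (n x)) (f := fun _ s _ => s.tail) (by fun_prop) hf (by fun_prop) hf.bdd
    fun x l' _ => ?_
  have h2 : ∀ (k : List ℕ) (l : List α), sz (k.foldl (fun s _ => s.tail) l) ≤ sz l := fun k => by
    induction k with
    | nil => exact fun _ => le_rfl
    | cons a k ih => exact fun l => (ih _).trans (sz_suffix_le (List.tail_suffix l))
  exact h2 _ _

@[fun_prop]
theorem PolyTime.getD {n : X → ℕ} {f : X → List α} {d : X → α} (hf : PolyTime f) (hn : PolyTime n)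
    (hd : PolyTime d) : PolyTime fun x => (f x).getD (n x) (d x) := by
  have h : ∀ x, (f x).getD (n x) (d x) = ((f x).drop (n x)).headD (d x) := fun x => by
    simp [List.getD_eq_getElem?_getD, List.headD_eq_head?_getD]
  simp only [h]
  fun_prop

@[fun_prop]
theorem PolyTime.replicate {n : X → ℕ} {f : X → α} (hn : PolyTime n) (hf : PolyTime f) :
    PolyTime fun x => List.replicate (n x) (f x) := by
  have : ∀ x, List.replicate (n x) (f x) = (List.range (n x)).map fun _ => f x := fun x => by simp
  simp only [this]
  fun_prop

end lists
end EmptySimplices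

namespace EmptySimplices
open EmptySimplices.Enc (enc)
-- Depth-first exploration of a tree.
section search
variable {ι ρ : Type} [Enc ι] [Enc ρ]

/-- `(l, m) ↦ l.reverseAux m`. -/
def Program.reverseAux : Program :=
  .seq (.loop (.seq .fst .isPair) (.pair (.seq .fst .snd) (.pair (.seq .fst .fst) .snd))) .snd

/-- The cost depends on `l` alone. Result lists may be much longer than any node, so adding new
results must not cost anything in terms of the old ones. -/
lemma runs_reverseAux (l m : List ρ) :
    Runs .reverseAux (enc (l, m)) (enc (l.reverseAux m)) (15 * l.length + 8) := by
  have h : Runs (.loop (.seq .fst .isPair) (.pair (.seq .fst .snd) (.pair (.seq .fst .fst) .snd)))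
      (enc (l, m)) (enc (([] : List ρ), l.reverseAux m)) (15 * l.length + 6) := by
    induction l generalizing m with
    | nil =>
      have := Runs.loop_stop (p := .pair (.seq .fst .snd) (.pair (.seq .fst .fst) .snd))
        (.seq (.fst _ (enc m)) (runs_isPair_nil (α := ρ)))
      exact this
    | cons a l ih =>
      have := Runs.loop_step (.seq (.fst _ _) (runs_isPair_cons a l)) one_ne_zero
        (.pair (.seq (.fst _ _) (.snd _ _)) (.pair (.seq (.fst _ _) (.fst _ _)) (.snd _ _)))
        (ih (a :: m))
      rw [show 15 * (a :: l).length + 6 = 5 + 9 + (15 * l.length + 6) + 1 by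
        rw [List.length_cons]; ring]
      exact this
  have h' := Runs.seq h (.snd _ _)
  exact h'

/-- Explores a tree with an explicit stack; `Q` computes the children and the results of a node. -/
def Program.search (Q : Program) : Program :=
  .seq (.pair (.pair .id (.const 0)) (.pair (.const 0) (.const 0)))
    (.seq (.loop (.seq .fst .isPair)
      (.seq (.pair (.seq (.seq .fst .fst) Q) .id)
        (.pair (.seq (.pair (.seq .fst .fst) (.seq .snd (.seq .fst .snd))) .reverseAux)
          (.pair
            (.seq (.pair (.seq .fst (.seq .snd .fst)) (.seq .snd (.seq .snd .fst))) .reverseAux)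
            (.seq (.pair (.seq .fst (.seq .snd .snd)) (.seq .snd (.seq .snd .snd)))
              .reverseAux))))) .snd)

/-- Exploration of a tree: `expand` lists the children of a node, `f` and `g` list its results. The
running time is bounded by the number of nodes times a polynomial in the size of the nodes. -/
theorem exists_program_search {expand : ι → List ι} {f g : ι → List ρ} (he : PolyTime expand)
    (hf : PolyTime f) (hg : PolyTime g) :
    ∃ (P : Program) (C : ℕ), ∀ (good : ι → Prop) (N : ι → ℕ) (M : ℕ),
      (∀ i, good i → sz i ≤ M) → (∀ i, good i → ∀ j ∈ expand i, good j) →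
      (∀ i, good i → 1 + ((expand i).map N).sum ≤ N i) → ∀ i, good i →
      ∃ (S L : List ρ) (t : ℕ), Runs P (enc i) (enc (S, L)) t ∧ t ≤ (N i + 1) * (M + 1) ^ C ∧
        (∀ r, r ∈ S ↔ ∃ j, Relation.ReflTransGen (fun a b => b ∈ expand a) i j ∧ r ∈ f j) ∧
        (∀ r, r ∈ L ↔ ∃ j, Relation.ReflTransGen (fun a b => b ∈ expand a) i j ∧ r ∈ g j) := by
  have hQ : PolyTime fun i => (expand i, f i, g i) := by fun_prop
  obtain ⟨Q, T, h1, h2, h3⟩ := hQ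
  obtain ⟨C, hC⟩ := (h1.add ((PolyBdd.const 15).mul h2)).add (.const 100)
  refine ⟨.search Q, C, fun good N M hM hgood hN i hi => ?_⟩
  have hcost : ∀ i, good i → T i + 15 * sz (expand i, f i, g i) + 100 ≤ (M + 1) ^ C :=
    fun i hi => (hC i).trans (Nat.pow_le_pow_left (by have := hM i hi; omega) _)
  generalize (M + 1) ^ C = K at hcost
  -- Induction on a bound `k` for the total potential of the stack. Replacing a node by its children
  -- lowers this total by at least one, so there are at most `k` iterations.
  suffices h : ∀ (k : ℕ) (st : List ι) (a b : List ρ), (∀ j ∈ st, good j) → (st.map N).sum ≤ k →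
      ∃ (S L : List ρ) (t : ℕ), Runs (.loop (.seq .fst .isPair)
      (.seq (.pair (.seq (.seq .fst .fst) Q) .id)
        (.pair (.seq (.pair (.seq .fst .fst) (.seq .snd (.seq .fst .snd))) .reverseAux)
          (.pair
            (.seq (.pair (.seq .fst (.seq .snd .fst)) (.seq .snd (.seq .snd .fst))) .reverseAux)
            (.seq (.pair (.seq .fst (.seq .snd .snd)) (.seq .snd (.seq .snd .snd)))
              .reverseAux))))) (enc (st, a, b)) (enc (([] : List ι), S, L)) t ∧
        t ≤ k * K + 10 ∧
        (∀ r, r ∈ S ↔ r ∈ a ∨ ∃ i ∈ st, ∃ j,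
          Relation.ReflTransGen (fun a b => b ∈ expand a) i j ∧ r ∈ f j) ∧
        (∀ r, r ∈ L ↔ r ∈ b ∨ ∃ i ∈ st, ∃ j,
          Relation.ReflTransGen (fun a b => b ∈ expand a) i j ∧ r ∈ g j) by
    obtain ⟨S, L, t, hr, ht, hS, hL⟩ := h (N i) [i] [] [] (by simpa using hi) (by simp)
    refine ⟨S, L, _, .seq (.pair (.pair (.id _) (.const _ _)) (.pair (.const _ _) (.const _ _)))
      (.seq hr (.snd _ _)), ?_, by simpa using hS, by simpa using hL⟩
    have := hcost i hi
    rw [add_mul]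
    omega
  intro k
  induction k with
  | zero =>
    intro st a b hst hk
    cases st with
    | nil => exact ⟨a, b, _, Runs.loop_stop (.seq (.fst _ _) runs_isPair_nil), by norm_num, by simp, by simp⟩
    | cons i st =>
      have := hN i (hst i (by simp))
      simp only [List.map_cons, List.sum_cons] at hk
      omega
  | succ k ih =>
    intro st a b hst hk
    cases st with
    | nil =>
      exact ⟨a, b, _, Runs.loop_stop (.seq (.fst _ _) runs_isPair_nil), by omega, by simp, by simp⟩
    | cons i st =>
      have hi := hst i (by simp)
      have hNi := hN i hi
      simp only [List.map_cons, List.sum_cons] at hk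
      obtain ⟨S, L, t, hr, ht, hS, hL⟩ := ih ((expand i).reverseAux st) ((f i).reverseAux a)
        ((g i).reverseAux b) (fun j hj => by
          rw [List.reverseAux_eq, List.mem_append, List.mem_reverse] at hj
          rcases hj with hj | hj
          · exact hgood i hi j hj
          · exact hst j (by simp [hj])) (by
          rw [List.reverseAux_eq, List.map_append, List.sum_append, List.map_reverse,
            List.sum_reverse]
          omega)
      obtain ⟨u, hu, r⟩ := h3 i
      -- Whatever is below the node on top of the stack is either a result of this node or lies
      -- below one of its children; this keeps the set of old and future results unchanged.
      have aux : ∀ (F : ι → List ρ) (x : List ρ) (r : ρ), (r ∈ (F i).reverseAux x ∨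
          ∃ i' ∈ (expand i).reverseAux st, ∃ j,
            Relation.ReflTransGen (fun a b => b ∈ expand a) i' j ∧ r ∈ F j) ↔
          (r ∈ x ∨ ∃ i' ∈ i :: st, ∃ j,
            Relation.ReflTransGen (fun a b => b ∈ expand a) i' j ∧ r ∈ F j) := by
        intro F x r
        simp only [List.reverseAux_eq, List.mem_append, List.mem_reverse, List.mem_cons]
        constructor
        · rintro ((h | h) | ⟨i', h | h, j, hj, hrj⟩)
          · exact .inr ⟨i, .inl rfl, i, .refl, h⟩
          · exact .inl h
          · exact .inr ⟨i, .inl rfl, j, .head h hj, hrj⟩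
          · exact .inr ⟨i', .inr h, j, hj, hrj⟩
        · rintro (h | ⟨i', rfl | h, j, hj, hrj⟩)
          · exact .inl (.inr h)
          · rcases hj.cases_head with rfl | ⟨c, hc, hj⟩
            · exact .inl (.inl hrj)
            · exact .inr ⟨c, .inl hc, j, hj, hrj⟩
          · exact .inr ⟨i', .inr h, j, hj, hrj⟩
      refine ⟨S, L, _, .loop_step (.seq (.fst _ _) (runs_isPair_cons i st)) one_ne_zero
        (.seq (.pair (.seq (.seq (.fst _ _) (.fst _ _)) r) (.id _))
          (.pair (.seq (.pair (.seq (.fst _ _) (.fst _ _))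
            (.seq (.snd _ _) (.seq (.fst _ _) (.snd _ _)))) (runs_reverseAux (expand i) st))
          (.pair (.seq (.pair (.seq (.fst _ _) (.seq (.snd _ _) (.fst _ _)))
            (.seq (.snd _ _) (.seq (.snd _ _) (.fst _ _)))) (runs_reverseAux (f i) a))
          (.seq (.pair (.seq (.fst _ _) (.seq (.snd _ _) (.snd _ _)))
            (.seq (.snd _ _) (.seq (.snd _ _) (.snd _ _)))) (runs_reverseAux (g i) b))))) hr, ?_,
        fun r => (hS r).trans (aux f a r), fun r => (hL r).trans (aux g b r)⟩
      have h4 := hcost i hi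
      have h5 := length_lt_sz (expand i)
      have h6 := length_lt_sz (f i)
      have h7 := length_lt_sz (g i)
      simp only [sz_prod] at h4
      rw [add_mul]
      omega

end search
end EmptySimplices

namespace EmptySimplices
open EmptySimplices.Enc (enc)

/-! ### The algorithm -/

/-- The `i`-th entry of a vector. -/
def gz (v : List ℤ) (i : ℕ) : ℤ := v.getD i 0

/-- The entry `(i, j)` of a matrix, given by the list of its rows. -/
def ent (A : List (List ℤ)) (i j : ℕ) : ℤ := gz (A.getD i []) j

/-- The scalar product of two vectors of length `n`. -/
def dotZ (n : ℕ) (a b : List ℤ) : ℤ := ((List.range n).map fun i => gz a i * gz b i).sum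

/-- The entry `j` of `Aᵀ τ`. -/
def colDot (n : ℕ) (A : List (List ℤ)) (j : ℕ) (τ : List ℤ) : ℤ :=
  ((List.range n).map fun i => ent A i j * gz τ i).sum

/-- The difference of two vectors of length `n`. -/
def vsub (n : ℕ) (a b : List ℤ) : List ℤ := (List.range n).map fun i => gz a i - gz b i

/-- The vector `c e_i`. -/
def unitVec (n i : ℕ) (c : ℤ) : List ℤ := (List.range n).map fun j : ℕ => bif zeq j i then c else 0

/-- The matrix `(d 0; v A)`. -/
def addRow (m d : ℕ) (v : List ℤ) (A : List (List ℤ)) : List (List ℤ) :=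
  ((d : ℤ) :: List.replicate m 0) :: (List.range m).map fun i => gz v i :: A.getD i []

/-- All vectors `(x, b)` with `0 ≤ x < d` and `b` in the given list, in decreasing order. -/
def boxExt (d : ℕ) (box : List (List ℤ)) : List (List ℤ) :=
  (List.range d).reverse.flatMap fun x : ℕ => box.map fun b => (x : ℤ) :: b

/-- The vectors `(x, d τ)` with `x ∈ [1, d δ]` and `x ≡ -v τ` modulo `δ`. -/
def tausExt (d δ m : ℕ) (v : List ℤ) (taus : List (List ℤ)) : List (List ℤ) :=
  taus.flatMap fun τ => (List.range d).map fun q : ℕ =>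
    ((δ : ℤ) * (q : ℤ) + δ - dotZ m v τ % δ) :: τ.map fun x => (d : ℤ) * x

/-- A partial matrix in Hermite normal form of size `m`, with additional data. -/
structure Node where
  /-- the dimension -/
  n : ℕ
  /-- the bound on the determinant -/
  Δ : ℕ
  /-- the size of the matrix -/
  m : ℕ
  /-- its determinant -/
  δ : ℕ
  /-- whether no unit column has been added yet -/
  ph : Bool
  /-- the rows of the matrix -/
  A : List (List ℤ)
  /-- the reduced vectors -/
  box : List (List ℤ)
  /-- the vectors `τ ∈ [1, δ]^m` with `Aᵀ τ ≡ 0` modulo `δ` -/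
  taus : List (List ℤ)
  /-- the vectors that may be used for the next unit column -/
  allow : List (List ℤ)

instance : Enc Node :=
  ⟨fun x => enc (x.n, x.Δ, x.m, x.δ, x.ph, x.A, x.box, x.taus, x.allow)⟩

section node
variable {X : Type} [Enc X]

lemma polyTime_node_prod :
    PolyTime fun x : Node => (x.n, x.Δ, x.m, x.δ, x.ph, x.A, x.box, x.taus, x.allow) :=
  (PolyTime.id (α := Node)).of_enc fun _ => rfl

@[fun_prop]
lemma PolyTime.node_n {f : X → Node} (hf : PolyTime f) : PolyTime fun x => (f x).n :=
  (polyTime_node_prod.comp hf).fst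
@[fun_prop]
lemma PolyTime.node_Δ {f : X → Node} (hf : PolyTime f) : PolyTime fun x => (f x).Δ :=
  (polyTime_node_prod.comp hf).snd.fst
@[fun_prop]
lemma PolyTime.node_m {f : X → Node} (hf : PolyTime f) : PolyTime fun x => (f x).m :=
  (polyTime_node_prod.comp hf).snd.snd.fst
@[fun_prop]
lemma PolyTime.node_δ {f : X → Node} (hf : PolyTime f) : PolyTime fun x => (f x).δ :=
  (polyTime_node_prod.comp hf).snd.snd.snd.fst
@[fun_prop]
lemma PolyTime.node_ph {f : X → Node} (hf : PolyTime f) : PolyTime fun x => (f x).ph :=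
  (polyTime_node_prod.comp hf).snd.snd.snd.snd.fst
@[fun_prop]
lemma PolyTime.node_A {f : X → Node} (hf : PolyTime f) : PolyTime fun x => (f x).A :=
  (polyTime_node_prod.comp hf).snd.snd.snd.snd.snd.fst
@[fun_prop]
lemma PolyTime.node_box {f : X → Node} (hf : PolyTime f) : PolyTime fun x => (f x).box :=
  (polyTime_node_prod.comp hf).snd.snd.snd.snd.snd.snd.fst
@[fun_prop]
lemma PolyTime.node_taus {f : X → Node} (hf : PolyTime f) : PolyTime fun x => (f x).taus :=
  (polyTime_node_prod.comp hf).snd.snd.snd.snd.snd.snd.snd.fst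
@[fun_prop]
lemma PolyTime.node_allow {f : X → Node} (hf : PolyTime f) : PolyTime fun x => (f x).allow :=
  (polyTime_node_prod.comp hf).snd.snd.snd.snd.snd.snd.snd.snd

@[fun_prop]
lemma PolyTime.node_mk {n Δ m δ : X → ℕ} {ph : X → Bool} {A box taus allow : X → List (List ℤ)}
    (h1 : PolyTime n) (h2 : PolyTime Δ) (h3 : PolyTime m) (h4 : PolyTime δ) (h5 : PolyTime ph)
    (h6 : PolyTime A) (h7 : PolyTime box) (h8 : PolyTime taus) (h9 : PolyTime allow) :
    PolyTime fun x => Node.mk (n x) (Δ x) (m x) (δ x) (ph x) (A x) (box x) (taus x) (allow x) :=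
  (h1.prodMk (h2.prodMk (h3.prodMk (h4.prodMk (h5.prodMk (h6.prodMk (h7.prodMk
    (h8.prodMk h9)))))))).of_enc fun _ => rfl

end node

/-- The node obtained by adding the unit column `(1, v)`, where `v` is the `j`-th allowed vector. -/
def Node.iChild (x : Node) (j : ℕ) : Node :=
  ⟨x.n, x.Δ, x.m + 1, x.δ, false, addRow x.m 1 ((x.allow.drop j).headD []) x.A, boxExt 1 x.box,
    tausExt 1 x.δ x.m ((x.allow.drop j).headD []) x.taus, boxExt 1 (x.allow.drop j)⟩

/-- The node obtained by adding the column `(d, v)`. -/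
def Node.tChild (x : Node) (d : ℕ) (v : List ℤ) : Node :=
  ⟨x.n, x.Δ, x.m + 1, d * x.δ, true, addRow x.m d v x.A, boxExt d x.box,
    tausExt d x.δ x.m v x.taus, boxExt d x.box⟩

/-- The children of a node. -/
def Node.expand (x : Node) : List Node :=
  bif zle (x.m + 1 : ℕ) x.n then
    (List.range x.allow.length).map x.iChild ++
      bif x.ph then
        (List.range (x.Δ + 1)).flatMap fun d : ℕ =>
          bif zle 2 d && zle (d * x.δ : ℕ) x.Δ then x.box.map (x.tChild d) else []
      else []
  else []

/-- Whether `y` belongs to the lattice generated by the columns, by duality. -/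
def inLat (n δ : ℕ) (taus : List (List ℤ)) (y : List ℤ) : Bool :=
  taus.all fun τ => zeq (dotZ n τ y % δ) 0

/-- The list of the layers `R, …, 0`; the layer `w` consists of the reduced vectors that are
congruent to some `y ≥ 0` with `τ y = w`. -/
def layers (n δ : ℕ) (taus box : List (List ℤ)) (τ : List ℤ) (R : ℕ) : List (List (List ℤ)) :=
  (List.range R).foldl (fun Ls _ => (box.filter fun g => (List.range n).any fun i =>
    (Ls.getD (gz τ i - 1).toNat []).any fun g' =>
      inLat n δ taus (vsub n (vsub n g (unitVec n i 1)) g')) :: Ls) [box.filter (inLat n δ taus)]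

/-- Whether `y` is congruent to an element of one of the layers. -/
def hits (n δ : ℕ) (taus : List (List ℤ)) (Ls : List (List (List ℤ))) (y : List ℤ) : Bool :=
  Ls.any fun L => L.any fun g => inLat n δ taus (vsub n y g)

/-- The system `A x ≤ h`, `-(Aᵀ τ / δ) x ≤ c₀`. -/
def mkSystem (n δ : ℕ) (A : List (List ℤ)) (τ h : List ℤ) (c₀ : ℤ) : List (List ℤ) × List ℤ :=
  (A ++ [(List.range n).map fun j => -(colDot n A j τ / δ)], h ++ [c₀])

/-- No integer in `[2, Δ]` divides an inequality of the system. -/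
def gcdOk (n Δ : ℕ) (s : List (List ℤ) × List ℤ) : Bool :=
  (List.range (n + 1)).all fun i => (List.range (Δ + 1)).all fun e =>
    !(zle 2 e && ((List.range n).all (fun j => zeq (ent s.1 i j % e) 0) && zeq (gz s.2 i % e) 0))

/-- `δ c₀ + τ h`. -/
def slack (n δ : ℕ) (τ h : List ℤ) (c₀ : ℤ) : ℤ := δ * c₀ + dotZ n τ h

/-- Whether the system defines an empty simplex. -/
def emptyOk (x : Node) (τ h : List ℤ) (c₀ : ℤ) : Bool :=
  zle 1 (slack x.n x.δ τ h c₀) && (gcdOk x.n x.Δ (mkSystem x.n x.δ x.A τ h c₀) &&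
    !(hits x.n x.δ x.taus (layers x.n x.δ x.taus x.box τ (slack x.n x.δ τ h c₀).toNat) h))

/-- Whether the system defines an empty lattice-simplex, when `h = 0`. -/
def latticeOk (x : Node) (τ h : List ℤ) (c₀ : ℤ) : Bool :=
  zle 1 (slack x.n x.δ τ h c₀) && (gcdOk x.n x.Δ (mkSystem x.n x.δ x.A τ h c₀) &&
    (List.range x.n).all fun i =>
      (zeq (slack x.n x.δ τ h c₀ % gz τ i) 0 &&
        inLat x.n x.δ x.taus (unitVec x.n i (slack x.n x.δ τ h c₀ / gz τ i))) &&
      (!(hits x.n x.δ x.taus ((layers x.n x.δ x.taus x.box τ (slack x.n x.δ τ h c₀).toNat).drop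
          (gz τ i + 1).toNat) (unitVec x.n i (-1))) &&
      (List.range x.n).all fun j => zeq i j ||
        !(hits x.n x.δ x.taus ((layers x.n x.δ x.taus x.box τ (slack x.n x.δ τ h c₀).toNat).drop
          (gz τ i + gz τ j).toNat) (vsub x.n (unitVec x.n i (-1)) (unitVec x.n j 1)))))

/-- The empty simplices with the matrix of the node. -/
def Node.leafS (x : Node) : List (List (List ℤ) × List ℤ) :=
  bif zeq x.m x.n then
    x.taus.flatMap fun τ => x.box.flatMap fun h => (List.range (2 * x.Δ + 1)).flatMap fun k : ℕ =>
      bif emptyOk x τ h ((k : ℤ) - x.Δ) then [mkSystem x.n x.δ x.A τ h ((k : ℤ) - x.Δ)] else []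
  else []

/-- The empty lattice-simplices with the matrix of the node. -/
def Node.leafL (x : Node) : List (List (List ℤ) × List ℤ) :=
  bif zeq x.m x.n then
    x.taus.flatMap fun τ => (List.range (x.Δ + 1)).flatMap fun k : ℕ =>
      bif latticeOk x τ (List.replicate x.n 0) k then
        [mkSystem x.n x.δ x.A τ (List.replicate x.n 0) k] else []
  else []

/-- The node of size `0`. -/
def Node.root (n Δ : ℕ) : Node := ⟨n, Δ, 0, 1, true, [], [[]], [[]], [[]]⟩

/-! ### Polynomial running time of the node operations and of the tests. -/

section polytime
variable {X : Type} [Enc X] {n m d δ i Δ R : X → ℕ} {v τ h y : X → List ℤ} {c : X → ℤ}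
  {A B box taus : X → List (List ℤ)} {Ls : X → List (List (List ℤ))} {x : X → Node}

@[fun_prop]
lemma PolyTime.gz (hv : PolyTime v) (hi : PolyTime i) : PolyTime fun a => gz (v a) (i a) := by
  unfold EmptySimplices.gz; fun_prop

@[fun_prop]
lemma PolyTime.ent (hA : PolyTime A) (hi : PolyTime i) (hd : PolyTime d) :
    PolyTime fun a => ent (A a) (i a) (d a) := by
  unfold EmptySimplices.ent; fun_prop

@[fun_prop]
lemma PolyTime.dotZ (hn : PolyTime n) (hv : PolyTime v) (hy : PolyTime y) :
    PolyTime fun a => dotZ (n a) (v a) (y a) := by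
  unfold EmptySimplices.dotZ; fun_prop

@[fun_prop]
lemma PolyTime.colDot (hn : PolyTime n) (hA : PolyTime A) (hi : PolyTime i) (hy : PolyTime y) :
    PolyTime fun a => colDot (n a) (A a) (i a) (y a) := by
  unfold EmptySimplices.colDot; fun_prop

@[fun_prop]
lemma PolyTime.vsub (hn : PolyTime n) (hv : PolyTime v) (hy : PolyTime y) :
    PolyTime fun a => vsub (n a) (v a) (y a) := by
  unfold EmptySimplices.vsub; fun_prop

@[fun_prop]
lemma PolyTime.unitVec (hn : PolyTime n) (hi : PolyTime i) (hc : PolyTime c) :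
    PolyTime fun a => unitVec (n a) (i a) (c a) := by
  unfold EmptySimplices.unitVec; fun_prop

@[fun_prop]
lemma PolyTime.addRow (hm : PolyTime m) (hd : PolyTime d) (hv : PolyTime v) (hA : PolyTime A) :
    PolyTime fun a => addRow (m a) (d a) (v a) (A a) := by
  unfold EmptySimplices.addRow; fun_prop

@[fun_prop]
lemma PolyTime.boxExt (hd : PolyTime d) (hB : PolyTime box) :
    PolyTime fun a => boxExt (d a) (box a) := by
  unfold EmptySimplices.boxExt; fun_prop

@[fun_prop]
lemma PolyTime.tausExt (hd : PolyTime d) (hδ : PolyTime δ) (hm : PolyTime m) (hv : PolyTime v)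
    (ht : PolyTime taus) : PolyTime fun a => tausExt (d a) (δ a) (m a) (v a) (taus a) := by
  unfold EmptySimplices.tausExt; fun_prop

@[fun_prop]
lemma PolyTime.iChild (hx : PolyTime x) (hi : PolyTime i) :
    PolyTime fun a => (x a).iChild (i a) := by
  unfold Node.iChild; fun_prop

@[fun_prop]
lemma PolyTime.tChild (hx : PolyTime x) (hd : PolyTime d) (hv : PolyTime v) :
    PolyTime fun a => (x a).tChild (d a) (v a) := by
  unfold Node.tChild; fun_prop

lemma polyTime_expand : PolyTime Node.expand := by
  unfold Node.expand; fun_prop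

@[fun_prop]
lemma PolyTime.inLat (hn : PolyTime n) (hδ : PolyTime δ) (ht : PolyTime taus) (hy : PolyTime y) :
    PolyTime fun a => inLat (n a) (δ a) (taus a) (y a) := by
  unfold EmptySimplices.inLat; fun_prop

@[fun_prop]
lemma PolyTime.hits (hn : PolyTime n) (hδ : PolyTime δ) (ht : PolyTime taus) (hL : PolyTime Ls)
    (hy : PolyTime y) : PolyTime fun a => hits (n a) (δ a) (taus a) (Ls a) (y a) := by
  unfold EmptySimplices.hits; fun_prop

lemma sz_filter_le {α : Type} [Enc α] (p : α → Bool) (l : List α) : sz (l.filter p) ≤ sz l := by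
  induction l with
  | nil => simp
  | cons a l ih =>
    rw [List.filter_cons]
    split_ifs <;> simp only [sz_cons] <;> omega

@[fun_prop]
-- Every layer is a sublist of the box, so the accumulated list of layers has size at most about `R`
-- times that of the box.
lemma PolyTime.layers (hn : PolyTime n) (hδ : PolyTime δ) (ht : PolyTime taus) (hB : PolyTime box)
    (hy : PolyTime y) (hR : PolyTime R) :
    PolyTime fun a => layers (n a) (δ a) (taus a) (box a) (y a) (R a) := by
  unfold EmptySimplices.layers
  refine PolyTime.foldl (l := fun a => List.range (R a)) (s := fun a => [(box a).filter _])
    (f := fun a Ls _ => ((box a).filter fun g => (List.range (n a)).any fun i =>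
    (Ls.getD (EmptySimplices.gz (y a) i - 1).toNat []).any fun g' =>
      EmptySimplices.inLat (n a) (δ a) (taus a) (EmptySimplices.vsub (n a)
        (EmptySimplices.vsub (n a) g (EmptySimplices.unitVec (n a) i 1)) g')) :: Ls)
    (by fun_prop) (by fun_prop) (by fun_prop) (B := fun a => (R a + 2) * (sz (box a) + 2))
    ((((PolyTime.bdd hR).mono fun a => by rw [sz_nat]; omega).add (.const 2)).mul
      ((PolyTime.bdd hB).add (.const 2))) fun a l' hl' => ?_
  have key : ∀ (l' : List ℕ) (s : List (List (List ℤ))) (f : List (List (List ℤ)) → List ℤ → Bool),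
      sz (l'.foldl (fun Ls _ => ((box a).filter (f Ls)) :: Ls) s) ≤
        l'.length * (sz (box a) + 2) + sz s := by
    intro l' s f
    induction l' generalizing s with
    | nil => simp
    | cons b l' ih =>
      refine (ih _).trans ?_
      have := sz_filter_le (f s) (box a)
      simp only [sz_cons, List.length_cons, add_mul]
      omega
  refine (key _ _ _).trans ?_
  have h1 := hl'.length_le
  rw [List.length_range] at h1
  have h2 := sz_filter_le (EmptySimplices.inLat (n a) (δ a) (taus a)) (box a)
  have h3 := Nat.mul_le_mul_right (sz (box a) + 2) h1
  simp only [sz_cons, sz_nil, add_mul] at *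
  omega

@[fun_prop]
lemma PolyTime.mkSystem (hn : PolyTime n) (hδ : PolyTime δ) (hA : PolyTime A) (hτ : PolyTime τ)
    (hh : PolyTime h) (hc : PolyTime c) :
    PolyTime fun a => mkSystem (n a) (δ a) (A a) (τ a) (h a) (c a) := by
  unfold EmptySimplices.mkSystem; fun_prop

@[fun_prop]
lemma PolyTime.gcdOk {s : X → List (List ℤ) × List ℤ} (hn : PolyTime n) (hΔ : PolyTime Δ)
    (hs : PolyTime s) : PolyTime fun a => gcdOk (n a) (Δ a) (s a) := by
  unfold EmptySimplices.gcdOk; fun_prop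

@[fun_prop]
lemma PolyTime.slack (hn : PolyTime n) (hδ : PolyTime δ) (hτ : PolyTime τ)
    (hh : PolyTime h) (hc : PolyTime c) :
    PolyTime fun a => slack (n a) (δ a) (τ a) (h a) (c a) := by
  unfold EmptySimplices.slack; fun_prop

@[fun_prop]
lemma PolyTime.emptyOk (hx : PolyTime x) (hτ : PolyTime τ) (hh : PolyTime h) (hc : PolyTime c) :
    PolyTime fun a => emptyOk (x a) (τ a) (h a) (c a) := by
  unfold EmptySimplices.emptyOk; fun_prop

@[fun_prop]
lemma PolyTime.latticeOk (hx : PolyTime x) (hτ : PolyTime τ) (hh : PolyTime h) (hc : PolyTime c) :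
    PolyTime fun a => latticeOk (x a) (τ a) (h a) (c a) := by
  unfold EmptySimplices.latticeOk; fun_prop

lemma polyTime_leafS : PolyTime Node.leafS := by
  unfold Node.leafS; fun_prop

lemma polyTime_leafL : PolyTime Node.leafL := by
  unfold Node.leafL; fun_prop

lemma polyTime_root : PolyTime fun p : ℕ × ℕ => Node.root p.1 p.2 := by
  unfold Node.root; fun_prop

end polytime
end EmptySimplices

namespace EmptySimplices
open EmptySimplices.Enc (enc)

/-! ### Entries of vectors and matrices -/

lemma gz_cons_zero (a : ℤ) (l : List ℤ) : gz (a :: l) 0 = a := rfl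

lemma gz_cons_succ (a : ℤ) (l : List ℤ) (i : ℕ) : gz (a :: l) (i + 1) = gz l i := rfl

lemma gz_eq_getElem {l : List ℤ} {i : ℕ} (h : i < l.length) : gz l i = l[i] := by
  simp [gz, List.getD_eq_getElem?_getD, h]

lemma gz_map_range {n i : ℕ} (f : ℕ → ℤ) (h : i < n) : gz ((List.range n).map f) i = f i := by
  simp [gz, List.getD_eq_getElem?_getD, h]

lemma gz_of_length_le {l : List ℤ} {i : ℕ} (h : l.length ≤ i) : gz l i = 0 := by
  simp [gz, List.getD_eq_getElem?_getD, h]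

lemma gz_map_mul (d : ℤ) (l : List ℤ) (i : ℕ) : gz (l.map fun x => d * x) i = d * gz l i := by
  by_cases h : i < l.length
  · rw [gz_eq_getElem (by simpa using h), gz_eq_getElem h]; simp
  · rw [gz_of_length_le (by simpa using h), gz_of_length_le (by simpa using h)]; simp

lemma gz_replicate_zero (n i : ℕ) : gz (List.replicate n 0) i = 0 := by
  by_cases h : i < n
  · rw [gz_eq_getElem (by simpa using h)]; simp
  · rw [gz_of_length_le (by simpa using h)]

lemma gz_vsub {n i : ℕ} (a b : List ℤ) (h : i < n) : gz (vsub n a b) i = gz a i - gz b i :=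
  gz_map_range _ h

lemma gz_unitVec {n i j : ℕ} (c : ℤ) (h : j < n) :
    gz (unitVec n i c) j = if j = i then c else 0 := by
  rw [unitVec, gz_map_range _ h]
  by_cases hij : j = i
  · simp [hij, (zeq_iff _ _).2]
  · have : zeq (j : ℤ) i = false := by
      rw [Bool.eq_false_iff, Ne, zeq_iff]; exact_mod_cast hij
    simp [this, hij]

lemma ext_gz {a b : List ℤ} (h : a.length = b.length) (h' : ∀ i < a.length, gz a i = gz b i) :
    a = b := by
  refine List.ext_getElem h fun i h1 h2 => ?_
  rw [← gz_eq_getElem h1, ← gz_eq_getElem h2, h' i h1]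

lemma sum_map_range {M : Type*} [AddCommMonoid M] (n : ℕ) (f : ℕ → M) :
    ((List.range n).map f).sum = ∑ i : Fin n, f i := by
  rw [← Finset.sum_range]
  induction n with
  | zero => simp
  | succ n ih => rw [List.range_succ, Finset.sum_range_succ, ← ih]; simp

lemma dotZ_eq (n : ℕ) (a b : List ℤ) : dotZ n a b = ∑ i : Fin n, gz a i * gz b i :=
  sum_map_range _ _

lemma colDot_eq (n : ℕ) (A : List (List ℤ)) (j : ℕ) (τ : List ℤ) :
    colDot n A j τ = ∑ i : Fin n, ent A i j * gz τ i :=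
  sum_map_range _ _

lemma colDot_map_mul (n : ℕ) (A : List (List ℤ)) (j : ℕ) (d : ℤ) (τ : List ℤ) :
    colDot n A j (τ.map fun x => d * x) = d * colDot n A j τ := by
  simp only [colDot_eq, gz_map_mul, Finset.mul_sum]
  exact Finset.sum_congr rfl fun i _ => by ring

lemma dotZ_map_mul (n : ℕ) (d : ℤ) (v τ : List ℤ) :
    dotZ n v (τ.map fun x => d * x) = d * dotZ n v τ := by
  simp only [dotZ_eq, gz_map_mul, Finset.mul_sum]
  exact Finset.sum_congr rfl fun i _ => by ring

section addRow
variable (m d : ℕ) (v : List ℤ) (A : List (List ℤ))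

lemma ent_addRow_zero_zero : ent (addRow m d v A) 0 0 = d := rfl

lemma ent_addRow_zero_succ (j : ℕ) : ent (addRow m d v A) 0 (j + 1) = 0 :=
  gz_replicate_zero m j

variable {m}

lemma getD_addRow_succ {i : ℕ} (h : i < m) :
    (addRow m d v A).getD (i + 1) [] = gz v i :: A.getD i [] := by
  simp [addRow, List.getD_eq_getElem?_getD, h]

lemma ent_addRow_succ_zero {i : ℕ} (h : i < m) : ent (addRow m d v A) (i + 1) 0 = gz v i := by
  rw [ent, getD_addRow_succ d v A h]; rfl

lemma ent_addRow_succ_succ {i : ℕ} (h : i < m) (j : ℕ) :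
    ent (addRow m d v A) (i + 1) (j + 1) = ent A i j := by
  rw [ent, getD_addRow_succ d v A h]; rfl

lemma colDot_addRow_zero (x : ℤ) (τ : List ℤ) :
    colDot (m + 1) (addRow m d v A) 0 (x :: τ) = d * x + dotZ m v τ := by
  rw [colDot_eq, Fin.sum_univ_succ, dotZ_eq]
  congr 1
  exact Finset.sum_congr rfl fun i _ => by
    rw [Fin.val_succ, ent_addRow_succ_zero d v A i.2, gz_cons_succ]

lemma colDot_addRow_succ (j : ℕ) (x : ℤ) (τ : List ℤ) :
    colDot (m + 1) (addRow m d v A) (j + 1) (x :: τ) = colDot m A j τ := by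
  rw [colDot_eq, Fin.sum_univ_succ, colDot_eq, Fin.val_zero, ent_addRow_zero_succ, zero_mul,
    zero_add]
  exact Finset.sum_congr rfl fun i _ => by
    rw [Fin.val_succ, ent_addRow_succ_succ d v A i.2, gz_cons_succ]

lemma length_addRow : (addRow m d v A).length = m + 1 := by simp [addRow]

end addRow

lemma mem_boxExt {d : ℕ} {box : List (List ℤ)} {v : List ℤ} :
    v ∈ boxExt d box ↔ ∃ x < d, ∃ b ∈ box, v = (x : ℤ) :: b := by
  simp only [boxExt, List.mem_flatMap, List.mem_reverse, List.mem_range, List.mem_map, eq_comm]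

lemma length_boxExt (d : ℕ) (box : List (List ℤ)) : (boxExt d box).length = d * box.length := by
  simp [boxExt, List.length_flatMap]

lemma length_tausExt (d δ m : ℕ) (v : List ℤ) (taus : List (List ℤ)) :
    (tausExt d δ m v taus).length = d * taus.length := by
  simp [tausExt, List.length_flatMap, mul_comm]

lemma mem_tausExt {d δ m : ℕ} {v : List ℤ} {taus : List (List ℤ)} {σ : List ℤ} :
    σ ∈ tausExt d δ m v taus ↔ ∃ τ ∈ taus, ∃ q < d,
      σ = ((δ : ℤ) * (q : ℤ) + δ - dotZ m v τ % δ) :: τ.map fun x => (d : ℤ) * x := by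
  simp only [tausExt, List.mem_flatMap, List.mem_range, List.mem_map, eq_comm]

/-- The square matrix given by the list `A` of its rows. -/
def toMat (m : ℕ) (A : List (List ℤ)) : Matrix (Fin m) (Fin m) ℤ := .of fun i j => ent A i j

/-- The entries `s, …, s + k - 1` of a vector, with the lexicographic order. -/
def vecKey (s k : ℕ) (w : List ℤ) : Lex (Fin k → ℤ) := toLex fun i => gz w (s + i)

/-- The entries `s, …, s + k - 1` of a column, with the lexicographic order. -/
def colKey (s k : ℕ) (A : List (List ℤ)) (j : ℕ) : Lex (Fin k → ℤ) :=
  toLex fun i => ent A (s + i) j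

/-- `A` is a matrix in Hermite normal form of size `s + k`, with `s` unit columns with sorted tails,
followed by `k` columns with diagonal entries at least `2`. -/
structure IsHNF (s k : ℕ) (A : List (List ℤ)) : Prop where
  length : A.length = s + k
  row_length : ∀ r ∈ A, r.length = s + k
  upper : ∀ i j, i < j → j < s + k → ent A i j = 0
  lower : ∀ i j, j < i → i < s + k → 0 ≤ ent A i j ∧ ent A i j < ent A i i
  diag_one : ∀ i < s, ent A i i = 1
  diag_two : ∀ i, s ≤ i → i < s + k → 2 ≤ ent A i i
  sorted : ∀ j j', j ≤ j' → j' < s → colKey s k A j ≤ colKey s k A j'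

/-- `w` is a reduced vector modulo the columns of `A`. -/
def IsReduced (m : ℕ) (A : List (List ℤ)) (w : List ℤ) : Prop :=
  w.length = m ∧ ∀ i < m, 0 ≤ gz w i ∧ gz w i < ent A i i

/-- `τ ∈ [1, δ]^m` and `Aᵀ τ ≡ 0` modulo `δ`. -/
def IsTau (m δ : ℕ) (A : List (List ℤ)) (τ : List ℤ) : Prop :=
  τ.length = m ∧ (∀ i < m, 1 ≤ gz τ i ∧ gz τ i ≤ δ) ∧ ∀ j < m, (δ : ℤ) ∣ colDot m A j τ

lemma IsHNF.diag_pos {s k : ℕ} {A : List (List ℤ)} (h : IsHNF s k A) {i : ℕ} (hi : i < s + k) :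
    1 ≤ ent A i i := by
  by_cases his : i < s
  · exact (h.diag_one i his).ge
  · exact le_trans one_le_two (h.diag_two i (by omega) hi)

lemma IsHNF.det {s k : ℕ} {A : List (List ℤ)} (h : IsHNF s k A) :
    (toMat (s + k) A).det = ∏ i : Fin (s + k), ent A i i :=
  by
  refine Matrix.det_of_isLowerTriangular (M := toMat (s + k) A) fun i j hij => ?_
  exact h.upper i j hij j.2

/-- Adding a column with diagonal entry at least `2`. -/
lemma IsHNF.cons_two {k d : ℕ} {A : List (List ℤ)} {v : List ℤ} (h : IsHNF 0 k A)
    (hv : IsReduced (0 + k) A v) (hd : 2 ≤ d) : IsHNF 0 (k + 1) (addRow (0 + k) d v A) := by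
  refine ⟨by rw [length_addRow]; omega, ?_, ?_, ?_, by simp, ?_, by simp⟩
  · intro r hr
    rw [addRow, List.mem_cons, List.mem_map] at hr
    rcases hr with rfl | ⟨i, hi, rfl⟩
    · simp
    · rw [List.mem_range] at hi
      rw [List.length_cons, List.getD_eq_getElem?_getD, List.getElem?_eq_getElem (by rw [h.length]; exact hi)]
      simp [h.row_length _ (List.getElem_mem _)]
  · rintro (_ | i) (_ | j) hij hj
    · omega
    · exact ent_addRow_zero_succ _ _ _ _ _
    · omega
    · rw [ent_addRow_succ_succ _ _ _ (by omega)]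
      exact h.upper i j (by omega) (by omega)
  · rintro (_ | i) (_ | j) hij hj
    · omega
    · omega
    · rw [ent_addRow_succ_succ _ _ _ (by omega), ent_addRow_succ_zero _ _ _ (by omega)]
      exact hv.2 i (by omega)
    · rw [ent_addRow_succ_succ _ _ _ (by omega), ent_addRow_succ_succ _ _ _ (by omega)]
      exact h.lower i j (by omega) (by omega)
  · rintro (_ | i) _ hj
    · rw [ent_addRow_zero_zero]; exact_mod_cast hd
    · rw [ent_addRow_succ_succ _ _ _ (by omega)]
      exact h.diag_two i (by omega) (by omega)

lemma colKey_addRow_zero (s k : ℕ) (d : ℕ) (v : List ℤ) (A : List (List ℤ)) :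
    colKey (s + 1) k (addRow (s + k) d v A) 0 = vecKey s k v := by
  refine congrArg toLex (funext fun i => ?_)
  rw [add_right_comm, ent_addRow_succ_zero _ _ _ (by omega)]

lemma colKey_addRow_succ (s k : ℕ) (d : ℕ) (v : List ℤ) (A : List (List ℤ)) (j : ℕ) :
    colKey (s + 1) k (addRow (s + k) d v A) (j + 1) = colKey s k A j := by
  refine congrArg toLex (funext fun i => ?_)
  rw [add_right_comm, ent_addRow_succ_succ _ _ _ (by omega)]

lemma vecKey_cons (s k : ℕ) (x : ℤ) (b : List ℤ) : vecKey (s + 1) k (x :: b) = vecKey s k b := by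
  refine congrArg toLex (funext fun i => ?_)
  rw [add_right_comm, gz_cons_succ]

/-- Adding a unit column. -/
lemma IsHNF.cons_one {s k : ℕ} {A : List (List ℤ)} {v : List ℤ} (h : IsHNF s k A)
    (hv : IsReduced (s + k) A v) (hs : ∀ j < s, vecKey s k v ≤ colKey s k A j) :
    IsHNF (s + 1) k (addRow (s + k) 1 v A) := by
  refine ⟨by rw [length_addRow]; omega, ?_, ?_, ?_, ?_, ?_, ?_⟩
  · intro r hr
    rw [addRow, List.mem_cons, List.mem_map] at hr
    rcases hr with rfl | ⟨i, hi, rfl⟩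
    · simp; omega
    · rw [List.mem_range] at hi
      rw [List.length_cons, List.getD_eq_getElem?_getD, List.getElem?_eq_getElem (by rw [h.length]; exact hi)]
      simp [h.row_length _ (List.getElem_mem _)]; omega
  · rintro (_ | i) (_ | j) hij hj
    · omega
    · exact ent_addRow_zero_succ _ _ _ _ _
    · omega
    · rw [ent_addRow_succ_succ _ _ _ (by omega)]
      exact h.upper i j (by omega) (by omega)
  · rintro (_ | i) (_ | j) hij hj
    · omega
    · omega
    · rw [ent_addRow_succ_succ _ _ _ (by omega), ent_addRow_succ_zero _ _ _ (by omega)]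
      exact hv.2 i (by omega)
    · rw [ent_addRow_succ_succ _ _ _ (by omega), ent_addRow_succ_succ _ _ _ (by omega)]
      exact h.lower i j (by omega) (by omega)
  · rintro (_ | i) hi
    · rw [ent_addRow_zero_zero]; rfl
    · rw [ent_addRow_succ_succ _ _ _ (by omega)]
      exact h.diag_one i (by omega)
  · rintro (_ | i) hi hj
    · omega
    · rw [ent_addRow_succ_succ _ _ _ (by omega)]
      exact h.diag_two i (by omega) (by omega)
  · rintro (_ | j) (_ | j') hj hj'
    · exact le_rfl
    · rw [colKey_addRow_zero, colKey_addRow_succ]; exact hs j' (by omega)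
    · omega
    · rw [colKey_addRow_succ, colKey_addRow_succ]; exact h.sorted j j' (by omega) (by omega)

lemma prod_diag_addRow (m d : ℕ) (v : List ℤ) (A : List (List ℤ)) :
    ∏ i : Fin (m + 1), ent (addRow m d v A) i i = d * ∏ i : Fin m, ent A i i := by
  rw [Fin.prod_univ_succ]
  congr 1
  exact Finset.prod_congr rfl fun i _ => by
    rw [Fin.val_succ, ent_addRow_succ_succ d v A i.2]

lemma mem_boxExt_iff_isReduced {m d : ℕ} {v : List ℤ} {A box : List (List ℤ)}
    (hbox : ∀ w, w ∈ box ↔ IsReduced m A w) (w : List ℤ) :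
    w ∈ boxExt d box ↔ IsReduced (m + 1) (addRow m d v A) w := by
  rw [mem_boxExt]
  constructor
  · rintro ⟨x, hx, b, hb, rfl⟩
    obtain ⟨h1, h2⟩ := (hbox b).1 hb
    refine ⟨by simp [h1], ?_⟩
    rintro (_ | i) hi
    · rw [gz_cons_zero, ent_addRow_zero_zero]; omega
    · rw [gz_cons_succ, ent_addRow_succ_succ _ _ _ (by omega)]; exact h2 i (by omega)
  · rintro ⟨h1, h2⟩
    obtain _ | ⟨x, b⟩ := w
    · simp at h1
    · have h3 := h2 0 (by omega)
      rw [gz_cons_zero, ent_addRow_zero_zero] at h3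
      refine ⟨x.toNat, by omega, b, (hbox b).2 ⟨by simpa using h1, fun i hi => ?_⟩, by
        rw [Int.toNat_of_nonneg h3.1]⟩
      have := h2 (i + 1) (by omega)
      rwa [gz_cons_succ, ent_addRow_succ_succ _ _ _ hi] at this

/-- The last `m` congruences modulo `d δ` force the tail of `σ` to be `d τ` with `τ` admissible for
`A`. Dividing the first one by `d` leaves `x ≡ -v τ` modulo `δ`, which has exactly `d` solutions in
`[1, d δ]`. So the number of dual vectors is multiplied by `d`, like the determinant. -/
lemma mem_tausExt_iff_isTau {m d δ : ℕ} {v : List ℤ} {A taus : List (List ℤ)} (hd : 1 ≤ d)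
    (hδ : 1 ≤ δ) (hdet : (toMat m A).det = δ) (htaus : ∀ τ, τ ∈ taus ↔ IsTau m δ A τ)
    (σ : List ℤ) : σ ∈ tausExt d δ m v taus ↔ IsTau (m + 1) (d * δ) (addRow m d v A) σ := by
  rw [mem_tausExt]
  have hδ' : (0 : ℤ) < δ := by exact_mod_cast hδ
  have hd' : (0 : ℤ) < d := by exact_mod_cast hd
  constructor
  · rintro ⟨τ, hτ, q, hq, rfl⟩
    obtain ⟨h1, h2, h3⟩ := (htaus τ).1 hτ
    have h4 := Int.emod_nonneg (dotZ m v τ) hδ'.ne'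
    have h5 := Int.emod_lt_of_pos (dotZ m v τ) hδ'
    have h6 : (q : ℤ) + 1 ≤ d := by exact_mod_cast hq
    refine ⟨by simp [h1], ?_, ?_⟩
    · rintro (_ | i) hi
      · rw [gz_cons_zero]
        push_cast
        constructor <;> nlinarith
      · rw [gz_cons_succ, gz_map_mul]
        have := h2 i (by omega)
        push_cast
        constructor <;> nlinarith
    · rintro (_ | j) hj
      · rw [colDot_addRow_zero, dotZ_map_mul, ← mul_add]
        push_cast
        refine mul_dvd_mul_left _ ⟨q + 1 + dotZ m v τ / δ, ?_⟩
        linarith [Int.emod_add_mul_ediv (dotZ m v τ) δ]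
      · rw [colDot_addRow_succ, colDot_map_mul]
        push_cast
        exact mul_dvd_mul_left _ (h3 j (by omega))
  · rintro ⟨h1, h2, h3⟩
    obtain _ | ⟨x, ρ⟩ := σ
    · simp at h1
    -- Multiplying `Aᵀ ρ ≡ 0` modulo `d δ` by the adjugate gives `δ ρ ≡ 0` modulo `d δ`.
    have hρ : ∀ i : Fin m, (d : ℤ) ∣ gz ρ i := by
      intro i
      choose u hu using fun j : Fin m => h3 (j + 1) (by omega)
      have e : (toMat m A).transpose.mulVec (fun i : Fin m => gz ρ i) = fun j => (d * δ : ℤ) * u j := by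
        funext j
        have := hu j
        rw [colDot_addRow_succ, colDot_eq] at this
        simpa [Matrix.mulVec, dotProduct, toMat] using this
      have e2 := congrArg ((toMat m A).transpose.adjugate.mulVec) e
      rw [Matrix.mulVec_mulVec, Matrix.adjugate_mul, Matrix.det_transpose, hdet, Matrix.smul_mulVec,
        Matrix.one_mulVec] at e2
      have e3 := congrFun e2 i
      rw [show (fun j => (d * δ : ℤ) * u j) = (δ : ℤ) • ((d : ℤ) • u) by
        funext j; simp only [Pi.smul_apply, smul_eq_mul]; ring, Matrix.mulVec_smul, Matrix.mulVec_smul] at e3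
      simp only [Pi.smul_apply, smul_eq_mul] at e3
      exact ⟨_, mul_left_cancel₀ hδ'.ne' e3⟩
    choose t ht using hρ
    set τ : List ℤ := List.ofFn t with hτdef
    have hτ : ∀ i : Fin m, gz τ i = t i := fun i => by
      rw [gz_eq_getElem (by simp [hτdef])]; simp [hτdef]
    have hlen : ρ.length = m := by simpa using h1
    have hρτ : ρ = τ.map fun x => (d : ℤ) * x := by
      refine ext_gz (by simp [hτdef, hlen]) fun i hi => ?_
      rw [gz_map_mul]
      have := hτ ⟨i, hlen ▸ hi⟩
      have h' := ht ⟨i, hlen ▸ hi⟩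
      simp only at this h'
      rw [this, h']
    subst hρτ
    have hτt : IsTau m δ A τ := by
      refine ⟨by simp [hτdef], fun i hi => ?_, fun j hj => ?_⟩
      · have := h2 (i + 1) (by omega)
        rw [gz_cons_succ, gz_map_mul] at this
        push_cast at this
        constructor
        · by_contra! hc
          nlinarith
        · exact le_of_mul_le_mul_left this.2 hd'
      · have := h3 (j + 1) (by omega)
        rw [colDot_addRow_succ, colDot_map_mul] at this
        push_cast at this
        exact (mul_dvd_mul_iff_left hd'.ne').1 this
    refine ⟨τ, (htaus τ).2 hτt, ((x - 1) / δ).toNat, ?_, ?_⟩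
    · have := h2 0 (by omega)
      rw [gz_cons_zero] at this
      have h4 : (x - 1) / δ < d := by
        rw [Int.ediv_lt_iff_lt_mul hδ']
        push_cast at this
        linarith
      omega
    · have h4 := h2 0 (by omega)
      rw [gz_cons_zero] at h4
      have h5 := h3 0 (by omega)
      rw [colDot_addRow_zero, dotZ_map_mul, ← mul_add] at h5
      push_cast at h5
      rw [mul_dvd_mul_iff_left hd'.ne'] at h5
      rw [Int.toNat_of_nonneg (Int.ediv_nonneg (by omega) hδ'.le)]
      congr 1
      have e1 := Int.emod_add_mul_ediv (dotZ m v τ) δ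
      have e2 := Int.emod_add_mul_ediv (x - 1) δ
      have e3 := Int.emod_nonneg (dotZ m v τ) hδ'.ne'
      have e4 := Int.emod_lt_of_pos (dotZ m v τ) hδ'
      have e5 := Int.emod_nonneg (x - 1) hδ'.ne'
      have e6 := Int.emod_lt_of_pos (x - 1) hδ'
      obtain ⟨w, hw⟩ := h5
      set r := dotZ m v τ % δ
      set s := (x - 1) % δ
      have e7 : s + 1 + r = δ * (w - (x - 1) / δ - dotZ m v τ / δ) := by linarith
      set y := w - (x - 1) / δ - dotZ m v τ / δ
      -- The left side of `e7` lies in `[1, 2 δ - 1]` and is a multiple of `δ`.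
      have e8 : y = 1 := by
        have a1 : 0 < y := by by_contra! hc; nlinarith
        have a2 : y < 2 := by by_contra! hc; nlinarith
        omega
      rw [e8] at e7
      linarith

end EmptySimplices

namespace EmptySimplices
open EmptySimplices.Enc (enc)

/-! ### The search tree -/

/-- The invariants of the nodes: the matrix has `s` unit columns and `k` other ones. -/
structure Node.Valid (n Δ s k : ℕ) (x : Node) : Prop where
  n_eq : x.n = n
  Δ_eq : x.Δ = Δ
  m_eq : x.m = s + k
  m_le : s + k ≤ n
  hnf : IsHNF s k x.A
  det : (toMat (s + k) x.A).det = x.δ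
  δ_pos : 1 ≤ x.δ
  δ_le : x.δ ≤ Δ
  two_pow : 2 ^ k ≤ x.δ
  length_box : x.box.length = x.δ
  length_taus : x.taus.length = x.δ
  length_allow : x.allow.length ≤ x.δ
  mem_box : ∀ w, w ∈ x.box ↔ IsReduced (s + k) x.A w
  mem_taus : ∀ τ, τ ∈ x.taus ↔ IsTau (s + k) x.δ x.A τ
  ph : x.ph = true → s = 0 ∧ x.allow = x.box
  mem_allow : ∀ w, w ∈ x.allow ↔ w ∈ x.box ∧ ∀ j < s, vecKey s k w ≤ colKey s k x.A j
  pairwise : x.allow.Pairwise fun a b => vecKey s k b < vecKey s k a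

lemma Node.valid_root {n Δ : ℕ} (hΔ : 1 ≤ Δ) : (Node.root n Δ).Valid n Δ 0 0 where
  n_eq := rfl
  Δ_eq := rfl
  m_eq := rfl
  m_le := Nat.zero_le _
  hnf := ⟨rfl, by simp [Node.root], by simp, by simp, by simp, by simp, by simp⟩
  det := by simp [Node.root]
  δ_pos := le_rfl
  δ_le := hΔ
  two_pow := le_rfl
  length_box := rfl
  length_taus := rfl
  length_allow := le_rfl
  mem_box := fun w => by simp [Node.root, IsReduced]
  mem_taus := fun w => by simp [Node.root, IsTau]
  ph := fun _ => ⟨rfl, rfl⟩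
  mem_allow := fun w => by simp [Node.root]
  pairwise := by simp [Node.root]

lemma det_addRow {s k s' k' d : ℕ} {v : List ℤ} {A : List (List ℤ)} (h : IsHNF s k A)
    (h' : IsHNF s' k' (addRow (s + k) d v A)) (hm : s' + k' = s + k + 1) :
    (toMat (s' + k') (addRow (s + k) d v A)).det = d * (toMat (s + k) A).det := by
  rw [h'.det, h.det, hm, prod_diag_addRow]

/-- `boxExt` runs through the first entries in decreasing order and, for each of them, through the
tails in the given order. Without unit columns the key is the whole vector, so the list stays
lexicographically decreasing. -/
lemma pairwise_boxExt {k d : ℕ} {box : List (List ℤ)}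
    (h : box.Pairwise fun a b => vecKey 0 k b < vecKey 0 k a) :
    (boxExt d box).Pairwise fun a b => vecKey 0 (k + 1) b < vecKey 0 (k + 1) a := by
  rw [boxExt, List.pairwise_flatMap]
  constructor
  · intro x _
    rw [List.pairwise_map]
    refine h.imp ?_
    rintro a b ⟨i, hi, hi'⟩
    refine ⟨i.succ, ?_, ?_⟩
    · intro j hj
      induction j using Fin.cases with
      | zero => rfl
      | succ j =>
        have := hi j (Fin.succ_lt_succ_iff.1 hj)
        simp only [vecKey, zero_add] at this
        simpa [vecKey, gz_cons_succ] using this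
    · simp only [vecKey, zero_add] at hi'
      simpa [vecKey, gz_cons_succ] using hi'
  · rw [List.pairwise_reverse]
    refine List.pairwise_lt_range.imp ?_
    intro x y hxy a ha b hb
    rw [List.mem_map] at ha hb
    obtain ⟨a, _, rfl⟩ := ha
    obtain ⟨b, _, rfl⟩ := hb
    refine ⟨0, fun j hj => absurd hj (Fin.not_lt_zero j), ?_⟩
    simpa [vecKey, gz_cons_zero] using hxy

/-- Without unit columns the sorting condition is void and every reduced vector is allowed. -/
lemma Node.Valid.tChild {n Δ s k d : ℕ} {x : Node} {v : List ℤ} (h : x.Valid n Δ s k)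
    (hph : x.ph = true) (hm : x.m < x.n) (hd : 2 ≤ d) (hdδ : d * x.δ ≤ Δ) (hv : v ∈ x.box) :
    s = 0 ∧ (x.tChild d v).Valid n Δ 0 (k + 1) := by
  obtain ⟨rfl, hallow⟩ := h.ph hph
  refine ⟨rfl, ?_⟩
  have hvr := (h.mem_box v).1 hv
  have hA := h.hnf.cons_two hvr hd
  have hdet : (toMat (0 + (k + 1)) (addRow (0 + k) d v x.A)).det = (d * x.δ : ℕ) := by
    rw [det_addRow h.hnf hA rfl, h.det]; push_cast; rfl
  have hm' := h.m_eq
  have hn' := h.n_eq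
  have hδ := h.δ_pos
  have hp : (boxExt d x.box).Pairwise fun a b => vecKey 0 (k + 1) b < vecKey 0 (k + 1) a :=
    pairwise_boxExt (hallow ▸ h.pairwise)
  have e : x.m = 0 + k := h.m_eq
  refine ⟨h.n_eq, h.Δ_eq, ?_, by omega, ?_, ?_, ?_, hdδ, ?_, ?_, ?_, ?_, ?_, ?_, fun _ => ⟨rfl, rfl⟩,
    ?_, hp⟩
  · change x.m + 1 = _; omega
  · change IsHNF _ _ (addRow x.m d v x.A); rw [e]; exact hA
  · change (toMat _ (addRow x.m d v x.A)).det = _; rw [e]; exact hdet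
  · change 1 ≤ d * x.δ; nlinarith
  · change _ ≤ d * x.δ
    rw [pow_succ, mul_comm]
    exact Nat.mul_le_mul hd h.two_pow
  · change (boxExt d x.box).length = d * x.δ; rw [length_boxExt, h.length_box]
  · change (tausExt d x.δ x.m v x.taus).length = d * x.δ; rw [length_tausExt, h.length_taus]
  · change (boxExt d x.box).length ≤ d * x.δ; rw [length_boxExt, h.length_box]
  · intro w
    change w ∈ boxExt d x.box ↔ IsReduced _ (addRow x.m d v x.A) w
    rw [e]; exact mem_boxExt_iff_isReduced h.mem_box w
  · intro τ
    change τ ∈ tausExt d x.δ x.m v x.taus ↔ IsTau _ (d * x.δ) (addRow x.m d v x.A) τ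
    rw [e]; exact mem_tausExt_iff_isTau (by omega) h.δ_pos h.det h.mem_taus τ
  · intro w
    simp [Node.tChild]

/-- The allowed vectors are listed in decreasing order, so dropping those before the chosen one
leaves exactly the vectors that may precede it. It is kept itself, since columns may be repeated.
The new leading entry of a reduced vector is `0` and does not enter the keys. -/
lemma Node.Valid.iChild {n Δ s k j : ℕ} {x : Node} (h : x.Valid n Δ s k) (hm : x.m < x.n)
    (hj : j < x.allow.length) : (x.iChild j).Valid n Δ (s + 1) k := by
  have hdrop : x.allow.drop j = x.allow[j] :: x.allow.drop (j + 1) := List.drop_eq_getElem_cons hj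
  set v := x.allow[j] with hvdef
  have hhead : (x.allow.drop j).headD [] = v := by rw [hdrop]; rfl
  have hva := (h.mem_allow v).1 (List.getElem_mem hj)
  have hvr := (h.mem_box v).1 hva.1
  have hA := h.hnf.cons_one hvr hva.2
  have hdet : (toMat (s + 1 + k) (addRow (s + k) 1 v x.A)).det = (1 * x.δ : ℕ) := by
    rw [det_addRow h.hnf hA (by omega), h.det]; push_cast; rfl
  have hm' := h.m_eq
  have hn' := h.n_eq
  have hδ := h.δ_pos
  have e : x.m = s + k := h.m_eq
  have e' : s + 1 + k = s + k + 1 := by omega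
  have hdrop_pw : (x.allow.drop j).Pairwise fun a b => vecKey s k b < vecKey s k a :=
    h.pairwise.sublist (List.drop_sublist j _)
  refine ⟨h.n_eq, h.Δ_eq, ?_, by omega, ?_, ?_, h.δ_pos, h.δ_le, h.two_pow, ?_, ?_, ?_, ?_, ?_,
    ?_, ?_, ?_⟩
  · change x.m + 1 = _; omega
  · change IsHNF _ _ (addRow x.m 1 ((x.allow.drop j).headD []) x.A); rw [e, hhead]; exact hA
  · change (toMat _ (addRow x.m 1 ((x.allow.drop j).headD []) x.A)).det = (x.δ : ℤ)
    rw [e, hhead, hdet, one_mul]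
  · change (boxExt 1 x.box).length = x.δ; rw [length_boxExt, h.length_box, one_mul]
  · change (tausExt 1 x.δ x.m _ x.taus).length = x.δ; rw [length_tausExt, h.length_taus, one_mul]
  · change (boxExt 1 (x.allow.drop j)).length ≤ x.δ
    rw [length_boxExt, List.length_drop]
    have := h.length_allow
    omega
  · intro w
    change w ∈ boxExt 1 x.box ↔ IsReduced _ (addRow x.m 1 ((x.allow.drop j).headD []) x.A) w
    rw [e, e']; exact mem_boxExt_iff_isReduced h.mem_box w
  · intro τ
    change τ ∈ tausExt 1 x.δ x.m ((x.allow.drop j).headD []) x.taus ↔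
      IsTau _ x.δ (addRow x.m 1 ((x.allow.drop j).headD []) x.A) τ
    rw [e, e', hhead]
    have := mem_tausExt_iff_isTau (v := v) le_rfl h.δ_pos h.det h.mem_taus τ
    rwa [one_mul] at this
  · intro hf
    exact absurd hf (by simp [Node.iChild])
  · intro w
    change w ∈ boxExt 1 (x.allow.drop j) ↔ w ∈ boxExt 1 x.box ∧ ∀ j' < s + 1,
      vecKey (s + 1) k w ≤ colKey (s + 1) k (addRow x.m 1 ((x.allow.drop j).headD []) x.A) j'
    rw [e, hhead, mem_boxExt, mem_boxExt]
    -- An allowed vector before position `j` would be strictly larger than `v`.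
    have key : ∀ b, b ∈ x.allow.drop j ↔ b ∈ x.allow ∧ vecKey s k b ≤ vecKey s k v := by
      intro b
      constructor
      · intro hb
        refine ⟨(List.drop_sublist j _).subset hb, ?_⟩
        rw [hdrop] at hb hdrop_pw
        rcases List.mem_cons.1 hb with rfl | hb
        · exact le_rfl
        · exact ((List.pairwise_cons.1 hdrop_pw).1 b hb).le
      · rintro ⟨hb, hle⟩
        have hpw := h.pairwise
        rw [← List.take_append_drop j x.allow, List.pairwise_append] at hpw
        rw [← List.take_append_drop j x.allow, List.mem_append] at hb
        rcases hb with hb | hb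
        · exact absurd (hpw.2.2 b hb v (by rw [hdrop]; simp)) (not_lt.2 hle)
        · exact hb
    constructor
    · rintro ⟨y, hy, b, hb, rfl⟩
      obtain ⟨h1, h2⟩ := (key b).1 hb
      obtain ⟨h3, h4⟩ := (h.mem_allow b).1 h1
      refine ⟨⟨y, hy, b, h3, rfl⟩, ?_⟩
      rintro (_ | j') hj'
      · rw [vecKey_cons, colKey_addRow_zero]; exact h2
      · rw [vecKey_cons, colKey_addRow_succ]; exact h4 j' (by omega)
    · rintro ⟨⟨y, hy, b, hb, rfl⟩, hw⟩
      refine ⟨y, hy, b, (key b).2 ⟨(h.mem_allow b).2 ⟨hb, fun j' hj' => ?_⟩, ?_⟩, rfl⟩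
      · have := hw (j' + 1) (by omega)
        rwa [vecKey_cons, colKey_addRow_succ] at this
      · have := hw 0 (by omega)
        rwa [vecKey_cons, colKey_addRow_zero] at this
  · change (boxExt 1 (x.allow.drop j)).Pairwise _
    rw [boxExt]
    simp only [List.range_one, List.reverse_singleton, List.flatMap_cons, List.flatMap_nil,
      List.append_nil]
    rw [List.pairwise_map]
    refine hdrop_pw.imp fun {a b} hab => ?_
    rwa [vecKey_cons, vecKey_cons]

lemma Node.mem_expand {x y : Node} (hδ : 1 ≤ x.δ) : y ∈ x.expand ↔ x.m < x.n ∧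
    ((∃ j < x.allow.length, y = x.iChild j) ∨
      (x.ph = true ∧ ∃ d, 2 ≤ d ∧ d * x.δ ≤ x.Δ ∧ ∃ v ∈ x.box, y = x.tChild d v)) := by
  by_cases hm : x.m < x.n
  · have h1 : zle (x.m + 1 : ℕ) x.n = true := by rw [zle_iff]; exact_mod_cast hm
    rw [Node.expand, h1, cond_true, List.mem_append, List.mem_map]
    simp only [hm, true_and]
    refine or_congr ?_ ?_
    · simp [eq_comm]
    · cases hph : x.ph
      · simp
      · simp only [cond_true, List.mem_flatMap, List.mem_range, true_and]
        constructor
        · rintro ⟨d, _, hy⟩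
          cases hc : (zle 2 d && zle (d * x.δ : ℕ) x.Δ)
          · rw [hc] at hy
            simp at hy
          · rw [hc, cond_true, List.mem_map] at hy
            rw [Bool.and_eq_true, zle_iff, zle_iff] at hc
            obtain ⟨v, hv, rfl⟩ := hy
            exact ⟨d, by exact_mod_cast hc.1, by exact_mod_cast hc.2, v, hv, rfl⟩
        · rintro ⟨d, hd, hdδ, v, hv, rfl⟩
          · refine ⟨d, ?_, ?_⟩
            · have : d * 1 ≤ d * x.δ := Nat.mul_le_mul_left d (by omega)
              omega
            · have hc : (zle 2 d && zle (d * x.δ : ℕ) x.Δ) = true := by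
                rw [Bool.and_eq_true, zle_iff, zle_iff]
                exact ⟨by exact_mod_cast hd, by exact_mod_cast hdδ⟩
              rw [hc, cond_true, List.mem_map]
              exact ⟨v, hv, rfl⟩
  · have h1 : zle (x.m + 1 : ℕ) x.n = false := by
      rw [Bool.eq_false_iff, Ne, zle_iff]; exact_mod_cast hm
    rw [Node.expand, h1]
    simp [hm]

end EmptySimplices

/-! ### Number and size of the nodes, completeness of the tree. -/

namespace EmptySimplices
open EmptySimplices.Enc (enc)

/-- An upper bound for the number of nodes below a node. -/
def Node.pot (n Δ : ℕ) (x : Node) : ℕ :=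
  if x.ph = true then
    (Nat.log 2 (Δ / x.δ) + 1) * Δ ^ Nat.log 2 (Δ / x.δ) * (n + Δ).choose Δ
  else (n - x.m + x.allow.length).choose x.allow.length

/-- Hockey-stick identity: the tree of multisets drawn from `a` vectors, with `r + 1` levels still
to come, has `(r + 1 + a).choose a` nodes. -/
lemma one_add_sum_choose (r a : ℕ) :
    1 + ∑ i ∈ Finset.range a, (r + (i + 1)).choose (i + 1) = (r + 1 + a).choose a := by
  induction a with
  | zero => simp
  | succ a ih =>
    rw [Finset.sum_range_succ, ← add_assoc, ih, show r + 1 + (a + 1) = (r + 1 + a) + 1 by ring,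
      Nat.choose_succ_succ]
    congr 2
    ring

lemma sum_map_range_nat (n : ℕ) (f : ℕ → ℕ) :
    ((List.range n).map f).sum = ∑ i ∈ Finset.range n, f i := by
  rw [sum_map_range, Finset.sum_range]

lemma sum_map_flatMap {α β : Type*} (l : List α) (f : α → List β) (g : β → ℕ) :
    ((l.flatMap f).map g).sum = (l.map fun a => ((f a).map g).sum).sum := by
  induction l with
  | nil => rfl
  | cons a l ih => simp [List.flatMap_cons, ih]

lemma Node.Valid.expand {n Δ s k : ℕ} {x y : Node} (h : x.Valid n Δ s k) (hy : y ∈ x.expand) :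
    ∃ s' k', y.Valid n Δ s' k' := by
  obtain ⟨hm, ⟨j, hj, rfl⟩ | ⟨hph, d, hd, hdδ, v, hv, rfl⟩⟩ := (Node.mem_expand h.δ_pos).1 hy
  · exact ⟨_, _, h.iChild hm hj⟩
  · exact ⟨_, _, (h.tChild hph hm hd (h.Δ_eq ▸ hdδ) hv).2⟩

/-- The child with index `j` keeps `x.allow.length - j` allowed vectors, so after reversing the
order the sum is the one in `one_add_sum_choose`. -/
lemma one_add_sum_pot_iChild (n Δ : ℕ) {x : Node} (hn : x.n = n) (hm : x.m < x.n) :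
    1 + (((List.range x.allow.length).map x.iChild).map (Node.pot n Δ)).sum =
      (n - x.m + x.allow.length).choose x.allow.length := by
  rw [List.map_map, sum_map_range_nat, ← Finset.sum_range_reflect,
    show n - x.m = (n - x.m - 1) + 1 by omega, ← one_add_sum_choose]
  congr 1
  refine Finset.sum_congr rfl fun j hj => ?_
  rw [Finset.mem_range] at hj
  have : (boxExt 1 (x.allow.drop (x.allow.length - 1 - j))).length = j + 1 := by
    rw [length_boxExt, List.length_drop]; omega
  simp only [Function.comp_apply, Node.pot, Node.iChild, this]
  rw [if_neg (by simp)]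
  congr 1

/-- With `ρ = log₂ (Δ / δ)` and `K = (n + Δ).choose Δ`, the node and its unit children account for
at most `K`. There are at most `(Δ / δ) δ ≤ Δ` other children. For them the logarithm has dropped by
one, so each has potential at most `ρ Δ ^ (ρ - 1) K`. The total is at most `(ρ + 1) Δ ^ ρ K`. -/
lemma Node.Valid.pot {n Δ s k : ℕ} {x : Node} (h : x.Valid n Δ s k) :
    1 + (x.expand.map (Node.pot n Δ)).sum ≤ x.pot n Δ := by
  have hδ := h.δ_pos
  have hδΔ := h.δ_le
  by_cases hm : x.m < x.n
  swap
  · have : x.expand = [] := by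
      rw [List.eq_nil_iff_forall_not_mem]
      exact fun y hy => hm ((Node.mem_expand hδ).1 hy).1
    rw [this, Node.pot]
    split_ifs
    · simp only [List.map_nil, List.sum_nil, add_zero]
      have := Nat.choose_pos (n := n + Δ) (k := Δ) (by omega)
      have : 0 < Δ ^ Nat.log 2 (Δ / x.δ) := Nat.pow_pos (by omega)
      exact Nat.mul_pos (Nat.mul_pos (by omega) this) (by omega)
    · exact Nat.choose_pos (by omega)
  have h1 : zle (x.m + 1 : ℕ) x.n = true := by rw [zle_iff]; exact_mod_cast hm
  rw [Node.expand, h1, cond_true, List.map_append, List.sum_append, ← add_assoc,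
    one_add_sum_pot_iChild n Δ h.n_eq hm]
  cases hph : x.ph
  · simp [Node.pot, hph]
  have hallow : x.allow.length = x.δ := by rw [(h.ph hph).2, h.length_box]
  rw [cond_true, Node.pot, if_pos hph, hallow]
  set K := (n + Δ).choose Δ with hK
  have hKle : (n - x.m + x.δ).choose x.δ ≤ K := by
    calc (n - x.m + x.δ).choose x.δ = (n - x.m + x.δ).choose (n - x.m) :=
          (Nat.choose_symm_add).symm
      _ ≤ (n - x.m + Δ).choose (n - x.m) := Nat.choose_le_choose _ (by omega)
      _ = (n - x.m + Δ).choose Δ := Nat.choose_symm_add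
      _ ≤ K := Nat.choose_le_choose _ (by omega)
  set ρ := Nat.log 2 (Δ / x.δ) with hρ
  have hT : ∀ d : ℕ, (((bif zle 2 d && zle (d * x.δ : ℕ) x.Δ then x.box.map (x.tChild d) else []).map
      (Node.pot n Δ)).sum) ≤ if 2 ≤ d ∧ d ≤ Δ / x.δ then x.δ * (ρ * Δ ^ (ρ - 1) * K) else 0 := by
    intro d
    by_cases hd : 2 ≤ d ∧ d * x.δ ≤ Δ
    · have hc : (zle 2 d && zle (d * x.δ : ℕ) x.Δ) = true := by
        rw [Bool.and_eq_true, zle_iff, zle_iff, h.Δ_eq]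
        exact ⟨by exact_mod_cast hd.1, by exact_mod_cast hd.2⟩
      have hd' : 2 ≤ d ∧ d ≤ Δ / x.δ := ⟨hd.1, (Nat.le_div_iff_mul_le hδ).2 hd.2⟩
      rw [hc, cond_true, if_pos hd', List.map_map, ← h.length_box]
      refine (List.sum_le_card_nsmul _ (ρ * Δ ^ (ρ - 1) * K) ?_).trans (by simp)
      intro z hz
      rw [List.mem_map] at hz
      obtain ⟨v, _, rfl⟩ := hz
      -- Multiplying `δ` by `d ≥ 2` at least halves `Δ / δ`.
      have hlog : Nat.log 2 (Δ / (d * x.δ)) + 1 ≤ ρ := by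
        have h2 : Δ / (d * x.δ) ≤ Δ / x.δ / 2 := by
          rw [Nat.div_div_eq_div_mul]
          exact Nat.div_le_div_left (by nlinarith) (by omega)
        have h3 : Nat.log 2 (Δ / x.δ / 2) = ρ - 1 := Nat.log_div_base 2 _
        have h4 : 0 < ρ := Nat.log_pos (by norm_num) (by omega)
        have := Nat.log_mono_right (b := 2) h2
        omega
      simp only [Function.comp_apply, Node.pot, Node.tChild, if_true]
      gcongr
      · omega
      · omega
    · have hc : (zle 2 d && zle (d * x.δ : ℕ) x.Δ) = false := by
        rw [Bool.eq_false_iff, Ne, Bool.and_eq_true, zle_iff, zle_iff, h.Δ_eq]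
        exact fun hc => hd ⟨by exact_mod_cast hc.1, by exact_mod_cast hc.2⟩
      rw [hc]
      simp
  -- At most `Δ / δ` values of `d` contribute, each with `δ` vectors.
  have hsum : (((List.range (x.Δ + 1)).flatMap fun d : ℕ => bif zle 2 d && zle (d * x.δ : ℕ) x.Δ then
      x.box.map (x.tChild d) else []).map (Node.pot n Δ)).sum ≤ Δ * (ρ * Δ ^ (ρ - 1) * K) := by
    rw [sum_map_flatMap, sum_map_range_nat]
    refine (Finset.sum_le_sum fun d _ => hT d).trans ?_
    rw [← Finset.sum_filter, Finset.sum_const, smul_eq_mul, ← mul_assoc]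
    refine Nat.mul_le_mul_right _ (le_trans (Nat.mul_le_mul_right _ ?_) (Nat.div_mul_le_self Δ x.δ))
    refine (Finset.card_le_card (t := Finset.Icc 1 (Δ / x.δ)) fun d hd => ?_).trans (by simp)
    rw [Finset.mem_filter] at hd
    rw [Finset.mem_Icc]
    omega
  refine (add_le_add hKle hsum).trans ?_
  rcases Nat.eq_zero_or_pos ρ with h0 | h0
  · simp [h0]
  · have h5 : 1 ≤ Δ ^ ρ := Nat.pow_pos (by omega)
    have h6 : Δ * (ρ * Δ ^ (ρ - 1) * K) = ρ * Δ ^ ρ * K := by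
      obtain ⟨q, hq⟩ : ∃ q, ρ = q + 1 := ⟨ρ - 1, by omega⟩
      rw [hq, Nat.add_sub_cancel, pow_succ]
      ring
    rw [h6]
    nlinarith [Nat.mul_le_mul_right K h5]

lemma sz_vec_le {w : List ℤ} {m D : ℕ} (hw : w.length ≤ m) (h : ∀ i < w.length, |gz w i| ≤ D) :
    sz w ≤ m * (D + 2) + 1 := by
  refine (sz_list_le (m := D + 1) fun a ha => ?_).trans (by gcongr)
  obtain ⟨i, hi, rfl⟩ := List.getElem_of_mem ha
  have := h i hi
  rw [gz_eq_getElem hi, Int.abs_eq_natAbs] at this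
  rw [sz_int]
  omega

lemma sz_vecs_le {l : List (List ℤ)} {m D a : ℕ} (hl : l.length ≤ a) (hw : ∀ w ∈ l, w.length ≤ m)
    (h : ∀ w ∈ l, ∀ i < m, |gz w i| ≤ D) : sz l ≤ a * (m * (D + 2) + 2) + 1 :=
  (sz_list_le fun w hwl => sz_vec_le (hw w hwl) fun i hi => h w hwl i (hi.trans_le (hw w hwl))).trans
    (by gcongr)

lemma IsHNF.diag_le {s k δ : ℕ} {A : List (List ℤ)} (h : IsHNF s k A)
    (hdet : (toMat (s + k) A).det = δ) {i : ℕ} (hi : i < s + k) : ent A i i ≤ δ := by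
  rw [← hdet, h.det]
  refine le_of_eq_of_le (Finset.prod_singleton (fun i : Fin (s + k) => ent A i i) ⟨i, hi⟩).symm ?_
  exact Finset.prod_le_prod_of_subset_of_one_le (Finset.subset_univ _)
    (fun j _ => (h.diag_pos j.2).trans' zero_le_one) fun j _ _ => h.diag_pos j.2

/-- A bound for the size of the nodes. -/
def sizeBound (n Δ : ℕ) : ℕ := 4 * ((n + Δ) * (n * (Δ + 2) + 2) + 1) + 2 * (n + Δ) + 30

/-- All entries are bounded by `Δ`. The length `n + Δ` serves for all four lists: `A` has at most
`n` rows, the others at most `δ ≤ Δ` elements. -/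
lemma Node.Valid.sz_le {n Δ s k : ℕ} {x : Node} (h : x.Valid n Δ s k) :
    sz x ≤ sizeBound n Δ := by
  have hδ := h.δ_le
  have hm := h.m_le
  have hdiag : ∀ i < s + k, ent x.A i i ≤ Δ := fun i hi =>
    (h.hnf.diag_le h.det hi).trans (by exact_mod_cast hδ)
  have hbox : ∀ w ∈ x.box, w.length ≤ n ∧ ∀ i < n, |gz w i| ≤ Δ := fun w hw => by
    obtain ⟨h1, h2⟩ := (h.mem_box w).1 hw
    refine ⟨by omega, fun i _ => ?_⟩
    by_cases hi : i < s + k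
    · have := h2 i hi
      have := hdiag i hi
      rw [abs_le]; omega
    · rw [gz_of_length_le (by omega)]; simp
  have htaus : ∀ w ∈ x.taus, w.length ≤ n ∧ ∀ i < n, |gz w i| ≤ Δ := fun w hw => by
    obtain ⟨h1, h2, _⟩ := (h.mem_taus w).1 hw
    refine ⟨by omega, fun i _ => ?_⟩
    by_cases hi : i < s + k
    · have := h2 i hi
      rw [abs_le]; omega
    · rw [gz_of_length_le (by omega)]; simp
  have hA : ∀ w ∈ x.A, w.length ≤ n ∧ ∀ i < n, |gz w i| ≤ Δ := fun w hw => by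
    have h1 := h.hnf.row_length w hw
    refine ⟨by omega, fun j _ => ?_⟩
    by_cases hj : j < s + k
    · obtain ⟨i, hi, rfl⟩ := List.getElem_of_mem hw
      have h2 : gz x.A[i] j = ent x.A i j := by
        simp [ent, List.getD_eq_getElem?_getD, hi]
      rw [h2]
      rw [h.hnf.length] at hi
      rcases lt_trichotomy i j with hij | rfl | hij
      · rw [h.hnf.upper i j hij hj]; simp
      · have := h.hnf.diag_pos hi
        have := hdiag i hi
        rw [abs_le]; omega
      · have := h.hnf.lower i j hij hi
        have := hdiag i hi
        rw [abs_le]; omega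
    · rw [gz_of_length_le (by omega)]; simp
  have h1 := sz_vecs_le (a := n + Δ) (by rw [h.hnf.length]; omega) (fun w hw => (hA w hw).1)
    fun w hw => (hA w hw).2
  have h2 := sz_vecs_le (a := n + Δ) (by rw [h.length_box]; omega) (fun w hw => (hbox w hw).1)
    fun w hw => (hbox w hw).2
  have h3 := sz_vecs_le (a := n + Δ) (by rw [h.length_taus]; omega) (fun w hw => (htaus w hw).1)
    fun w hw => (htaus w hw).2
  have h4 := sz_vecs_le (l := x.allow) (a := n + Δ) (by have := h.length_allow; omega)
    (fun w hw => (hbox w ((h.mem_allow w).1 hw).1).1) fun w hw => (hbox w ((h.mem_allow w).1 hw).1).2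
  change sz (x.n, x.Δ, x.m, x.δ, x.ph, x.A, x.box, x.taus, x.allow) ≤ _
  have h5 := sz_bool x.ph
  simp only [sz_prod, sz_nat]
  rw [h.n_eq, h.Δ_eq, h.m_eq, sizeBound]
  omega

/-- Every matrix in Hermite normal form of determinant at most `Δ` is found. -/
lemma exists_reachable_node {S K Δ : ℕ} (hΔ : 1 ≤ Δ) (H : ℕ → ℕ → ℤ)
    (lower : ∀ i j, j < i → i < S + K → 0 ≤ H i j ∧ H i j < H i i)
    (upper : ∀ i j, i < j → j < S + K → H i j = 0)
    (diag_one : ∀ i < S, H i i = 1) (diag_two : ∀ i, S ≤ i → i < S + K → 2 ≤ H i i)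
    (sorted : ∀ j j', j ≤ j' → j' < S →
      toLex (fun i : Fin K => H (S + i) j) ≤ toLex (fun i : Fin K => H (S + i) j'))
    (hdet : ∏ i ∈ Finset.range (S + K), H i i ≤ Δ) :
    ∃ x, Relation.ReflTransGen (fun a b => b ∈ Node.expand a) (Node.root (S + K) Δ) x ∧
      x.Valid (S + K) Δ S K ∧ ∀ i j, i < S + K → j < S + K → ent x.A i j = H i j := by
  have pos : ∀ i < S + K, 1 ≤ H i i := fun i hi => by
    by_cases his : i < S
    · exact (diag_one i his).ge
    · exact le_trans one_le_two (diag_two i (by omega) hi)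
  -- The trailing `k × k` blocks of `H` are reached by columns with diagonal entry at least `2`.
  have hT : ∀ k ≤ K, ∃ x, Relation.ReflTransGen (fun a b => b ∈ Node.expand a) (Node.root (S + K) Δ) x ∧
      x.Valid (S + K) Δ 0 k ∧ x.ph = true ∧
      ∀ i j, i < k → j < k → ent x.A i j = H (S + K - k + i) (S + K - k + j) := by
    intro k
    induction k with
    | zero => exact fun _ => ⟨_, .refl, Node.valid_root hΔ, rfl, by simp⟩
    | succ k ih =>
      intro hk
      obtain ⟨x, hx, hval, hph, hent⟩ := ih (by omega)
      have e1 : S + K - k = (S + K - (k + 1)) + 1 := by omega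
      set p := S + K - (k + 1) with hp
      have hpp := diag_two p (by omega) (by omega)
      set v : List ℤ := (List.range k).map fun i => H (p + 1 + i) p with hv
      have hvbox : v ∈ x.box := by
        rw [hval.mem_box, zero_add]
        refine ⟨by simp [hv], fun i hi => ?_⟩
        rw [hv, gz_map_range _ hi, hent i i hi hi, e1]
        exact lower _ _ (by omega) (by omega)
      have hm : x.m < x.n := by rw [hval.m_eq, hval.n_eq]; omega
      -- The left side is the product of the last `k + 1` diagonal entries, hence at most the
      -- product of all of them.
      have hdδ : (H p p).toNat * x.δ ≤ Δ := by
        zify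
        rw [Int.toNat_of_nonneg (by omega), ← hval.det, hval.hnf.det]
        refine le_trans (le_of_eq (b := ∏ i ∈ Finset.range (k + 1), H (p + i) (p + i)) ?_)
          (le_trans ?_ hdet)
        · rw [Finset.prod_range_succ', add_zero, mul_comm, zero_add, Finset.prod_range]
          congr 1
          refine Finset.prod_congr rfl fun i _ => ?_
          rw [hent i i i.2 i.2, e1, add_right_comm, add_assoc]
        · have h0 : (0 : ℤ) ≤ ∏ i ∈ Finset.range (k + 1), H (p + i) (p + i) :=
            Finset.prod_nonneg fun i hi => by
              rw [Finset.mem_range] at hi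
              exact (pos _ (by omega)).trans' zero_le_one
          have h1 : (1 : ℤ) ≤ ∏ i ∈ Finset.range p, H i i :=
            Finset.one_le_prod fun i hi => pos _ (by rw [Finset.mem_range] at hi; omega)
          rw [show S + K = p + (k + 1) by omega, Finset.prod_range_add _ p]
          exact le_mul_of_one_le_left h0 h1
      have hd2 : 2 ≤ (H p p).toNat := by omega
      refine ⟨x.tChild (H p p).toNat v, hx.tail ((Node.mem_expand hval.δ_pos).2 ⟨hm, .inr ⟨hph, _,
        hd2, by rw [hval.Δ_eq]; exact hdδ, v, hvbox, rfl⟩⟩),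
        (hval.tChild hph hm hd2 hdδ hvbox).2, rfl, ?_⟩
      have e2 : (x.tChild (H p p).toNat v).A = addRow k (H p p).toNat v x.A := by
        rw [← zero_add k, ← hval.m_eq]; rfl
      rw [e2]
      rintro (_ | i) (_ | j) hi hj
      · rw [ent_addRow_zero_zero, Int.toNat_of_nonneg (by omega)]; rfl
      · rw [ent_addRow_zero_succ, upper _ _ (by omega) (by omega)]
      · rw [ent_addRow_succ_zero _ _ _ (by omega), hv, gz_map_range _ (by omega)]
        congr 1; omega
      · rw [ent_addRow_succ_succ _ _ _ (by omega), hent i j (by omega) (by omega), e1]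
        congr 1 <;> omega
  -- Unit columns are then prepended from right to left; `sorted` says that the next one is still
  -- allowed.
  have hI : ∀ s ≤ S, ∃ x, Relation.ReflTransGen (fun a b => b ∈ Node.expand a) (Node.root (S + K) Δ) x ∧
      x.Valid (S + K) Δ s K ∧
      ∀ i j, i < s + K → j < s + K → ent x.A i j = H (S - s + i) (S - s + j) := by
    intro s
    induction s with
    | zero =>
      intro _
      obtain ⟨x, hx, hval, _, hent⟩ := hT K le_rfl
      refine ⟨x, hx, hval, fun i j hi hj => ?_⟩
      rw [hent i j (by omega) (by omega), Nat.add_sub_cancel, Nat.sub_zero]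
    | succ s ih =>
      intro hs
      obtain ⟨x, hx, hval, hent⟩ := ih (by omega)
      have e1 : S - s = (S - (s + 1)) + 1 := by omega
      set p := S - (s + 1) with hp
      set v : List ℤ := (List.range (s + K)).map fun i => H (p + 1 + i) p with hv
      have hvbox : v ∈ x.box := by
        rw [hval.mem_box]
        refine ⟨by simp [hv], fun i hi => ?_⟩
        rw [hv, gz_map_range _ hi, hent i i hi hi, e1]
        exact lower _ _ (by omega) (by omega)
      have hvallow : v ∈ x.allow := by
        rw [hval.mem_allow]
        refine ⟨hvbox, fun j hj => ?_⟩
        convert sorted p (p + 1 + j) (by omega) (by omega) using 1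
        · refine congrArg toLex (funext fun i => ?_)
          rw [hv, gz_map_range _ (by omega)]
          congr 1; omega
        · refine congrArg toLex (funext fun i => ?_)
          rw [hent _ _ (by omega) (by omega), e1]
          congr 1; omega
      have hm : x.m < x.n := by rw [hval.m_eq, hval.n_eq]; omega
      obtain ⟨j, hj, hjv⟩ := List.getElem_of_mem hvallow
      refine ⟨x.iChild j, hx.tail ((Node.mem_expand hval.δ_pos).2 ⟨hm, .inl ⟨j, hj, rfl⟩⟩),
        hval.iChild hm hj, ?_⟩
      have e2 : (x.iChild j).A = addRow (s + K) 1 v x.A := by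
        rw [← hval.m_eq, ← hjv]
        change addRow x.m 1 ((x.allow.drop j).headD []) x.A = _
        rw [List.drop_eq_getElem_cons hj]
        rfl
      rw [e2]
      rintro (_ | i) (_ | j) hi hj
      · rw [ent_addRow_zero_zero, add_zero, diag_one p (by omega)]; rfl
      · rw [ent_addRow_zero_succ, upper _ _ (by omega) (by omega)]
      · rw [ent_addRow_succ_zero _ _ _ (by omega), hv, gz_map_range _ (by omega)]
        congr 1; omega
      · rw [ent_addRow_succ_succ _ _ _ (by omega), hent i j (by omega) (by omega), e1]
        congr 1 <;> omega
  obtain ⟨x, hx, hval, hent⟩ := hI S le_rfl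
  exact ⟨x, hx, hval, fun i j hi hj => by rw [hent i j hi hj, Nat.sub_self, zero_add, zero_add]⟩

lemma Node.valid_of_reachable {n Δ : ℕ} (hΔ : 1 ≤ Δ) {x : Node}
    (h : Relation.ReflTransGen (fun a b => b ∈ Node.expand a) (Node.root n Δ) x) :
    ∃ s k, x.Valid n Δ s k := by
  induction h with
  | refl => exact ⟨0, 0, Node.valid_root hΔ⟩
  | tail _ hbc ih =>
    obtain ⟨s, k, h⟩ := ih
    exact h.expand hbc

end EmptySimplices

namespace EmptySimplices
open Matrix

/-! ### Unimodular equivalence -/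

section unimodular
variable {n : ℕ}

/-- The map `x ↦ U x + x₀`. -/
def uniMap (U : Matrix (Fin n) (Fin n) ℤ) (x₀ : Fin n → ℤ) (x : Fin n → ℝ) : Fin n → ℝ :=
  fun i => ∑ j, (U i j : ℝ) * x j + (x₀ i : ℝ)

lemma uniMap_eq (U : Matrix (Fin n) (Fin n) ℤ) (x₀ : Fin n → ℤ) (x : Fin n → ℝ) :
    uniMap U x₀ x = U.map (Int.cast : ℤ → ℝ) *ᵥ x + fun i => (x₀ i : ℝ) := rfl

lemma uniMap_uniMap (U V : Matrix (Fin n) (Fin n) ℤ) (x₀ y₀ : Fin n → ℤ) (x : Fin n → ℝ) :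
    uniMap V y₀ (uniMap U x₀ x) = uniMap (V * U) (V *ᵥ x₀ + y₀) x := by
  simp only [uniMap_eq, mulVec_add, mulVec_mulVec, add_assoc]
  congr 1
  · congr 1
    exact (Matrix.map_mul (f := Int.castRingHom ℝ)).symm
  · funext i
    simp [mulVec, dotProduct]

lemma uniMap_one (x : Fin n → ℝ) : uniMap 1 0 x = x := by
  rw [uniMap_eq]
  have : (1 : Matrix (Fin n) (Fin n) ℤ).map (Int.cast : ℤ → ℝ) = 1 :=
    Matrix.map_one _ Int.cast_zero Int.cast_one
  rw [this, one_mulVec]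
  funext i
  simp

lemma unimodularEquiv_iff {S S' : Set (Fin n → ℝ)} :
    UnimodularEquiv S S' ↔ ∃ U x₀, IsUnit U.det ∧ uniMap U x₀ '' S = S' := Iff.rfl

lemma UnimodularEquiv.trans {S S' S'' : Set (Fin n → ℝ)} (h : UnimodularEquiv S S')
    (h' : UnimodularEquiv S' S'') : UnimodularEquiv S S'' := by
  obtain ⟨U, x₀, hU, rfl⟩ := unimodularEquiv_iff.1 h
  obtain ⟨V, y₀, hV, rfl⟩ := unimodularEquiv_iff.1 h'
  refine unimodularEquiv_iff.2 ⟨V * U, V *ᵥ x₀ + y₀, by rw [det_mul]; exact hV.mul hU, ?_⟩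
  rw [Set.image_image]
  simp only [uniMap_uniMap]

lemma uniMap_inv_uniMap {U : Matrix (Fin n) (Fin n) ℤ} (hU : IsUnit U.det) (x₀ : Fin n → ℤ)
    (x : Fin n → ℝ) : uniMap U⁻¹ (-(U⁻¹ *ᵥ x₀)) (uniMap U x₀ x) = x := by
  rw [uniMap_uniMap, nonsing_inv_mul _ hU, add_neg_cancel, uniMap_one]

lemma uniMap_uniMap_inv {U : Matrix (Fin n) (Fin n) ℤ} (hU : IsUnit U.det) (x₀ : Fin n → ℤ)
    (x : Fin n → ℝ) : uniMap U x₀ (uniMap U⁻¹ (-(U⁻¹ *ᵥ x₀)) x) = x := by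
  rw [uniMap_uniMap, mul_nonsing_inv _ hU, mulVec_neg, mulVec_mulVec, mul_nonsing_inv _ hU,
    one_mulVec, neg_add_cancel, uniMap_one]

lemma UnimodularEquiv.symm {S S' : Set (Fin n → ℝ)} (h : UnimodularEquiv S S') :
    UnimodularEquiv S' S := by
  obtain ⟨U, x₀, hU, rfl⟩ := unimodularEquiv_iff.1 h
  refine unimodularEquiv_iff.2 ⟨U⁻¹, -(U⁻¹ *ᵥ x₀), by
    rw [det_nonsing_inv]; exact isUnit_ringInverse.2 hU, ?_⟩
  rw [Set.image_image]
  simp only [uniMap_inv_uniMap hU, Set.image_id']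

lemma uniMap_mem_integerPoints (U : Matrix (Fin n) (Fin n) ℤ) (x₀ : Fin n → ℤ) {x : Fin n → ℝ}
    (hx : x ∈ integerPoints n) : uniMap U x₀ x ∈ integerPoints n := by
  obtain ⟨z, rfl⟩ := hx
  exact ⟨U *ᵥ z + x₀, by funext i; simp [uniMap, mulVec, dotProduct]⟩

lemma uniMap_mem_integerPoints_iff {U : Matrix (Fin n) (Fin n) ℤ} (hU : IsUnit U.det)
    (x₀ : Fin n → ℤ) {x : Fin n → ℝ} :
    uniMap U x₀ x ∈ integerPoints n ↔ x ∈ integerPoints n := by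
  refine ⟨fun h => ?_, uniMap_mem_integerPoints U x₀⟩
  rw [← uniMap_inv_uniMap hU x₀ x]
  exact uniMap_mem_integerPoints _ _ h

lemma uniMap_injective {U : Matrix (Fin n) (Fin n) ℤ} (hU : IsUnit U.det) (x₀ : Fin n → ℤ) :
    Function.Injective (uniMap U x₀) := fun x y h => by
  rw [← uniMap_inv_uniMap hU x₀ x, h, uniMap_inv_uniMap hU]

lemma uniMap_combo (U : Matrix (Fin n) (Fin n) ℤ) (x₀ : Fin n → ℤ) (x y : Fin n → ℝ) {a b : ℝ}
    (hab : a + b = 1) : uniMap U x₀ (a • x + b • y) = a • uniMap U x₀ x + b • uniMap U x₀ y := by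
  simp only [uniMap_eq, mulVec_add, mulVec_smul, smul_add]
  have : (fun i => (x₀ i : ℝ)) = a • (fun i => (x₀ i : ℝ)) + b • (fun i => (x₀ i : ℝ)) := by
    rw [← add_smul, hab, one_smul]
  rw [this]
  simp only [smul_add]
  have h2 : ∀ v : Fin n → ℝ, a • (a • v) + a • (b • v) = a • v := fun v => by
    rw [← smul_add, ← add_smul, hab, one_smul]
  have h3 : ∀ v : Fin n → ℝ, b • (a • v) + b • (b • v) = b • v := fun v => by
    rw [← smul_add, ← add_smul, hab, one_smul]
  rw [h2, h3]
  abel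

lemma uniMap_mem_extremePoints {U : Matrix (Fin n) (Fin n) ℤ} (hU : IsUnit U.det)
    (x₀ : Fin n → ℤ) {S : Set (Fin n → ℝ)} {x : Fin n → ℝ} (hx : x ∈ S.extremePoints ℝ) :
    uniMap U x₀ x ∈ (uniMap U x₀ '' S).extremePoints ℝ := by
  rw [mem_extremePoints_iff_left] at hx ⊢
  refine ⟨Set.mem_image_of_mem _ hx.1, ?_⟩
  rintro _ ⟨y, hy, rfl⟩ _ ⟨z, hz, rfl⟩ ⟨a, b, ha, hb, hab, h⟩
  rw [← uniMap_combo U x₀ y z hab] at h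
  rw [hx.2 y hy z hz ⟨a, b, ha, hb, hab, uniMap_injective hU x₀ h⟩]

lemma image_extremePoints_uniMap {U : Matrix (Fin n) (Fin n) ℤ} (hU : IsUnit U.det)
    (x₀ : Fin n → ℤ) (S : Set (Fin n → ℝ)) :
    uniMap U x₀ '' S.extremePoints ℝ = (uniMap U x₀ '' S).extremePoints ℝ := by
  apply Set.Subset.antisymm
  · rintro _ ⟨x, hx, rfl⟩
    exact uniMap_mem_extremePoints hU x₀ hx
  · intro y hy
    have hU' : IsUnit (U⁻¹).det := by rw [det_nonsing_inv]; exact isUnit_ringInverse.2 hU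
    have := uniMap_mem_extremePoints hU' (-(U⁻¹ *ᵥ x₀)) hy
    rw [Set.image_image] at this
    simp only [uniMap_inv_uniMap hU, Set.image_id'] at this
    exact ⟨_, this, uniMap_uniMap_inv hU x₀ y⟩

lemma UnimodularEquiv.inter_integerPoints_eq_empty {S S' : Set (Fin n → ℝ)}
    (h : UnimodularEquiv S S') (hS : S ∩ integerPoints n = ∅) : S' ∩ integerPoints n = ∅ := by
  obtain ⟨U, x₀, hU, rfl⟩ := unimodularEquiv_iff.1 h
  rw [Set.eq_empty_iff_forall_notMem] at hS ⊢
  rintro _ ⟨⟨x, hx, rfl⟩, hz⟩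
  exact hS x ⟨hx, (uniMap_mem_integerPoints_iff hU x₀).1 hz⟩

lemma UnimodularEquiv.extremePoints_subset {S S' : Set (Fin n → ℝ)} (h : UnimodularEquiv S S')
    (hS : S.extremePoints ℝ ⊆ integerPoints n) : S'.extremePoints ℝ ⊆ integerPoints n := by
  obtain ⟨U, x₀, hU, rfl⟩ := unimodularEquiv_iff.1 h
  rw [← image_extremePoints_uniMap hU]
  rintro _ ⟨x, hx, rfl⟩
  exact uniMap_mem_integerPoints _ _ (hS hx)

lemma UnimodularEquiv.inter_integerPoints_eq_extremePoints {S S' : Set (Fin n → ℝ)}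
    (h : UnimodularEquiv S S') (hS : S ∩ integerPoints n = S.extremePoints ℝ) :
    S' ∩ integerPoints n = S'.extremePoints ℝ := by
  obtain ⟨U, x₀, hU, rfl⟩ := unimodularEquiv_iff.1 h
  rw [← image_extremePoints_uniMap hU, ← hS]
  ext y
  constructor
  · rintro ⟨⟨x, hx, rfl⟩, hz⟩
    exact ⟨x, ⟨hx, (uniMap_mem_integerPoints_iff hU x₀).1 hz⟩, rfl⟩
  · rintro ⟨x, ⟨hx, hz⟩, rfl⟩
    exact ⟨⟨x, hx, rfl⟩, (uniMap_mem_integerPoints_iff hU x₀).2 hz⟩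

lemma UnimodularEquiv.nontrivial {S S' : Set (Fin n → ℝ)} (h : UnimodularEquiv S S')
    (hS : S.Nontrivial) : S'.Nontrivial := by
  obtain ⟨U, x₀, hU, rfl⟩ := unimodularEquiv_iff.1 h
  exact hS.image (uniMap_injective hU x₀)

lemma IsSimplex.nontrivial {S : Set (Fin n → ℝ)} (hn : 1 ≤ n) (h : IsSimplex S) :
    S.Nontrivial := by
  obtain ⟨s, rfl⟩ := h
  refine ⟨s.points 0, subset_convexHull _ _ ⟨0, rfl⟩, s.points (Fin.last n),
    subset_convexHull _ _ ⟨_, rfl⟩, fun h => ?_⟩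
  have := congrArg Fin.val (s.independent.injective h)
  simp at this
  omega

lemma IsSimplex.isBounded {S : Set (Fin n → ℝ)} (h : IsSimplex S) : Bornology.IsBounded S := by
  obtain ⟨s, rfl⟩ := h
  exact isBounded_convexHull.2 (Set.finite_range _).isBounded

end unimodular

/-! ### The simplex defined by a system -/

section geometry
variable {n : ℕ} {σ : IneqSystem n} {δ : ℤ} {τ : Fin n → ℤ}

/-- `σ` is the system `H x ≤ h`, `-(Hᵀ τ / δ) x ≤ c₀` with `det H = δ > 0` and `τ ∈ [1, δ]ⁿ`. -/
structure IneqSystem.HasSlacks (σ : IneqSystem n) (δ : ℤ) (τ : Fin n → ℤ) : Prop where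
  det : σ.H.det = δ
  pos : 0 < δ
  one_le : ∀ i, 1 ≤ τ i
  le : ∀ i, τ i ≤ δ
  c_eq : ∀ j, δ * σ.c j = -∑ i, σ.H i j * τ i

/-- The bound `δ c₀ + τ h` for the weighted sum of the slacks. -/
def IneqSystem.bound (σ : IneqSystem n) (δ : ℤ) (τ : Fin n → ℤ) : ℤ :=
  δ * σ.rhs (Fin.last n) + ∑ i, τ i * σ.h i

/-- The slacks of the first `n` inequalities. -/
def IneqSystem.slacks (σ : IneqSystem n) (x : Fin n → ℝ) : Fin n → ℝ :=
  fun i => σ.h i - ∑ j, (σ.H i j : ℝ) * x j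

lemma IneqSystem.slacks_eq (σ : IneqSystem n) (x : Fin n → ℝ) :
    σ.slacks x = (fun i => (σ.h i : ℝ)) - σ.H.map (Int.cast : ℤ → ℝ) *ᵥ x := rfl

/-- Multiplied by `δ`, the last inequality becomes the bound on the weighted sum of the slacks,
because `δ c = -Hᵀ τ`. -/
lemma IneqSystem.HasSlacks.mem_solutions (hσ : σ.HasSlacks δ τ) (x : Fin n → ℝ) :
    x ∈ σ.solutions ↔ (∀ i, 0 ≤ σ.slacks x i) ∧ ∑ i, τ i * σ.slacks x i ≤ σ.bound δ τ := by
  have hδ : (0 : ℝ) < δ := by exact_mod_cast hσ.pos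
  rw [IneqSystem.solutions, Set.mem_ofPred_eq, Fin.forall_fin_succ']
  refine and_congr (forall_congr' fun i => ?_) ?_
  · rw [IneqSystem.slacks, sub_nonneg]; rfl
  · have h1 : ∑ i, τ i * σ.slacks x i =
        ∑ i, (τ i : ℝ) * σ.h i + δ * ∑ j, (σ.c j : ℝ) * x j := by
      have h2 : ∀ j, (δ : ℝ) * σ.c j = -∑ i, (σ.H i j : ℝ) * τ i := fun j => by
        exact_mod_cast hσ.c_eq j
      simp only [IneqSystem.slacks, mul_sub, Finset.sum_sub_distrib, Finset.mul_sum]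
      rw [sub_eq_add_neg]
      congr 1
      simp only [← mul_assoc, h2, neg_mul, Finset.sum_neg_distrib, Finset.sum_mul]
      rw [Finset.sum_comm]
      congr 1
      exact Finset.sum_congr rfl fun j _ => Finset.sum_congr rfl fun i _ => by ring
    rw [h1, IneqSystem.bound]
    push_cast
    rw [add_comm, add_le_add_iff_right, mul_le_mul_iff_right₀ hδ]
    rfl

lemma IneqSystem.HasSlacks.isUnit_det (hσ : σ.HasSlacks δ τ) :
    IsUnit (σ.H.map (Int.cast : ℤ → ℝ)).det := by
  have : (σ.H.map (Int.cast : ℤ → ℝ)).det = δ := by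
    rw [← hσ.det]; exact ((Int.castRingHom ℝ).map_det _).symm
  rw [this, isUnit_iff_ne_zero]
  exact_mod_cast hσ.pos.ne'

lemma IneqSystem.HasSlacks.slacks_injective (hσ : σ.HasSlacks δ τ) :
    Function.Injective σ.slacks := fun x y h => by
  rw [slacks_eq, slacks_eq, sub_right_inj] at h
  exact (Matrix.mulVec_injective_iff_isUnit.2 ((Matrix.isUnit_iff_isUnit_det _).2 hσ.isUnit_det)) h

/-- The point with given slacks. -/
noncomputable def IneqSystem.point (σ : IneqSystem n) (y : Fin n → ℝ) : Fin n → ℝ :=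
  (σ.H.map (Int.cast : ℤ → ℝ))⁻¹ *ᵥ ((fun i => (σ.h i : ℝ)) - y)

lemma IneqSystem.HasSlacks.slacks_point (hσ : σ.HasSlacks δ τ) (y : Fin n → ℝ) :
    σ.slacks (σ.point y) = y := by
  rw [slacks_eq, point, mulVec_mulVec, mul_nonsing_inv _ hσ.isUnit_det, one_mulVec, sub_sub_cancel]

lemma IneqSystem.slacks_sum {ι : Type*} (s : Finset ι) (w : ι → ℝ) (p : ι → Fin n → ℝ)
    (hw : ∑ i ∈ s, w i = 1) : σ.slacks (∑ i ∈ s, w i • p i) = ∑ i ∈ s, w i • σ.slacks (p i) := by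
  simp only [slacks_eq, smul_sub, Finset.sum_sub_distrib, ← Finset.sum_smul, hw, one_smul,
    mulVec_sum, mulVec_smul]

/-- The weights are positive, so a bound `≤ 0` would force all slacks to vanish and leave at most
one point. -/
lemma IneqSystem.HasSlacks.bound_pos (hσ : σ.HasSlacks δ τ) (h : σ.solutions.Nontrivial) :
    0 < σ.bound δ τ := by
  obtain ⟨x, hx, x', hx', hne⟩ := h
  rw [hσ.mem_solutions] at hx hx'
  by_contra! hR
  have hR' : (σ.bound δ τ : ℝ) ≤ 0 := by exact_mod_cast hR
  have hτ : ∀ i, (1 : ℝ) ≤ τ i := fun i => by exact_mod_cast hσ.one_le i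
  have key : ∀ z, ((∀ i, 0 ≤ σ.slacks z i) ∧ ∑ i, τ i * σ.slacks z i ≤ σ.bound δ τ) →
      σ.slacks z = 0 := by
    rintro z ⟨h1, h2⟩
    have h3 : ∀ i ∈ Finset.univ, 0 ≤ (τ i : ℝ) * σ.slacks z i := fun i _ =>
      mul_nonneg (zero_le_one.trans (hτ i)) (h1 i)
    have h4 := (Finset.sum_eq_zero_iff_of_nonneg h3).1
      (le_antisymm (h2.trans hR') (Finset.sum_nonneg h3))
    funext i
    have := h4 i (Finset.mem_univ i)
    exact (mul_eq_zero.1 this).resolve_left (by have := hτ i; positivity)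
  exact hne (hσ.slacks_injective ((key x hx).trans (key x' hx').symm))

/-- The vertices of the simplex defined by the system. -/
noncomputable def IneqSystem.vertex (σ : IneqSystem n) (δ : ℤ) (τ : Fin n → ℤ) :
    Fin (n + 1) → Fin n → ℝ :=
  Fin.cons (σ.point 0) fun i => σ.point (Pi.single i ((σ.bound δ τ : ℝ) / τ i))

lemma IneqSystem.HasSlacks.slacks_vertex_zero (hσ : σ.HasSlacks δ τ) :
    σ.slacks (σ.vertex δ τ 0) = 0 := hσ.slacks_point _

lemma IneqSystem.HasSlacks.slacks_vertex_succ (hσ : σ.HasSlacks δ τ) (i : Fin n) :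
    σ.slacks (σ.vertex δ τ i.succ) = Pi.single i ((σ.bound δ τ : ℝ) / τ i) := hσ.slacks_point _

/-- In slack coordinates the vertices are the origin and nonzero multiples of the unit vectors. -/
lemma IneqSystem.HasSlacks.affineIndependent (hσ : σ.HasSlacks δ τ) (hR : 0 < σ.bound δ τ) :
    AffineIndependent ℝ (σ.vertex δ τ) := by
  classical
  rw [affineIndependent_iff_of_fintype]
  intro w hw h
  rw [Finset.weightedVSub_eq_linear_combination _ hw] at h
  have h1 : ∑ i, w i • σ.slacks (σ.vertex δ τ i) = 0 := by
    simp only [slacks_eq, smul_sub, Finset.sum_sub_distrib, ← Finset.sum_smul, hw, zero_smul]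
    rw [zero_sub, neg_eq_zero]
    have := congrArg (σ.H.map (Int.cast : ℤ → ℝ) *ᵥ ·) h
    simpa only [mulVec_sum, mulVec_smul, mulVec_zero] using this
  have h2 : ∀ i : Fin n, w i.succ = 0 := by
    intro i
    have := congrFun h1 i
    rw [Fin.sum_univ_succ, hσ.slacks_vertex_zero, smul_zero, zero_add] at this
    simp only [hσ.slacks_vertex_succ, Finset.sum_apply, Pi.smul_apply, smul_eq_mul, Pi.zero_apply]
      at this
    rw [Finset.sum_eq_single i] at this
    · rw [Pi.single_eq_same] at this
      refine (mul_eq_zero.1 this).resolve_right (div_ne_zero ?_ ?_)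
      · exact_mod_cast hR.ne'
      · have := hσ.one_le i
        exact_mod_cast (by omega : τ i ≠ 0)
    · intro j _ hj
      rw [Pi.single_eq_of_ne hj.symm, mul_zero]
    · simp
  intro i
  refine Fin.cases ?_ h2 i
  rw [Fin.sum_univ_succ] at hw
  simpa [h2] using hw

lemma IneqSystem.convex_solutions (σ : IneqSystem n) : Convex ℝ σ.solutions := by
  intro x hx y hy a b ha hb hab i
  have h1 := mul_le_mul_of_nonneg_left (hx i) ha
  have h2 := mul_le_mul_of_nonneg_left (hy i) hb
  have h3 : ∑ j, (σ.mat i j : ℝ) * (a • x + b • y) j =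
      a * ∑ j, (σ.mat i j : ℝ) * x j + b * ∑ j, (σ.mat i j : ℝ) * y j := by
    rw [Finset.mul_sum, Finset.mul_sum, ← Finset.sum_add_distrib]
    exact Finset.sum_congr rfl fun j _ => by
      simp only [Pi.add_apply, Pi.smul_apply, smul_eq_mul]; ring
  rw [h3]
  calc _ ≤ a * (σ.rhs i : ℝ) + b * σ.rhs i := add_le_add h1 h2
    _ = σ.rhs i := by rw [← add_mul, hab, one_mul]

lemma IneqSystem.HasSlacks.vertex_mem (hσ : σ.HasSlacks δ τ) (hR : 0 < σ.bound δ τ)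
    (i : Fin (n + 1)) : σ.vertex δ τ i ∈ σ.solutions := by
  have hR' : (0 : ℝ) < σ.bound δ τ := by exact_mod_cast hR
  have hτ : ∀ i, (0 : ℝ) < τ i := fun i => by exact_mod_cast hσ.one_le i
  rw [hσ.mem_solutions]
  refine Fin.cases ?_ (fun i => ?_) i
  · rw [hσ.slacks_vertex_zero]
    simpa using hR'.le
  · rw [hσ.slacks_vertex_succ]
    constructor
    · intro j
      rcases eq_or_ne j i with rfl | hj
      · rw [Pi.single_eq_same]; exact (div_pos hR' (hτ _)).le
      · rw [Pi.single_eq_of_ne hj]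
    · rw [Finset.sum_eq_single i]
      · rw [Pi.single_eq_same, mul_div_cancel₀ _ (hτ i).ne']
      · intro j _ hj
        rw [Pi.single_eq_of_ne hj, mul_zero]
      · simp

lemma IneqSystem.HasSlacks.solutions_eq (hσ : σ.HasSlacks δ τ) (hR : 0 < σ.bound δ τ) :
    σ.solutions = convexHull ℝ (Set.range (σ.vertex δ τ)) := by
  have hR' : (0 : ℝ) < σ.bound δ τ := by exact_mod_cast hR
  have hτ : ∀ i, (0 : ℝ) < τ i := fun i => by exact_mod_cast hσ.one_le i
  apply Set.Subset.antisymm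
  · intro x hx
    rw [hσ.mem_solutions] at hx
    -- The barycentric coordinates: the slack `y_i` is the fraction `τ_i y_i / R` of the slack `R /
    -- τ_i` at vertex `i + 1`.
    let w : Fin (n + 1) → ℝ := Fin.cons (1 - ∑ i, τ i * σ.slacks x i / σ.bound δ τ)
      fun i => τ i * σ.slacks x i / σ.bound δ τ
    have hw1 : ∑ i, w i = 1 := by rw [Fin.sum_univ_succ]; simp [w]
    have hw0 : ∀ i, 0 ≤ w i := by
      intro i
      refine Fin.cases ?_ (fun i => ?_) i
      · simp only [w, Fin.cons_zero, sub_nonneg]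
        rw [← Finset.sum_div, div_le_one hR']
        exact hx.2
      · simp only [w, Fin.cons_succ]
        exact div_nonneg (mul_nonneg (hτ i).le (hx.1 i)) hR'.le
    have hxe : x = ∑ i, w i • σ.vertex δ τ i := by
      apply hσ.slacks_injective
      rw [slacks_sum _ _ _ hw1, Fin.sum_univ_succ, hσ.slacks_vertex_zero, smul_zero, zero_add]
      funext j
      simp only [hσ.slacks_vertex_succ, Finset.sum_apply, Pi.smul_apply, smul_eq_mul]
      rw [Finset.sum_eq_single j]
      · rw [Pi.single_eq_same]
        simp only [w, Fin.cons_succ]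
        have := (hτ j).ne'
        field_simp
      · intro i _ hi
        rw [Pi.single_eq_of_ne hi.symm, mul_zero]
      · simp
    rw [hxe]
    exact (convex_convexHull ℝ _).sum_mem (fun i _ => hw0 i) hw1 fun i _ =>
      subset_convexHull _ _ ⟨i, rfl⟩
  · refine convexHull_min ?_ σ.convex_solutions
    rintro _ ⟨i, rfl⟩
    exact hσ.vertex_mem hR i

lemma IneqSystem.HasSlacks.isSimplex (hσ : σ.HasSlacks δ τ) (hR : 0 < σ.bound δ τ) :
    IsSimplex σ.solutions :=
  ⟨⟨_, hσ.affineIndependent hR⟩, hσ.solutions_eq hR⟩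

lemma IneqSystem.slacks_combo (x y : Fin n → ℝ) {a b : ℝ} (hab : a + b = 1) :
    σ.slacks (a • x + b • y) = a • σ.slacks x + b • σ.slacks y := by
  simp only [slacks_eq, mulVec_add, mulVec_smul, smul_sub]
  have : (fun i => (σ.h i : ℝ)) = a • (fun i => (σ.h i : ℝ)) + b • (fun i => (σ.h i : ℝ)) := by
    rw [← add_smul, hab, one_smul]
  nth_rewrite 1 [this]
  abel

/-- If a vertex lies inside a segment of the simplex, the slacks that vanish at the vertex vanish at
the end points too, being nonnegative. The remaining slack, if any, attains its maximum `R / τ_i` at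
the vertex, hence also at the end points. -/
lemma IneqSystem.HasSlacks.extremePoints_eq (hσ : σ.HasSlacks δ τ) (hR : 0 < σ.bound δ τ) :
    σ.solutions.extremePoints ℝ = Set.range (σ.vertex δ τ) := by
  have hR' : (0 : ℝ) < σ.bound δ τ := by exact_mod_cast hR
  have hτ : ∀ i, (0 : ℝ) < τ i := fun i => by exact_mod_cast hσ.one_le i
  apply Set.Subset.antisymm
  · rw [hσ.solutions_eq hR]; exact extremePoints_convexHull_subset
  rintro _ ⟨i, rfl⟩
  rw [mem_extremePoints_iff_left]
  refine ⟨hσ.vertex_mem hR i, ?_⟩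
  rintro x hx y hy ⟨a, b, ha, hb, hab, h⟩
  rw [hσ.mem_solutions] at hx hy
  apply hσ.slacks_injective
  have h' := congrArg σ.slacks h
  rw [slacks_combo x y hab] at h'
  have hzero : ∀ j, σ.slacks (σ.vertex δ τ i) j = 0 → σ.slacks x j = 0 := by
    intro j hj
    have := congrFun h' j
    rw [hj] at this
    simp only [Pi.add_apply, Pi.smul_apply, smul_eq_mul] at this
    have h1 := mul_nonneg ha.le (hx.1 j)
    have h2 := mul_nonneg hb.le (hy.1 j)
    have h3 : a * σ.slacks x j = 0 := by linarith
    exact (mul_eq_zero.1 h3).resolve_left ha.ne'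
  have hle : ∀ z, ((∀ i, 0 ≤ σ.slacks z i) ∧ ∑ i, τ i * σ.slacks z i ≤ σ.bound δ τ) →
      ∀ j, σ.slacks z j ≤ (σ.bound δ τ : ℝ) / τ j := by
    rintro z ⟨h1, h2⟩ j
    rw [le_div_iff₀ (hτ j), mul_comm]
    refine le_trans ?_ h2
    exact Finset.single_le_sum (f := fun j => (τ j : ℝ) * σ.slacks z j)
      (fun j _ => mul_nonneg (hτ j).le (h1 j)) (Finset.mem_univ j)
  revert h' hzero
  refine Fin.cases ?_ (fun i => ?_) i
  · rw [hσ.slacks_vertex_zero]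
    intro _ hzero
    exact funext fun j => hzero j rfl
  · rw [hσ.slacks_vertex_succ]
    intro h' hzero
    funext j
    rcases eq_or_ne j i with rfl | hj
    · have h1 := congrFun h' j
      rw [Pi.single_eq_same] at h1 ⊢
      simp only [Pi.add_apply, Pi.smul_apply, smul_eq_mul] at h1
      have h2 := hle x hx j
      have h3 := hle y hy j
      by_contra hne
      have h4 : σ.slacks x j < (σ.bound δ τ : ℝ) / τ j := lt_of_le_of_ne h2 hne
      have h5 : a * σ.slacks x j < a * ((σ.bound δ τ : ℝ) / τ j) := mul_lt_mul_of_pos_left h4 ha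
      have h6 : b * σ.slacks y j ≤ b * ((σ.bound δ τ : ℝ) / τ j) := mul_le_mul_of_nonneg_left h3 hb.le
      have h7 : a * ((σ.bound δ τ : ℝ) / τ j) + b * ((σ.bound δ τ : ℝ) / τ j) =
        (σ.bound δ τ : ℝ) / τ j := by rw [← add_mul, hab, one_mul]
      linarith
    · rw [Pi.single_eq_of_ne hj]
      exact hzero j (by rw [Pi.single_eq_of_ne hj])

lemma IneqSystem.slacks_intCast (z : Fin n → ℤ) :
    σ.slacks (fun i => (z i : ℝ)) = fun i => (((σ.h - σ.H *ᵥ z) i : ℤ) : ℝ) := by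
  funext i
  simp [slacks, mulVec, dotProduct]

/-- Integer points have as slack vectors exactly the integer `y` with `h - y` in the lattice of the
columns, so emptiness becomes a statement about one residue class. -/
lemma IneqSystem.HasSlacks.isEmptySimplex_iff (hσ : σ.HasSlacks δ τ) (hR : 0 < σ.bound δ τ) :
    IsEmptySimplex σ.solutions ↔ ∀ y : Fin n → ℤ, (∀ i, 0 ≤ y i) →
      (∃ u, σ.H *ᵥ u = σ.h - y) → σ.bound δ τ < ∑ i, τ i * y i := by
  rw [IsEmptySimplex, Set.eq_empty_iff_forall_notMem]
  simp only [hσ.isSimplex hR, true_and]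
  constructor
  · rintro h y hy ⟨u, hu⟩
    by_contra! hle
    have hyu : σ.h - σ.H *ᵥ u = y := by rw [hu, sub_sub_cancel]
    refine h _ ⟨(hσ.mem_solutions _).2 ?_, u, rfl⟩
    rw [slacks_intCast, hyu]
    beta_reduce
    exact ⟨fun i => by exact_mod_cast hy i, by exact_mod_cast hle⟩
  · rintro h _ ⟨hx, z, rfl⟩
    rw [hσ.mem_solutions, slacks_intCast] at hx
    beta_reduce at hx
    have := h (σ.h - σ.H *ᵥ z) (fun i => by exact_mod_cast hx.1 i) ⟨z, by rw [sub_sub_cancel]⟩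
    have h2 : ∑ i, τ i * (σ.h - σ.H *ᵥ z) i ≤ σ.bound δ τ := by exact_mod_cast hx.2
    omega

lemma IneqSystem.HasSlacks.mem_integerPoints_iff (hσ : σ.HasSlacks δ τ) (x : Fin n → ℝ) :
    x ∈ integerPoints n ↔ ∃ u, σ.slacks x = fun i => (((σ.h - σ.H *ᵥ u) i : ℤ) : ℝ) := by
  constructor
  · rintro ⟨z, rfl⟩
    exact ⟨z, slacks_intCast z⟩
  · rintro ⟨u, hu⟩
    exact ⟨u, hσ.slacks_injective (by rw [hu, slacks_intCast])⟩

/-- For `h = 0` the slack vectors of the integer points form the lattice itself. The vertex with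
zero slacks is integral, and the others are integral iff `(R / τ_i) e_i` is a lattice vector. -/
lemma IneqSystem.HasSlacks.isEmptyLatticeSimplex_iff (hσ : σ.HasSlacks δ τ)
    (hR : 0 < σ.bound δ τ) (hh : σ.h = 0) :
    IsEmptyLatticeSimplex σ.solutions ↔
      (∀ i, τ i ∣ σ.bound δ τ ∧ ∃ u, σ.H *ᵥ u = Pi.single i (σ.bound δ τ / τ i)) ∧
      ∀ y : Fin n → ℤ, (∀ i, 0 ≤ y i) → (∃ u, σ.H *ᵥ u = y) → ∑ i, τ i * y i ≤ σ.bound δ τ →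
        y = 0 ∨ ∃ i, y = Pi.single i (σ.bound δ τ / τ i) := by
  have hτ : ∀ i, (0 : ℝ) < τ i := fun i => by exact_mod_cast hσ.one_le i
  have hτ' : ∀ i, τ i ≠ 0 := fun i => by have := hσ.one_le i; omega
  have hcast : ∀ i, τ i ∣ σ.bound δ τ → (Pi.single i ((σ.bound δ τ : ℝ) / τ i) : Fin n → ℝ) =
      fun j => (((Pi.single i (σ.bound δ τ / τ i) : Fin n → ℤ) j : ℤ) : ℝ) := by
    intro i hi
    funext j
    rcases eq_or_ne j i with rfl | hj
    · rw [Pi.single_eq_same, Pi.single_eq_same, Int.cast_div hi (by exact_mod_cast hτ' j)]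
    · rw [Pi.single_eq_of_ne hj, Pi.single_eq_of_ne hj, Int.cast_zero]
  rw [IsEmptyLatticeSimplex, IsLatticeSimplex, hσ.extremePoints_eq hR]
  simp only [hσ.isSimplex hR, true_and]
  constructor
  · rintro ⟨h1, h2⟩
    have hdvd : ∀ i, τ i ∣ σ.bound δ τ ∧ ∃ u, σ.H *ᵥ u = Pi.single i (σ.bound δ τ / τ i) := by
      intro i
      obtain ⟨u, hu⟩ := (hσ.mem_integerPoints_iff _).1 (h1 ⟨i.succ, rfl⟩)
      rw [hσ.slacks_vertex_succ, hh, zero_sub] at hu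
      have h3 := congrFun hu i
      rw [Pi.single_eq_same, div_eq_iff (hτ i).ne'] at h3
      have hd : τ i ∣ σ.bound δ τ := ⟨(-(σ.H *ᵥ u)) i, by rw [mul_comm]; exact_mod_cast h3⟩
      refine ⟨hd, -u, ?_⟩
      rw [hcast i hd] at hu
      rw [mulVec_neg]
      funext j
      exact_mod_cast (congrFun hu j).symm
    refine ⟨hdvd, ?_⟩
    rintro y hy ⟨u, rfl⟩ hle
    have hslack : σ.slacks (fun i => ((-u) i : ℝ)) = fun i => (((σ.H *ᵥ u) i : ℤ) : ℝ) := by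
      have := slacks_intCast (σ := σ) (-u)
      rw [hh, mulVec_neg, zero_sub, neg_neg] at this
      simpa using this
    have hmem : (fun i => ((-u) i : ℝ)) ∈ σ.solutions := by
      rw [hσ.mem_solutions, hslack]
      beta_reduce
      exact ⟨fun i => by exact_mod_cast hy i, by exact_mod_cast hle⟩
    have hint : (fun i => ((-u) i : ℝ)) ∈ integerPoints n := ⟨-u, by funext i; simp⟩
    have hv : (fun i => ((-u) i : ℝ)) ∈ Set.range (σ.vertex δ τ) := h2 ▸ ⟨hmem, hint⟩
    obtain ⟨i, hi⟩ := hv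
    have h4 := congrArg σ.slacks hi
    rw [hslack] at h4
    revert h4
    refine Fin.cases ?_ (fun i => ?_) i
    · rw [hσ.slacks_vertex_zero]
      intro h4
      exact .inl (funext fun j => by
        have := (congrFun h4 j).symm
        rw [Pi.zero_apply] at this ⊢
        exact_mod_cast this)
    · rw [hσ.slacks_vertex_succ, hcast i (hdvd i).1]
      intro h4
      exact .inr ⟨i, funext fun j => by exact_mod_cast (congrFun h4 j).symm⟩
  · rintro ⟨h1, h2⟩
    have hsub : Set.range (σ.vertex δ τ) ⊆ integerPoints n := by
      rintro _ ⟨i, rfl⟩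
      rw [hσ.mem_integerPoints_iff]
      refine Fin.cases ?_ (fun i => ?_) i
      · refine ⟨0, ?_⟩
        rw [hσ.slacks_vertex_zero, hh, mulVec_zero]
        funext j; simp
      · obtain ⟨hd, u, hu⟩ := h1 i
        refine ⟨-u, ?_⟩
        rw [hσ.slacks_vertex_succ, hcast i hd, hh, mulVec_neg, hu]
        funext j; simp
    refine ⟨hsub, Set.Subset.antisymm ?_ ?_⟩
    · rintro x ⟨hx, hz⟩
      obtain ⟨u, hu⟩ := (hσ.mem_integerPoints_iff _).1 hz
      rw [hσ.mem_solutions, hu] at hx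
      rw [hh, zero_sub] at hx hu
      beta_reduce at hx
      rcases h2 (-(σ.H *ᵥ u)) (fun i => by exact_mod_cast hx.1 i) ⟨-u, by rw [mulVec_neg]⟩
        (by exact_mod_cast hx.2) with h0 | ⟨i, hi⟩
      · refine ⟨0, hσ.slacks_injective ?_⟩
        rw [hσ.slacks_vertex_zero, hu, h0]
        funext j; simp
      · refine ⟨i.succ, hσ.slacks_injective ?_⟩
        rw [hσ.slacks_vertex_succ, hcast i (h1 i).1, hu, hi]
    · rintro _ ⟨i, rfl⟩
      exact ⟨hσ.vertex_mem hR i, hsub ⟨i, rfl⟩⟩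

end geometry
end EmptySimplices

namespace EmptySimplices
open Matrix

/-! ### Reduction modulo a triangular matrix -/

/-- Forward substitution: a multiple of column `p` fixes entry `p` by division with remainder and
does not affect the entries above. The parameter `a` leaves the first `a` columns unused: `0`
reduces a right-hand side, `j + 1` reduces column `j` below its diagonal entry. -/
lemma exists_reduce {n : ℕ} {H : Matrix (Fin n) (Fin n) ℤ} (lower : ∀ i j, i < j → H i j = 0)
    (pos : ∀ i, 0 < H i i) (y : Fin n → ℤ) (a : ℕ) :
    ∃ u : Fin n → ℤ, (∀ j, j.val < a → u j = 0) ∧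
      ∀ i, a ≤ i.val → 0 ≤ (y - H *ᵥ u) i ∧ (y - H *ᵥ u) i < H i i := by
  suffices h : ∀ m ≤ n, ∃ u : Fin n → ℤ, (∀ j, j.val < a → u j = 0) ∧
      ∀ i, a ≤ i.val → i.val < m → 0 ≤ (y - H *ᵥ u) i ∧ (y - H *ᵥ u) i < H i i by
    obtain ⟨u, h1, h2⟩ := h n le_rfl
    exact ⟨u, h1, fun i hi => h2 i hi i.2⟩
  intro m
  induction m with
  | zero => exact fun _ => ⟨0, by simp, by simp⟩
  | succ m ih =>
    intro hm
    obtain ⟨u, h1, h2⟩ := ih (by omega)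
    by_cases ham : a ≤ m
    · set p : Fin n := ⟨m, hm⟩
      set q := (y - H *ᵥ u) p / H p p
      refine ⟨u + Pi.single p q, fun j hj => ?_, fun i hi him => ?_⟩
      · rw [Pi.add_apply, h1 j hj, Pi.single_eq_of_ne, zero_add]
        rintro rfl
        simp only [p] at hj
        omega
      · have e : (y - H *ᵥ (u + Pi.single p q)) i = (y - H *ᵥ u) i - q * H i p := by
          rw [mulVec_add, mulVec_single]
          simp only [Pi.sub_apply, Pi.add_apply, col_apply, Pi.smul_apply, MulOpposite.smul_eq_mul_unop,
            MulOpposite.unop_op]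
          ring
        rw [e]
        rcases Nat.lt_succ_iff_lt_or_eq.1 him with him | him
        · rw [lower i p him, mul_zero, sub_zero]
          exact h2 i hi him
        · obtain rfl : i = p := Fin.ext him
          have e1 := Int.emod_add_mul_ediv ((y - H *ᵥ u) p) (H p p)
          have e2 := Int.emod_nonneg ((y - H *ᵥ u) p) (pos p).ne'
          have e3 := Int.emod_lt_of_pos ((y - H *ᵥ u) p) (pos p)
          have e4 : (y - H *ᵥ u) p - q * H p p = (y - H *ᵥ u) p % H p p := by
            rw [mul_comm]; linarith
          rw [e4]
          exact ⟨e2, e3⟩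
    · exact ⟨u, h1, fun i hi him => absurd hi (by omega)⟩

/-! ### The lattice tests -/

/-- The lattice generated by the columns of `H`. -/
def InLattice {n : ℕ} (H : Matrix (Fin n) (Fin n) ℤ) (y : Fin n → ℤ) : Prop := ∃ u, H *ᵥ u = y

lemma InLattice.add {n : ℕ} {H : Matrix (Fin n) (Fin n) ℤ} {y z : Fin n → ℤ} (hy : InLattice H y)
    (hz : InLattice H z) : InLattice H (y + z) := by
  obtain ⟨u, rfl⟩ := hy
  obtain ⟨v, rfl⟩ := hz
  exact ⟨u + v, mulVec_add _ _ _⟩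

lemma InLattice.neg {n : ℕ} {H : Matrix (Fin n) (Fin n) ℤ} {y : Fin n → ℤ} (hy : InLattice H y) :
    InLattice H (-y) := by
  obtain ⟨u, rfl⟩ := hy
  exact ⟨-u, mulVec_neg _ _⟩

/-- The vector with the given entries. -/
def toVec (n : ℕ) (y : List ℤ) : Fin n → ℤ := fun i => gz y i

lemma toVec_vsub (n : ℕ) (a b : List ℤ) : toVec n (vsub n a b) = toVec n a - toVec n b :=
  funext fun i => gz_vsub a b i.2

lemma toVec_unitVec (n : ℕ) (i : Fin n) (c : ℤ) : toVec n (unitVec n i c) = Pi.single i c := by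
  funext j
  rw [toVec, gz_unitVec c j.2]
  rcases eq_or_ne j i with rfl | h
  · simp
  · rw [Pi.single_eq_of_ne h, if_neg (fun hh => h (Fin.ext hh))]

lemma toVec_ofFn {n : ℕ} (y : Fin n → ℤ) : toVec n (List.ofFn y) = y := by
  funext i
  rw [toVec, gz_eq_getElem (by simp)]
  simp

section tests
variable {s k n δ : ℕ} {A taus box : List (List ℤ)} {τ : List ℤ}

/-- A vector `y` lies in `A ℤⁿ` iff `adj(A) y ≡ 0` modulo `δ`. The rows of the adjugate, reduced
modulo `δ` into `[1, δ]`, are among the dual vectors. Conversely every dual vector pairs with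
lattice vectors to multiples of `δ`. -/
lemma inLat_iff (hδ : 1 ≤ δ) (hdet : (toMat n A).det = δ) (htaus : ∀ τ, τ ∈ taus ↔ IsTau n δ A τ)
    (y : List ℤ) : inLat n δ taus y = true ↔ InLattice (toMat n A) (toVec n y) := by
  have hδ' : (0 : ℤ) < δ := by exact_mod_cast hδ
  rw [inLat, List.all_eq_true]
  simp only [zeq_iff]
  constructor
  · intro h
    -- The shift by `1` chooses residues in `[1, δ]` instead of `[0, δ - 1]`, as `IsTau` requires.
    have hdvd : ∀ i, (δ : ℤ) ∣ ((toMat n A).adjugate *ᵥ toVec n y) i := by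
      intro i
      set f : Fin n → ℤ := fun j => ((toMat n A).adjugate i j - 1) % δ + 1
      have hf : ∀ j, (δ : ℤ) ∣ (toMat n A).adjugate i j - f j := fun j => by
        have := Int.emod_add_mul_ediv ((toMat n A).adjugate i j - 1) δ
        exact ⟨((toMat n A).adjugate i j - 1) / δ, by simp only [f]; linarith⟩
      have hgz : ∀ j : Fin n, gz (List.ofFn f) j = f j := fun j => congrFun (toVec_ofFn f) j
      have hmem : List.ofFn f ∈ taus := by
        rw [htaus]
        refine ⟨by simp, fun j hj => ?_, fun j hj => ?_⟩
        · have := hgz ⟨j, hj⟩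
          simp only at this
          rw [this]
          have h1 := Int.emod_nonneg ((toMat n A).adjugate i ⟨j, hj⟩ - 1) hδ'.ne'
          have h2 := Int.emod_lt_of_pos ((toMat n A).adjugate i ⟨j, hj⟩ - 1) hδ'
          simp only [f]
          omega
        · rw [colDot_eq]
          have e1 : ∑ l : Fin n, ent A l j * gz (List.ofFn f) l =
              ((toMat n A).adjugate * toMat n A) i ⟨j, hj⟩ -
                ∑ l : Fin n, ent A l j * ((toMat n A).adjugate i l - f l) := by
            rw [Matrix.mul_apply, ← Finset.sum_sub_distrib]
            refine Finset.sum_congr rfl fun l _ => ?_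
            rw [hgz, toMat, of_apply]
            ring
          rw [e1, adjugate_mul, hdet]
          refine dvd_sub ?_ (Finset.dvd_sum fun l _ => Dvd.dvd.mul_left (hf l) _)
          rw [Matrix.smul_apply, smul_eq_mul]
          exact dvd_mul_right _ _
      have h1 := Int.dvd_of_emod_eq_zero (h _ hmem)
      rw [dotZ_eq] at h1
      have e2 : ((toMat n A).adjugate *ᵥ toVec n y) i =
          ∑ l : Fin n, gz (List.ofFn f) l * gz y l +
            ∑ l : Fin n, ((toMat n A).adjugate i l - f l) * gz y l := by
        rw [← Finset.sum_add_distrib]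
        change ∑ l : Fin n, (toMat n A).adjugate i l * toVec n y l = _
        refine Finset.sum_congr rfl fun l _ => ?_
        rw [hgz, toVec]
        ring
      rw [e2]
      exact dvd_add h1 (Finset.dvd_sum fun l _ => Dvd.dvd.mul_right (hf l) _)
    choose u hu using hdvd
    refine ⟨u, ?_⟩
    have e3 : (toMat n A).adjugate *ᵥ toVec n y = (δ : ℤ) • u := funext hu
    have e4 := congrArg (toMat n A *ᵥ ·) e3
    simp only [mulVec_mulVec, mul_adjugate, hdet, smul_mulVec, one_mulVec, mulVec_smul] at e4
    exact (smul_right_injective _ hδ'.ne' e4).symm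
  · rintro ⟨u, hu⟩ τ hτ
    obtain ⟨_, _, h3⟩ := (htaus τ).1 hτ
    apply Int.emod_eq_zero_of_dvd
    have e : dotZ n τ y = ∑ j : Fin n, colDot n A j τ * u j := by
      rw [dotZ_eq]
      have : ∀ i : Fin n, gz y i = ∑ j : Fin n, ent A i j * u j := fun i => (congrFun hu i).symm
      simp only [this, colDot_eq, Finset.mul_sum, Finset.sum_mul]
      rw [Finset.sum_comm]
      exact Finset.sum_congr rfl fun j _ => Finset.sum_congr rfl fun i _ => by ring
    rw [e]
    exact Finset.dvd_sum fun j _ => Dvd.dvd.mul_right (h3 j j.2) _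

/-- The reduced vectors represent all classes modulo the lattice. -/
lemma exists_mem_box (hA : IsHNF s k A) (hbox : ∀ w, w ∈ box ↔ IsReduced (s + k) A w)
    (y : Fin (s + k) → ℤ) : ∃ g ∈ box, InLattice (toMat (s + k) A) (y - toVec (s + k) g) := by
  obtain ⟨u, -, hu⟩ := exists_reduce (H := toMat (s + k) A)
    (fun i j hij => hA.upper i j hij j.2) (fun i => hA.diag_pos i.2) y 0
  refine ⟨List.ofFn (y - toMat (s + k) A *ᵥ u), (hbox _).2 ⟨by simp, fun i hi => ?_⟩, u, ?_⟩
  · have e := congrFun (toVec_ofFn (y - toMat (s + k) A *ᵥ u)) ⟨i, hi⟩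
    simp only [toVec] at e
    rw [e]
    exact hu ⟨i, hi⟩ (Nat.zero_le _)
  · rw [toVec_ofFn, sub_sub_cancel]

lemma layers_zero : layers n δ taus box τ 0 = [box.filter (inLat n δ taus)] := rfl

lemma layers_succ (R : ℕ) : layers n δ taus box τ (R + 1) =
    (box.filter fun g => (List.range n).any fun i =>
    ((layers n δ taus box τ R).getD (gz τ i - 1).toNat []).any fun g' =>
      inLat n δ taus (vsub n (vsub n g (unitVec n i 1)) g')) :: layers n δ taus box τ R := by
  simp [layers, List.range_succ]

lemma length_layers (R : ℕ) : (layers n δ taus box τ R).length = R + 1 := by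
  induction R with
  | zero => rfl
  | succ R ih => rw [layers_succ, List.length_cons, ih]

/-- Being congruent to some `y ≥ 0` with `τ y = w`. -/
def IsReached {n : ℕ} (H : Matrix (Fin n) (Fin n) ℤ) (τ : Fin n → ℤ) (w : ℤ) (g : Fin n → ℤ) :
    Prop :=
  ∃ y : Fin n → ℤ, (∀ i, 0 ≤ y i) ∧ ∑ i, τ i * y i = w ∧ InLattice H (g - y)

/-- A nonnegative `y` of value `w > 0` has some `y_i > 0`, and `y - e_i` is nonnegative of value `w
- τ_i`. The list runs from the newest layer downwards, so while layer `R + 1` is computed, layer `R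
+ 1 - τ_i` has index `τ_i - 1`. For `τ_i > R + 1` the default value `[]` stands for the missing
layer. -/
lemma mem_layers (hA : IsHNF s k A) (hbox : ∀ w, w ∈ box ↔ IsReduced (s + k) A w) (hδ : 1 ≤ δ)
    (hdet : (toMat (s + k) A).det = δ) (htaus : ∀ τ, τ ∈ taus ↔ IsTau (s + k) δ A τ)
    (hτ : τ ∈ taus) (R j : ℕ) (hj : j ≤ R) (g : List ℤ) :
    g ∈ (layers (s + k) δ taus box τ R).getD j [] ↔ g ∈ box ∧
      IsReached (toMat (s + k) A) (toVec (s + k) τ) (R - j : ℕ) (toVec (s + k) g) := by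
  obtain ⟨_, hτ1, _⟩ := (htaus τ).1 hτ
  induction R generalizing j g with
  | zero =>
    obtain rfl : j = 0 := by omega
    rw [layers_zero, List.getD_cons_zero, List.mem_filter, inLat_iff hδ hdet htaus]
    refine and_congr_right fun _ => ?_
    constructor
    · intro h
      exact ⟨0, by simp, by simp, by simpa using h⟩
    · rintro ⟨y, hy, hw, hl⟩
      have h0 : y = 0 := by
        have h1 : ∀ i ∈ Finset.univ, 0 ≤ toVec (s + k) τ i * y i := fun i _ =>
          mul_nonneg (zero_le_one.trans (hτ1 i i.2).1) (hy i)
        have h2 := (Finset.sum_eq_zero_iff_of_nonneg h1).1 (by simpa using hw)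
        funext i
        exact (mul_eq_zero.1 (h2 i (Finset.mem_univ i))).resolve_left (by
          have := (hτ1 i i.2).1
          simp only [toVec]
          omega)
      rwa [h0, sub_zero] at hl
  | succ R ih =>
    rw [layers_succ]
    rcases j with _ | j
    · rw [List.getD_cons_zero, List.mem_filter]
      refine and_congr_right fun _ => ?_
      simp only [List.any_eq_true, List.mem_range, inLat_iff hδ hdet htaus, toVec_vsub]
      constructor
      · rintro ⟨i, hi, g', hg', hl⟩
        have h1 := (hτ1 i hi).1
        by_cases hle : (gz τ i - 1).toNat ≤ R
        · obtain ⟨hgb, y, hy, hw, hl'⟩ := (ih _ hle g').1 hg'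
          refine ⟨y + Pi.single ⟨i, hi⟩ 1, fun l => add_nonneg (hy l) ?_, ?_, ?_⟩
          · rcases eq_or_ne l ⟨i, hi⟩ with rfl | hl
            · simp
            · rw [Pi.single_eq_of_ne hl]
          · simp only [Pi.add_apply, mul_add, Finset.sum_add_distrib, hw]
            rw [Finset.sum_eq_single ⟨i, hi⟩ (fun l _ hl => by rw [Pi.single_eq_of_ne hl, mul_zero])
              (by simp), Pi.single_eq_same, mul_one, toVec]
            simp only
            omega
          · have := hl.add hl'
            have e := toVec_unitVec (s + k) ⟨i, hi⟩ 1
            simp only at e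
            rw [e] at this
            convert this using 1
            abel
        · rw [List.getD_eq_getElem?_getD, List.getElem?_eq_none (by rw [length_layers]; omega)] at hg'
          simp at hg'
      · rintro ⟨y, hy, hw, hl⟩
        have hex : ∃ i, 0 < y i := by
          by_contra! hc
          have h0 : y = 0 := funext fun i => le_antisymm (hc i) (hy i)
          rw [h0] at hw
          simp at hw
          omega
        obtain ⟨i, hi⟩ := hex
        have h1 := (hτ1 i i.2).1
        have hy' : ∀ l, 0 ≤ (y - Pi.single i 1 : Fin (s + k) → ℤ) l := fun l => by
          rcases eq_or_ne l i with rfl | hl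
          · rw [Pi.sub_apply, Pi.single_eq_same]; omega
          · rw [Pi.sub_apply, Pi.single_eq_of_ne hl, sub_zero]; exact hy l
        have hw' : ∑ l, toVec (s + k) τ l * (y - Pi.single i 1 : Fin (s + k) → ℤ) l = (R : ℤ) + 1 - gz τ i := by
          simp only [Pi.sub_apply, mul_sub, Finset.sum_sub_distrib, hw]
          rw [Finset.sum_eq_single i (fun l _ hl => by rw [Pi.single_eq_of_ne hl, mul_zero])
              (by simp), Pi.single_eq_same, mul_one, toVec]
          push_cast
          ring
        have hnn : 0 ≤ ∑ l, toVec (s + k) τ l * (y - Pi.single i 1 : Fin (s + k) → ℤ) l :=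
          Finset.sum_nonneg fun l _ => mul_nonneg (zero_le_one.trans (hτ1 l l.2).1) (hy' l)
        -- The layers record classes only, so `y - e_i` is replaced by its reduced representative.
        obtain ⟨g', hg', hl'⟩ := exists_mem_box hA hbox (y - Pi.single i 1)
        refine ⟨i, i.2, g', (ih _ (by omega) g').2 ⟨hg', _, hy', ?_, ?_⟩, ?_⟩
        · rw [hw']; omega
        · rw [← neg_sub]; exact hl'.neg
        · rw [toVec_unitVec]
          have := hl.add hl'
          convert this using 1
          abel
    · rw [List.getD_cons_succ, ih j (by omega) g]
      congr! 2
      omega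

/-- The largest layers stand first, so dropping `d` of them lowers the bound from `R` to `R - d`. -/
lemma hits_drop_layers_iff (hA : IsHNF s k A) (hbox : ∀ w, w ∈ box ↔ IsReduced (s + k) A w)
    (hδ : 1 ≤ δ) (hdet : (toMat (s + k) A).det = δ)
    (htaus : ∀ τ, τ ∈ taus ↔ IsTau (s + k) δ A τ) (hτ : τ ∈ taus) (R d : ℕ) (y : List ℤ) :
    hits (s + k) δ taus ((layers (s + k) δ taus box τ R).drop d) y = true ↔
      ∃ z : Fin (s + k) → ℤ, (∀ i, 0 ≤ z i) ∧ ∑ i, toVec (s + k) τ i * z i + d ≤ R ∧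
        InLattice (toMat (s + k) A) (toVec (s + k) y - z) := by
  obtain ⟨_, hτ1, _⟩ := (htaus τ).1 hτ
  simp only [hits, List.any_eq_true, inLat_iff hδ hdet htaus, toVec_vsub]
  constructor
  · rintro ⟨L, hL, g, hg, hl⟩
    obtain ⟨i, hi, rfl⟩ := List.getElem_of_mem hL
    rw [List.length_drop, length_layers] at hi
    rw [List.getElem_drop] at hg
    have hg' : g ∈ (layers (s + k) δ taus box τ R).getD (d + i) [] := by
      rw [List.getD_eq_getElem?_getD, List.getElem?_eq_getElem (by rw [length_layers]; omega)]
      exact hg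
    obtain ⟨_, z, hz, hw, hl'⟩ := (mem_layers hA hbox hδ hdet htaus hτ R _ (by omega) g).1 hg'
    refine ⟨z, hz, by rw [hw]; omega, ?_⟩
    have := hl.add hl'
    convert this using 1
    abel
  · rintro ⟨z, hz, hw, hl⟩
    have hnn : 0 ≤ ∑ l, toVec (s + k) τ l * z l :=
      Finset.sum_nonneg fun l _ => mul_nonneg (zero_le_one.trans (hτ1 l l.2).1) (hz l)
    obtain ⟨g, hg, hl'⟩ := exists_mem_box hA hbox z
    set w := ∑ l, toVec (s + k) τ l * z l with hwdef
    have hj : R - w.toNat ≤ R := Nat.sub_le _ _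
    have hg' := (mem_layers hA hbox hδ hdet htaus hτ R _ hj g).2 ⟨hg, z, hz, by omega, by
      rw [← neg_sub]; exact hl'.neg⟩
    have hlt : R - w.toNat < (layers (s + k) δ taus box τ R).length := by rw [length_layers]; omega
    rw [List.getD_eq_getElem?_getD, List.getElem?_eq_getElem hlt] at hg'
    refine ⟨(layers (s + k) δ taus box τ R)[R - w.toNat], ?_, g, hg', ?_⟩
    · rw [List.mem_iff_getElem]
      refine ⟨R - w.toNat - d, by rw [List.length_drop, length_layers]; omega, ?_⟩
      rw [List.getElem_drop]
      congr 1
      omega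
    · have := hl.add hl'
      convert this using 1
      abel

end tests
end EmptySimplices

namespace EmptySimplices
open Matrix

/-! ### Determinants of submatrices -/

section minors
variable {n : ℕ}

lemma natAbs_det_submatrix_of_injective (M : Matrix (Fin n) (Fin n) ℤ) {g : Fin n → Fin n}
    (hg : Function.Injective g) : (M.submatrix g id).det.natAbs = M.det.natAbs := by
  have h := det_permute (Equiv.ofBijective g (Finite.injective_iff_bijective.1 hg)) M
  rw [Equiv.coe_ofBijective] at h
  rw [h, Int.natAbs_mul]
  rcases Int.units_eq_one_or (Equiv.Perm.sign (Equiv.ofBijective g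
    (Finite.injective_iff_bijective.1 hg))) with h | h <;> simp [h]

lemma det_submatrix_eq_zero {m : ℕ} (M : Matrix (Fin m) (Fin n) ℤ) {g : Fin n → Fin m}
    (hg : ¬ Function.Injective g) : (M.submatrix g id).det = 0 := by
  simp only [Function.Injective, not_forall] at hg
  obtain ⟨a, b, h, hne⟩ := hg
  exact det_zero_of_row_eq hne (by funext j; simp [h])

lemma natAbs_det_submatrix_le (M : Matrix (Fin n) (Fin n) ℤ) (g : Fin n → Fin n) :
    (M.submatrix g id).det.natAbs ≤ M.det.natAbs := by
  by_cases hg : Function.Injective g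
  · exact (natAbs_det_submatrix_of_injective M hg).le
  · simp [det_submatrix_eq_zero M hg]

lemma natAbs_det_submatrix_right_le (M : Matrix (Fin n) (Fin n) ℤ) (g : Fin n → Fin n) :
    (M.submatrix id g).det.natAbs ≤ M.det.natAbs := by
  rw [← det_transpose, transpose_submatrix, ← det_transpose M]
  exact natAbs_det_submatrix_le _ g

/-- `maxMinor` only takes increasing choices of rows. An injective `f` becomes increasing after
sorting, which changes the determinant at most by its sign; otherwise two rows coincide. -/
lemma natAbs_det_le_maxMinor {m : ℕ} (A : Matrix (Fin m) (Fin n) ℤ) (f : Fin n → Fin m) :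
    (A.submatrix f id).det.natAbs ≤ maxMinor n A := by
  by_cases hf : Function.Injective f
  · have hmono : StrictMono (f ∘ Tuple.sort f) :=
      (Tuple.monotone_sort f).strictMono_of_injective (hf.comp (Tuple.sort f).injective)
    have h := natAbs_det_submatrix_of_injective (A.submatrix f id) (Tuple.sort f).injective
    rw [submatrix_submatrix, Function.comp_id] at h
    rw [← h]
    exact Finset.le_sup (f := fun IJ : (Fin n ↪o Fin m) × (Fin n ↪o Fin n) =>
      (A.submatrix IJ.1 IJ.2).det.natAbs)
      (Finset.mem_univ (OrderEmbedding.ofStrictMono _ hmono, RelEmbedding.refl _))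
  · simp [det_submatrix_eq_zero A hf]

lemma rank_eq_of_det_submatrix_ne_zero {m : ℕ} {A : Matrix (Fin m) (Fin n) ℤ} {f : Fin n → Fin m}
    (h : (A.submatrix f id).det ≠ 0) : (A.map (Int.cast : ℤ → ℚ)).rank = n := by
  refine le_antisymm (rank_le_width _) ?_
  have h1 : IsUnit ((A.submatrix f id).map (Int.cast : ℤ → ℚ)) := by
    rw [isUnit_iff_isUnit_det, isUnit_iff_ne_zero]
    have : ((A.submatrix f id).map (Int.cast : ℤ → ℚ)).det = ((A.submatrix f id).det : ℚ) :=
      ((Int.castRingHom ℚ).map_det _).symm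
    rw [this]
    exact_mod_cast h
  have h2 := rank_of_isUnit _ h1
  rw [Fintype.card_fin] at h2
  nth_rewrite 1 [← h2]
  exact rank_submatrix_le (A.map (Int.cast : ℤ → ℚ)) f id

/-- The determinants obtained by replacing one row by `-tᵀ H` with `t ∈ (0, 1]ⁿ` are bounded. -/
lemma IneqSystem.HasSlacks.natAbs_det_le {σ : IneqSystem n} {δ : ℤ} {τ : Fin n → ℤ}
    (hσ : σ.HasSlacks δ τ) (f : Fin n → Fin (n + 1)) :
    (σ.mat.submatrix f id).det.natAbs ≤ σ.H.det.natAbs := by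
  by_cases hf : Function.Injective f
  swap
  · simp [det_submatrix_eq_zero σ.mat hf]
  by_cases hlast : ∃ p, f p = Fin.last n
  · obtain ⟨p, hp⟩ := hlast
    have hg : ∀ q, ∃ r : Fin n, q ≠ p → f q = r.castSucc := fun q => by
      by_cases hq : f q = Fin.last n
      · exact ⟨p, fun h => absurd (hf (hq.trans hp.symm)) h⟩
      · obtain ⟨r, hr⟩ := Fin.exists_castSucc_eq.2 hq
        exact ⟨r, fun _ => hr.symm⟩
    choose g hg using hg
    have e1 : σ.mat.submatrix f id = (σ.H.submatrix g id).updateRow p σ.c := by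
      ext q j
      rcases eq_or_ne q p with rfl | hq
      · rw [updateRow_self, submatrix_apply, hp]; rfl
      · rw [updateRow_ne hq, submatrix_apply, hg q hq]; rfl
    have e2 : δ • σ.c = ∑ i, (-τ i) • σ.H i := by
      funext j
      simp only [Pi.smul_apply, smul_eq_mul, Finset.sum_apply, hσ.c_eq j]
      rw [← Finset.sum_neg_distrib]
      exact Finset.sum_congr rfl fun i _ => by ring
    have e3 : ∀ i, ((σ.H.submatrix g id).updateRow p (σ.H i)).det =
        (σ.H.submatrix (Function.update g p i) id).det := fun i => by
      congr 1
      ext q j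
      rcases eq_or_ne q p with rfl | hq
      · simp
      · simp [hq]
    have e4 : δ * (σ.mat.submatrix f id).det =
        ∑ i, -τ i * (σ.H.submatrix (Function.update g p i) id).det := by
      rw [e1, ← det_updateRow_smul, e2]
      have h := (detRowAlternating (R := ℤ)).toMultilinearMap.map_update_sum Finset.univ p
        (fun i => (-τ i) • σ.H i) (σ.H.submatrix g id)
      refine Eq.trans h (Finset.sum_congr rfl fun i _ => ?_)
      rw [← e3]
      exact det_updateRow_smul _ _ _ _
    -- Outside `p` the map `g` takes `n - 1` distinct values, so exactly one index completes it to a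
    -- bijection. At most one term of `e4` survives, and it equals `± τ_i δ`; hence the minor is `±
    -- τ_i`.
    have huniq : ∀ i i', Function.Injective (Function.update g p i) →
        Function.Injective (Function.update g p i') → i = i' := by
      intro i i' h h'
      obtain ⟨q, hq⟩ := (Finite.injective_iff_surjective.1 h) i'
      rcases eq_or_ne q p with rfl | hqp
      · rwa [Function.update_self] at hq
      · rw [Function.update_of_ne hqp] at hq
        refine absurd (h' (a₁ := q) (a₂ := p) ?_) hqp
        rw [Function.update_of_ne hqp, Function.update_self, hq]
    have key : ∃ i, (σ.mat.submatrix f id).det.natAbs ≤ (τ i).natAbs := by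
      have hpos := hσ.pos
      by_cases h : ∃ i, Function.Injective (Function.update g p i)
      · obtain ⟨i, hi⟩ := h
        refine ⟨i, ?_⟩
        rw [Finset.sum_eq_single i (fun i' _ hne => by
          rw [det_submatrix_eq_zero _ fun h' => hne (huniq _ _ h' hi), mul_zero]) (by simp)] at e4
        have h1 := congrArg Int.natAbs e4
        rw [Int.natAbs_mul, Int.natAbs_mul, Int.natAbs_neg,
          natAbs_det_submatrix_of_injective _ hi, hσ.det, mul_comm] at h1
        exact (Nat.eq_of_mul_eq_mul_right (by omega) h1).le
      · push Not at h
        rw [Finset.sum_eq_zero fun i _ => by rw [det_submatrix_eq_zero _ (h i), mul_zero]] at e4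
        rw [(mul_eq_zero.1 e4).resolve_left hpos.ne']
        exact ⟨p, Nat.zero_le _⟩
    obtain ⟨i, hi⟩ := key
    have h1 := hσ.one_le i
    have h2 := hσ.le i
    rw [hσ.det]
    omega
  · push Not at hlast
    choose g hg using fun q => Fin.exists_castSucc_eq.2 (hlast q)
    have e : σ.mat.submatrix f id = σ.H.submatrix g id := by
      ext q j
      rw [submatrix_apply, ← hg q]; rfl
    rw [e]
    exact natAbs_det_submatrix_le _ _

lemma IneqSystem.HasSlacks.bigDelta_eq {σ : IneqSystem n} {δ : ℤ} {τ : Fin n → ℤ}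
    (hσ : σ.HasSlacks δ τ) : bigDelta σ.mat = σ.H.det.natAbs := by
  have h : (σ.mat.submatrix Fin.castSucc id).det ≠ 0 := by
    have := hσ.det
    have := hσ.pos
    change σ.H.det ≠ 0
    omega
  rw [bigDelta, rank_eq_of_det_submatrix_ne_zero h]
  refine le_antisymm (Finset.sup_le ?_) (natAbs_det_le_maxMinor σ.mat Fin.castSucc)
  rintro ⟨I, J⟩ _
  exact (natAbs_det_submatrix_right_le (σ.mat.submatrix I id) J).trans (hσ.natAbs_det_le I)

end minors

/-! ### Canonical systems -/

/-- The systems in Hermite normal form with sorted columns that are found by the algorithm. -/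
structure IneqSystem.IsCanonical {n : ℕ} (Δ : ℕ) (σ : IneqSystem n) (δ : ℤ) (τ : Fin n → ℤ) :
    Prop where
  slacks : σ.HasSlacks δ τ
  det_le : δ ≤ Δ
  lower : ∀ i j, i < j → σ.H i j = 0
  reduced : ∀ i j, j < i → 0 ≤ σ.H i j ∧ σ.H i j < σ.H i i
  block : ∃ (s k : ℕ) (hsk : s + k = n),
    (∀ i : Fin s, σ.H (Fin.cast hsk (i.castAdd k)) (Fin.cast hsk (i.castAdd k)) = 1) ∧
    (∀ i : Fin k, 2 ≤ σ.H (Fin.cast hsk (i.natAdd s)) (Fin.cast hsk (i.natAdd s))) ∧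
    Monotone fun j : Fin s => toLex fun i : Fin k =>
      σ.H (Fin.cast hsk (i.natAdd s)) (Fin.cast hsk (j.castAdd k))
  rhs_reduced : ∀ i, 0 ≤ σ.h i ∧ σ.h i < σ.H i i

/-- The coefficients and the right-hand side of each inequality have gcd `1`. -/
def IneqSystem.IsPrimitive {n : ℕ} (σ : IneqSystem n) : Prop :=
  ∀ i, Int.gcd (Finset.univ.gcd (σ.mat i)) (σ.rhs i) = 1

section canonical
variable {n Δ : ℕ} {σ : IneqSystem n} {δ : ℤ} {τ : Fin n → ℤ}

lemma IneqSystem.IsCanonical.diag_pos (h : σ.IsCanonical Δ δ τ) (i : Fin n) : 1 ≤ σ.H i i := by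
  obtain ⟨s, k, rfl, h1, h2, -⟩ := h.block
  refine Fin.addCases (fun i => ?_) (fun i => ?_) i
  · exact (h1 i).ge
  · exact one_le_two.trans (h2 i)

lemma IneqSystem.IsCanonical.prod_diag (h : σ.IsCanonical Δ δ τ) : ∏ i, σ.H i i = δ := by
  rw [← h.slacks.det]
  exact (Matrix.det_of_isLowerTriangular (M := σ.H) fun i j hij => h.lower i j hij).symm

/-- Together with `∏ H_ii = δ`, this bounds the diagonal entries, the column sums and the sum of the
reduced right-hand sides by `δ` alone, independently of `n`. -/
lemma one_add_sum_sub_one_le_prod {ι : Type*} (s : Finset ι) {a : ι → ℤ} (h : ∀ i, 1 ≤ a i) :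
    1 + ∑ i ∈ s, (a i - 1) ≤ ∏ i ∈ s, a i := by
  classical
  induction s using Finset.induction_on with
  | empty => simp
  | insert i s hi ih =>
    rw [Finset.sum_insert hi, Finset.prod_insert hi]
    have h1 : 1 ≤ ∏ i ∈ s, a i := le_trans (by
      have := Finset.sum_nonneg (s := s) fun i _ => sub_nonneg.2 (h i)
      linarith) ih
    nlinarith [h i]

lemma IneqSystem.IsCanonical.diag_le (h : σ.IsCanonical Δ δ τ) (i : Fin n) : σ.H i i ≤ δ := by
  have h1 := one_add_sum_sub_one_le_prod Finset.univ h.diag_pos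
  rw [h.prod_diag] at h1
  have h2 : σ.H i i - 1 ≤ ∑ i, (σ.H i i - 1) := Finset.single_le_sum (f := fun i => σ.H i i - 1)
    (fun i _ => sub_nonneg.2 (h.diag_pos i)) (Finset.mem_univ i)
  linarith

lemma IneqSystem.IsCanonical.nonneg (h : σ.IsCanonical Δ δ τ) (i j : Fin n) : 0 ≤ σ.H i j := by
  rcases lt_trichotomy i j with hij | rfl | hij
  · exact (h.lower i j hij).ge
  · exact zero_le_one.trans (h.diag_pos i)
  · exact (h.reduced i j hij).1

/-- Off the diagonal an entry in row `i` is at most `H_ii - 1`. -/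
lemma IneqSystem.IsCanonical.sum_col_le (h : σ.IsCanonical Δ δ τ) (j : Fin n) :
    ∑ i, σ.H i j ≤ δ := by
  refine le_trans ?_ ((one_add_sum_sub_one_le_prod Finset.univ h.diag_pos).trans h.prod_diag.le)
  rw [← Finset.add_sum_erase _ _ (Finset.mem_univ j),
    ← Finset.add_sum_erase _ (fun i => σ.H i i - 1) (Finset.mem_univ j), ← add_assoc,
    add_sub_cancel]
  refine add_le_add_right (Finset.sum_le_sum fun i hi => ?_) _
  rcases lt_or_gt_of_ne (Finset.ne_of_mem_erase hi) with hij | hij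
  · rw [h.lower i j hij]; exact sub_nonneg.2 (h.diag_pos i)
  · have := (h.reduced i j hij).2; omega

lemma IneqSystem.IsCanonical.c_neg (h : σ.IsCanonical Δ δ τ) (j : Fin n) : σ.c j < 0 := by
  have h1 : 0 < ∑ i, σ.H i j * τ i := by
    refine Finset.sum_pos' (fun i _ => mul_nonneg (h.nonneg i j) ?_) ⟨j, Finset.mem_univ j, ?_⟩
    · exact zero_le_one.trans (h.slacks.one_le i)
    · exact mul_pos (h.diag_pos j) (h.slacks.one_le j)
  have h2 := h.slacks.c_eq j
  have h3 := h.slacks.pos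
  nlinarith

/-- Since `τ_i ≤ δ`, the number `δ |c_j| = ∑ H_ij τ_i` is at most `δ` times a column sum, hence at
most `δ²`. -/
lemma IneqSystem.IsCanonical.abs_c_le (h : σ.IsCanonical Δ δ τ) (j : Fin n) : |σ.c j| ≤ Δ := by
  rw [abs_of_neg (h.c_neg j)]
  have h1 : ∑ i, σ.H i j * τ i ≤ δ * δ := by
    calc ∑ i, σ.H i j * τ i ≤ ∑ i, σ.H i j * δ :=
          Finset.sum_le_sum fun i _ => mul_le_mul_of_nonneg_left (h.slacks.le i) (h.nonneg i j)
      _ = (∑ i, σ.H i j) * δ := (Finset.sum_mul _ _ _).symm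
      _ ≤ δ * δ := mul_le_mul_of_nonneg_right (h.sum_col_le j) h.slacks.pos.le
  have h2 := h.slacks.c_eq j
  have h3 := h.slacks.pos
  have h4 := h.det_le
  nlinarith

lemma IneqSystem.IsCanonical.abs_mat_le (h : σ.IsCanonical Δ δ τ) (i : Fin (n + 1)) (j : Fin n) :
    |σ.mat i j| ≤ Δ := by
  refine Fin.lastCases (h.abs_c_le j) (fun i => ?_) i
  change |σ.H i j| ≤ Δ
  rw [abs_of_nonneg (h.nonneg i j)]
  refine le_trans ?_ ((h.diag_le i).trans h.det_le)
  rcases lt_trichotomy i j with hij | rfl | hij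
  · rw [h.lower i j hij]; exact zero_le_one.trans (h.diag_pos i)
  · exact le_rfl
  · exact (h.reduced i j hij).2.le

lemma IneqSystem.IsCanonical.isDeltaModular (h : σ.IsCanonical Δ δ τ) :
    IsDeltaModular Δ σ.mat := by
  rw [IsDeltaModular, h.slacks.bigDelta_eq, h.slacks.det]
  have := h.det_le
  have := h.slacks.pos
  omega

lemma IneqSystem.IsCanonical.isNormalized (h : σ.IsCanonical Δ δ τ)
    (hgcd : σ.IsPrimitive) : σ.IsNormalized Δ where
  lower := h.lower
  diag_pos := fun i => h.diag_pos i
  reduced := h.reduced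
  det_eq := h.slacks.bigDelta_eq.symm
  block := by
    have hprod := h.prod_diag
    obtain ⟨s, k, rfl, h1, h2, h3⟩ := h.block
    simp only [Fin.cast_eq_self] at h1 h2 h3
    refine ⟨s, k, rfl, .of fun i j => σ.H (i.natAdd s) (j.castAdd k),
      .of fun i j => σ.H (i.natAdd s) (j.natAdd s), ?_, ?_, h3, ?_, h2⟩
    · ext i j
      rcases i with i | i <;> rcases j with j | j
      · simp only [submatrix_apply, Equiv.trans_apply, finSumFinEquiv_apply_left, finCongr_apply,
          Fin.cast_eq_self, fromBlocks_apply₁₁]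
        rcases lt_trichotomy i j with hij | rfl | hij
        · rw [h.lower _ _ (by rw [Fin.lt_def]; exact hij), one_apply_ne hij.ne]
        · rw [h1, one_apply_eq]
        · have := h.reduced (i.castAdd k) (j.castAdd k) (by rw [Fin.lt_def]; exact hij)
          rw [h1] at this
          rw [one_apply_ne hij.ne']
          omega
      · simp only [submatrix_apply, Equiv.trans_apply, finSumFinEquiv_apply_left, finCongr_apply,
          Fin.cast_eq_self, fromBlocks_apply₁₂, finSumFinEquiv_apply_right]
        exact h.lower _ _ (by rw [Fin.lt_def]; simp only [Fin.val_castAdd, Fin.val_natAdd]; omega)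
      · simp
      · simp
    -- The product of the `k` diagonal entries `≥ 2` is the determinant.
    · have h4 : (2 : ℤ) ^ k ≤ Δ := by
        refine le_trans ?_ (hprod.le.trans h.det_le)
        rw [Fin.prod_univ_add]
        simp only [h1, Finset.prod_const_one, one_mul]
        calc (2 : ℤ) ^ k = ∏ _i : Fin k, 2 := by simp
          _ ≤ _ := Finset.prod_le_prod (fun _ _ => by norm_num) fun i _ => h2 i
      have h5 : (2 : ℝ) ^ k ≤ Δ := by exact_mod_cast h4
      rw [Real.le_logb_iff_rpow_le one_lt_two (lt_of_lt_of_le (by positivity) h5),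
        Real.rpow_natCast]
      exact h5
    · intro i j hij
      exact h.lower _ _ (by rw [Fin.lt_def] at *; simp only [Fin.val_natAdd]; omega)
  rhs_reduced := h.rhs_reduced
  gcd_eq_one := hgcd
  c_mem := by
    have hpos : (0 : ℝ) < δ := by exact_mod_cast h.slacks.pos
    refine ⟨fun i => τ i / δ, fun i => ⟨div_pos ?_ hpos, (div_le_one hpos).2 ?_⟩, fun j => ?_⟩
    · exact_mod_cast h.slacks.one_le i
    · exact_mod_cast h.slacks.le i
    · have : (δ : ℝ) * σ.c j = -∑ i, (σ.H i j : ℝ) * τ i := by exact_mod_cast h.slacks.c_eq j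
      rw [← mul_right_inj' hpos.ne', this, Finset.mul_sum, ← Finset.sum_neg_distrib]
      exact Finset.sum_congr rfl fun i _ => by field_simp
  entry_le := h.abs_mat_le

end canonical
end EmptySimplices

namespace EmptySimplices
open Matrix
open EmptySimplices.Enc (enc)

/-! ### The systems constructed by the algorithm -/

/-- The system with given rows and right-hand side. -/
def toSystem (n : ℕ) (r : List (List ℤ) × List ℤ) : IneqSystem n :=
  ⟨.of fun i j => ent r.1 i j, fun i => gz r.2 i⟩

lemma encodeList_map {α β : Type} (e : β → Datum) (g : α → β) (l : List α) :
    encodeList e (l.map g) = encodeList (fun a => e (g a)) l := by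
  induction l with
  | nil => rfl
  | cons a l ih => rw [List.map_cons, encodeList, encodeList, ih]

lemma ofFn_gz {n : ℕ} {l : List ℤ} (h : l.length = n) : List.ofFn (fun i : Fin n => gz l i) = l := by
  refine ext_gz (by simp [h]) fun i hi => ?_
  rw [List.length_ofFn] at hi
  exact congrFun (toVec_ofFn fun i : Fin n => gz l i) ⟨i, hi⟩

lemma encodeSystem_toSystem {n : ℕ} {r : List (List ℤ) × List ℤ} (h1 : r.1.length = n + 1)
    (h2 : ∀ a ∈ r.1, a.length = n) (h3 : r.2.length = n + 1) :
    encodeSystem (toSystem n r) = enc r := by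
  have e1 : r.1 = (List.ofFn fun (i : Fin (n + 1)) (j : Fin n) => ent r.1 i j).map
      fun row => List.ofFn row := by
    refine List.ext_getElem (by simp [h1]) fun i hi _ => ?_
    rw [List.getElem_map, List.getElem_ofFn]
    have h4 := h2 _ (List.getElem_mem hi)
    conv_lhs => rw [← ofFn_gz h4]
    congr 1
    funext j
    simp [ent, List.getD_eq_getElem?_getD, hi]
  have e2 : enc r.1 = encodeList (fun row : Fin n → ℤ => encodeList Datum.num (List.ofFn row))
      (List.ofFn fun (i : Fin (n + 1)) (j : Fin n) => ent r.1 i j) := by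
    conv_lhs => rw [e1]
    exact encodeList_map _ _ _
  have e3 : enc r.2 = encodeList Datum.num (List.ofFn (toSystem n r).rhs) := by
    conv_lhs => rw [← ofFn_gz h3]
    rfl
  change _ = Datum.pair (enc r.1) (enc r.2)
  rw [e2, e3]
  rfl

lemma IneqSystem.ext_parts {n : ℕ} {σ σ' : IneqSystem n} (h1 : σ.H = σ'.H) (h2 : σ.c = σ'.c)
    (h3 : σ.h = σ'.h) (h4 : σ.rhs (Fin.last n) = σ'.rhs (Fin.last n)) : σ = σ' := by
  obtain ⟨A, b⟩ := σ
  obtain ⟨A', b'⟩ := σ'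
  congr 1
  · funext i
    refine Fin.lastCases h2 (fun i => ?_) i
    exact congrFun h1 i
  · funext i
    refine Fin.lastCases h4 (fun i => ?_) i
    exact congrFun h3 i

section mkSystem
variable {s k n Δ δ : ℕ} {A : List (List ℤ)} {τ h : List ℤ} {c₀ : ℤ}

lemma toSystem_mkSystem_H (hA : A.length = n) :
    (toSystem n (mkSystem n δ A τ h c₀)).H = toMat n A := by
  ext i j
  simp [toSystem, mkSystem, IneqSystem.H, ent, toMat, List.getD_eq_getElem?_getD, hA]

lemma toSystem_mkSystem_c (hA : A.length = n) (j : Fin n) :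
    (toSystem n (mkSystem n δ A τ h c₀)).c j = -(colDot n A j τ / δ) := by
  have : (A ++ [(List.range n).map fun j => -(colDot n A j τ / δ)]).getD n [] =
      (List.range n).map fun j => -(colDot n A j τ / δ) := by
    simp [List.getD_eq_getElem?_getD, ← hA]
  simp only [toSystem, mkSystem, IneqSystem.c, ent, of_apply, Fin.val_last, this]
  exact gz_map_range (fun j => -(colDot n A j τ / δ)) j.2

lemma toSystem_mkSystem_h (hh : h.length = n) :
    (toSystem n (mkSystem n δ A τ h c₀)).h = toVec n h := by
  funext i
  simp [toSystem, mkSystem, IneqSystem.h, gz, toVec, List.getD_eq_getElem?_getD, hh]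

lemma toSystem_mkSystem_last (hh : h.length = n) :
    (toSystem n (mkSystem n δ A τ h c₀)).rhs (Fin.last n) = c₀ := by
  simp [toSystem, mkSystem, gz, List.getD_eq_getElem?_getD, ← hh]

lemma hasSlacks_mkSystem (hδ : 1 ≤ δ) (hA : A.length = n) (hdet : (toMat n A).det = δ)
    (hτ : IsTau n δ A τ) :
    (toSystem n (mkSystem n δ A τ h c₀)).HasSlacks δ (toVec n τ) where
  det := by rw [toSystem_mkSystem_H hA, hdet]
  pos := by exact_mod_cast hδ
  one_le := fun i => (hτ.2.1 i i.2).1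
  le := fun i => (hτ.2.1 i i.2).2
  c_eq := fun j => by
    rw [toSystem_mkSystem_c hA, toSystem_mkSystem_H hA, mul_neg,
      Int.mul_ediv_cancel' (hτ.2.2 j j.2), colDot_eq]
    rfl

lemma bound_mkSystem (hh : h.length = n) :
    (toSystem n (mkSystem n δ A τ h c₀)).bound δ (toVec n τ) = slack n δ τ h c₀ := by
  rw [IneqSystem.bound, toSystem_mkSystem_last hh, toSystem_mkSystem_h hh, slack, dotZ_eq]
  rfl

lemma isCanonical_mkSystem {x : Node} (hx : x.Valid (s + k) Δ s k) (hτ : τ ∈ x.taus)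
    (hh : h ∈ x.box) :
    (toSystem (s + k) (mkSystem (s + k) x.δ x.A τ h c₀)).IsCanonical Δ x.δ (toVec (s + k) τ) := by
  have hA := hx.hnf
  obtain ⟨hlen, hred⟩ := (hx.mem_box h).1 hh
  have hH : (toSystem (s + k) (mkSystem (s + k) x.δ x.A τ h c₀)).H = toMat (s + k) x.A :=
    toSystem_mkSystem_H hA.length
  refine ⟨hasSlacks_mkSystem hx.δ_pos hA.length hx.det ((hx.mem_taus τ).1 hτ),
    by exact_mod_cast hx.δ_le, ?_, ?_, ⟨s, k, rfl, ?_, ?_, ?_⟩, ?_⟩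
  · rw [hH]; exact fun i j hij => hA.upper i j hij j.2
  · rw [hH]; exact fun i j hij => hA.lower i j hij i.2
  · rw [hH]; exact fun i => hA.diag_one i i.2
  · rw [hH]; exact fun i => hA.diag_two (s + i) (Nat.le_add_right _ _) (by omega)
  · rw [hH]; exact fun j j' hj => hA.sorted j j' hj j'.2
  · rw [hH, toSystem_mkSystem_h hlen]; exact fun i => hred i i.2

end mkSystem

/-- A common divisor of a row divides a nonzero coefficient, and coefficients are at most `Δ` in
absolute value. Such a coefficient exists in each row: a diagonal entry, or any entry of `c`, all of
which are negative. -/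
lemma gcdOk_iff {n Δ : ℕ} {δ : ℤ} {τ : Fin n → ℤ} {r : List (List ℤ) × List ℤ} (hn : 1 ≤ n)
    (h : (toSystem n r).IsCanonical Δ δ τ) :
    gcdOk n Δ r = true ↔ (toSystem n r).IsPrimitive := by
  have h0 : gcdOk n Δ r = true ↔ ∀ i < n + 1, ∀ e < Δ + 1, ¬ (2 ≤ e ∧
      (∀ j < n, (e : ℤ) ∣ ent r.1 i j) ∧ (e : ℤ) ∣ gz r.2 i) := by
    simp only [gcdOk, List.all_eq_true, List.mem_range, Bool.not_eq_true', Bool.eq_false_iff, Ne,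
      Bool.and_eq_true, zle_iff, zeq_iff, Int.dvd_iff_emod_eq_zero, Nat.ofNat_le_cast]
  have hdvd : ∀ (i : Fin (n + 1)) (e : ℤ),
      e ∣ Int.gcd (Finset.univ.gcd ((toSystem n r).mat i)) ((toSystem n r).rhs i) ↔
        (∀ j < n, e ∣ ent r.1 i j) ∧ e ∣ gz r.2 i := by
    intro i e
    rw [Int.dvd_coe_gcd_iff, Finset.dvd_gcd_iff]
    refine and_congr_left fun _ => ⟨fun h j hj => h ⟨j, hj⟩ (Finset.mem_univ _), fun h j _ => h j j.2⟩
  rw [h0]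
  constructor
  · intro hall i
    have hne : ∃ j, (toSystem n r).mat i j ≠ 0 := by
      refine Fin.lastCases ⟨⟨0, hn⟩, (h.c_neg ⟨0, hn⟩).ne⟩ (fun i => ⟨i, ?_⟩) i
      have : (1 : ℤ) ≤ (toSystem n r).mat i.castSucc i := h.diag_pos i
      omega
    obtain ⟨j, hj⟩ := hne
    set g := Int.gcd (Finset.univ.gcd ((toSystem n r).mat i)) ((toSystem n r).rhs i)
    have h1 := (hdvd i g).1 dvd_rfl
    have h2 : (g : ℤ) ∣ (toSystem n r).mat i j := h1.1 j j.2
    have h3 := Int.le_of_dvd (abs_pos.2 hj) ((dvd_abs _ _).2 h2)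
    have h4 := h.abs_mat_le i j
    have h5 : g ≠ 0 := by
      intro h0
      rw [h0, Nat.cast_zero, zero_dvd_iff] at h2
      exact hj h2
    have h6 := hall i i.2 g (by omega)
    by_contra hg
    exact h6 ⟨by omega, h1⟩
  · rintro hp i hi e _ ⟨he, h1⟩
    have h2 := (hdvd ⟨i, hi⟩ e).2 h1
    rw [hp ⟨i, hi⟩, Nat.cast_one] at h2
    have := Int.le_of_dvd one_pos h2
    omega

/-! ### Correctness of the tests at the leaves. -/

section leaves
variable {s k Δ : ℕ} {x : Node} {τ h : List ℤ} {c₀ : ℤ}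

lemma emptyOk_iff (hn : 1 ≤ s + k) (hx : x.Valid (s + k) Δ s k) (hτ : τ ∈ x.taus)
    (hh : h ∈ x.box) : emptyOk x τ h c₀ = true ↔
      0 < (toSystem (s + k) (mkSystem (s + k) x.δ x.A τ h c₀)).bound x.δ (toVec (s + k) τ) ∧
      (toSystem (s + k) (mkSystem (s + k) x.δ x.A τ h c₀)).IsPrimitive ∧
      IsEmptySimplex (toSystem (s + k) (mkSystem (s + k) x.δ x.A τ h c₀)).solutions := by
  have hc := isCanonical_mkSystem (c₀ := c₀) hx hτ hh
  have hlen := ((hx.mem_box h).1 hh).1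
  rw [emptyOk, Bool.and_eq_true, Bool.and_eq_true, zle_iff, hx.n_eq, hx.Δ_eq, gcdOk_iff hn hc,
    bound_mkSystem hlen]
  rw [show 1 ≤ slack (s + k) x.δ τ h c₀ ↔ 0 < slack (s + k) x.δ τ h c₀ by omega]
  refine and_congr_right fun hR => and_congr_right fun _ => ?_
  rw [hc.slacks.isEmptySimplex_iff (by rwa [bound_mkSystem hlen]), bound_mkSystem hlen,
    toSystem_mkSystem_H hx.hnf.length, toSystem_mkSystem_h hlen, Bool.not_eq_true',
    Bool.eq_false_iff, Ne]
  have h1 := hits_drop_layers_iff hx.hnf hx.mem_box hx.δ_pos hx.det hx.mem_taus hτ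
    (slack (s + k) x.δ τ h c₀).toNat 0 h
  rw [List.drop_zero] at h1
  rw [h1]
  push Not
  refine forall_congr' fun y => forall_congr' fun _ => ?_
  rw [Nat.cast_zero, add_zero, Int.toNat_of_nonneg hR.le]
  constructor
  · intro h2 h3
    by_contra! h4
    exact h2 h4 h3
  · intro h2 h3 h4
    exact absurd (h2 h4) (not_lt.2 h3)

/-- Criterion for the lattice-simplex to be empty, in terms of pairs of coordinates. -/
lemma forall_vertex_iff {n : ℕ} {L : (Fin n → ℤ) → Prop} {τ : Fin n → ℤ} {R : ℤ}
    (hτ : ∀ i, 1 ≤ τ i) (hdvd : ∀ i, τ i ∣ R) :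
    (∀ y : Fin n → ℤ, (∀ i, 0 ≤ y i) → L y → ∑ i, τ i * y i ≤ R →
        y = 0 ∨ ∃ i, y = Pi.single i (R / τ i)) ↔
      ∀ i, (∀ z : Fin n → ℤ, (∀ l, 0 ≤ z l) → ∑ l, τ l * z l + (τ i + 1) ≤ R →
          ¬ L (z + Pi.single i 1)) ∧
        ∀ j, i = j ∨ ∀ z : Fin n → ℤ, (∀ l, 0 ≤ z l) → ∑ l, τ l * z l + (τ i + τ j) ≤ R →
          ¬ L (z + Pi.single i 1 + Pi.single j 1) := by
  have hsum : ∀ (z : Fin n → ℤ) i c, ∑ l, τ l * (z + Pi.single i c : Fin n → ℤ) l =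
      ∑ l, τ l * z l + τ i * c := fun z i c => by
    simp only [Pi.add_apply, mul_add, Finset.sum_add_distrib]
    congr 1
    rw [Finset.sum_eq_single i (fun l _ hl => by rw [Pi.single_eq_of_ne hl, mul_zero]) (by simp),
      Pi.single_eq_same]
  have hnn : ∀ (z : Fin n → ℤ) i, (∀ l, 0 ≤ z l) → ∀ l, 0 ≤ (z + Pi.single i 1 : Fin n → ℤ) l :=
    fun z i hz l => add_nonneg (hz l) (by
      rcases eq_or_ne l i with rfl | hl
      · simp
      · rw [Pi.single_eq_of_ne hl])
  have hself : ∀ (z : Fin n → ℤ) i, (∀ l, 0 ≤ z l) → 1 ≤ (z + Pi.single i 1 : Fin n → ℤ) i :=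
    fun z i hz => by
      rw [Pi.add_apply, Pi.single_eq_same]
      have := hz i
      omega
  constructor
  · intro h i
    refine ⟨fun z hz hle hL => ?_, fun j => or_iff_not_imp_left.2 fun hij z hz hle hL => ?_⟩
    · rcases h _ (hnn z i hz) hL (by rw [hsum]; omega) with h0 | ⟨l, hl⟩
      · have h1 := hself z i hz
        rw [h0] at h1
        simp at h1
      -- A multiple of `e_l` allowed by the conclusion has value exactly `R`, while this vector has
      -- value at most `R - 1`.
      · have h1 := hsum z i 1
        have h2 := hsum 0 l (R / τ l)
        rw [zero_add, ← hl, h1, Int.mul_ediv_cancel' (hdvd l)] at h2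
        simp at h2
        omega
    · have hz' := hnn z i hz
      have hz'' := hnn _ j hz'
      have h1 := hself _ j hz'
      have h2 : 1 ≤ (z + Pi.single i 1 + Pi.single j 1 : Fin n → ℤ) i := by
        rw [Pi.add_apply, Pi.single_eq_of_ne hij, add_zero]
        exact hself z i hz
      rcases h _ hz'' hL (by rw [hsum, hsum]; omega) with h0 | ⟨l, hl⟩
      · rw [h0] at h1
        simp at h1
      · rw [hl] at h1 h2
        rcases eq_or_ne i l with rfl | hil
        · rw [Pi.single_eq_of_ne (Ne.symm hij)] at h1
          omega
        · rw [Pi.single_eq_of_ne hil] at h2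
          omega
  · intro h y hy hL hle
    by_cases h0 : ∃ i, y i ≠ 0
    swap
    · push Not at h0
      exact .inl (funext h0)
    obtain ⟨i, hi⟩ := h0
    refine .inr ⟨i, ?_⟩
    have hyi : 0 < y i := lt_of_le_of_ne (hy i) hi.symm
    -- A nonzero `y` with two positive coordinates violates the condition on pairs. If only `y_i` is
    -- positive, the first condition excludes values below `R`, so `τ_i y_i = R`.
    set z : Fin n → ℤ := y + Pi.single i (-1) with hz
    have hyz : z + Pi.single i 1 = y := by
      rw [hz, add_assoc, ← Pi.single_add]
      simp
    have hz0 : ∀ l, 0 ≤ z l := fun l => by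
      rcases eq_or_ne l i with rfl | hl
      · rw [hz, Pi.add_apply, Pi.single_eq_same]; omega
      · rw [hz, Pi.add_apply, Pi.single_eq_of_ne hl, add_zero]; exact hy l
    have hzsum : ∑ l, τ l * z l = ∑ l, τ l * y l - τ i := by rw [hz, hsum]; ring
    by_cases h1 : ∃ j, j ≠ i ∧ y j ≠ 0
    · exfalso
      obtain ⟨j, hji, hj⟩ := h1
      have hyj : 0 < y j := lt_of_le_of_ne (hy j) hj.symm
      refine ((h i).2 j).resolve_left hji.symm (z + Pi.single j (-1)) (fun l => ?_) ?_ ?_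
      · rcases eq_or_ne l j with rfl | hl
        · rw [Pi.add_apply, Pi.single_eq_same, hz, Pi.add_apply, Pi.single_eq_of_ne hji]; omega
        · rw [Pi.add_apply, Pi.single_eq_of_ne hl, add_zero]; exact hz0 l
      · rw [hsum, hzsum]; linarith
      · have : z + Pi.single j (-1) + Pi.single i 1 + Pi.single j 1 = y := by
          rw [add_right_comm, add_assoc z, ← Pi.single_add]
          simpa using hyz
        rwa [this]
    · push Not at h1
      have h2 : y = Pi.single i (y i) := by
        funext l
        rcases eq_or_ne l i with rfl | hl
        · rw [Pi.single_eq_same]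
        · rw [Pi.single_eq_of_ne hl, h1 l hl]
      have h3 : ∑ l, τ l * y l = τ i * y i := by
        have := hsum 0 i (y i)
        rw [zero_add, ← h2] at this
        simpa using this
      have h4 : R ≤ τ i * y i := by
        by_contra! hlt
        exact (h i).1 z hz0 (by rw [hzsum, h3]; omega) (by rwa [hyz])
      have h5 : R = τ i * y i := le_antisymm h4 (h3 ▸ hle)
      rw [h5, Int.mul_ediv_cancel_left _ (by have := hτ i; omega)]
      exact h2

lemma toVec_replicate (n : ℕ) : toVec n (List.replicate n 0) = 0 :=
  funext fun i => gz_replicate_zero n i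

lemma replicate_mem_box (hx : x.Valid (s + k) Δ s k) : List.replicate (s + k) 0 ∈ x.box := by
  rw [hx.mem_box]
  exact ⟨by simp, fun i hi => by
    rw [gz_replicate_zero]; exact ⟨le_rfl, hx.hnf.diag_pos hi⟩⟩

/-- By `forall_vertex_iff` a bad lattice vector has the form `z + e_i` with value `< R`, or `z + e_i
+ e_j` with `i ≠ j` and value `≤ R`, where `z ≥ 0`. It is found by looking for the class of `-e_i`
or `-e_i - e_j` in the layers, after dropping the first `τ_i + 1` or `τ_i + τ_j` of them. -/
lemma latticeOk_iff (hn : 1 ≤ s + k) (hx : x.Valid (s + k) Δ s k) (hτ : τ ∈ x.taus)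
    (hh : h = List.replicate (s + k) 0) : latticeOk x τ h c₀ = true ↔
      0 < (toSystem (s + k) (mkSystem (s + k) x.δ x.A τ h c₀)).bound x.δ (toVec (s + k) τ) ∧
      (toSystem (s + k) (mkSystem (s + k) x.δ x.A τ h c₀)).IsPrimitive ∧
      IsEmptyLatticeSimplex (toSystem (s + k) (mkSystem (s + k) x.δ x.A τ h c₀)).solutions := by
  have hbox : h ∈ x.box := hh ▸ replicate_mem_box hx
  have hc := isCanonical_mkSystem (c₀ := c₀) hx hτ hbox
  have hlen := ((hx.mem_box h).1 hbox).1
  have hτ1 : ∀ i, 1 ≤ toVec (s + k) τ i := fun i => (((hx.mem_taus τ).1 hτ).2.1 i i.2).1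
  have h0 : (toSystem (s + k) (mkSystem (s + k) x.δ x.A τ h c₀)).h = 0 := by
    rw [toSystem_mkSystem_h hlen, hh, toVec_replicate]
  rw [latticeOk, Bool.and_eq_true, Bool.and_eq_true, zle_iff, hx.n_eq, hx.Δ_eq, gcdOk_iff hn hc,
    bound_mkSystem hlen]
  rw [show 1 ≤ slack (s + k) x.δ τ h c₀ ↔ 0 < slack (s + k) x.δ τ h c₀ by omega]
  refine and_congr_right fun hR => and_congr_right fun _ => ?_
  rw [hc.slacks.isEmptyLatticeSimplex_iff (by rwa [bound_mkSystem hlen]) h0, bound_mkSystem hlen,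
    toSystem_mkSystem_H hx.hnf.length]
  set R := slack (s + k) x.δ τ h c₀
  have hL := inLat_iff hx.δ_pos hx.det hx.mem_taus
  have hhits := hits_drop_layers_iff hx.hnf hx.mem_box hx.δ_pos hx.det hx.mem_taus hτ R.toNat
  have key : (∀ i : Fin (s + k), toVec (s + k) τ i ∣ R) →
      ((∀ y : Fin (s + k) → ℤ, (∀ i, 0 ≤ y i) → (∃ u, toMat (s + k) x.A *ᵥ u = y) →
        ∑ i, toVec (s + k) τ i * y i ≤ R →
        y = 0 ∨ ∃ i, y = Pi.single i (R / toVec (s + k) τ i)) ↔ _) :=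
    forall_vertex_iff (L := InLattice (toMat (s + k) x.A)) hτ1
  have hneg : ∀ y : Fin (s + k) → ℤ, InLattice (toMat (s + k) x.A) (-y) ↔
      InLattice (toMat (s + k) x.A) y := fun y => ⟨fun h => neg_neg y ▸ h.neg, fun h => h.neg⟩
  have h1 : ∀ i : Fin (s + k), (hits (s + k) x.δ x.taus ((layers (s + k) x.δ x.taus x.box τ
      R.toNat).drop (gz τ i + 1).toNat) (unitVec (s + k) i (-1))) = true ↔
      ∃ z : Fin (s + k) → ℤ, (∀ l, 0 ≤ z l) ∧
        ∑ l, toVec (s + k) τ l * z l + (toVec (s + k) τ i + 1) ≤ R ∧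
        InLattice (toMat (s + k) x.A) (z + Pi.single i 1) := fun i => by
    rw [hhits]
    refine exists_congr fun z => and_congr_right fun _ => and_congr ?_ ?_
    · have : gz τ i = toVec (s + k) τ i := rfl
      have := hτ1 i
      omega
    · rw [toVec_unitVec, ← hneg, neg_sub, Pi.single_neg, sub_neg_eq_add]
  have h2 : ∀ i j : Fin (s + k), (hits (s + k) x.δ x.taus ((layers (s + k) x.δ x.taus x.box τ
      R.toNat).drop (gz τ i + gz τ j).toNat)
      (vsub (s + k) (unitVec (s + k) i (-1)) (unitVec (s + k) j 1))) = true ↔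
      ∃ z : Fin (s + k) → ℤ, (∀ l, 0 ≤ z l) ∧
        ∑ l, toVec (s + k) τ l * z l + (toVec (s + k) τ i + toVec (s + k) τ j) ≤ R ∧
        InLattice (toMat (s + k) x.A) (z + Pi.single i 1 + Pi.single j 1) := fun i j => by
    rw [hhits]
    refine exists_congr fun z => and_congr_right fun _ => and_congr ?_ ?_
    · have : gz τ i = toVec (s + k) τ i := rfl
      have : gz τ j = toVec (s + k) τ j := rfl
      have := hτ1 i
      have := hτ1 j
      omega
    · rw [toVec_vsub, toVec_unitVec, toVec_unitVec, ← hneg, Pi.single_neg]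
      congr! 1
      abel
  have h3 : ∀ i : Fin (s + k), inLat (s + k) x.δ x.taus (unitVec (s + k) i (R / gz τ i)) = true ↔
      ∃ u, toMat (s + k) x.A *ᵥ u = Pi.single i (R / toVec (s + k) τ i) := fun i => by
    rw [hL, toVec_unitVec]; rfl
  have h4 : ∀ i : Fin (s + k), R % gz τ i = 0 ↔ toVec (s + k) τ i ∣ R := fun i =>
    Int.dvd_iff_emod_eq_zero.symm
  have hfin : ∀ p : ℕ → Prop, (∀ i < s + k, p i) ↔ ∀ i : Fin (s + k), p i := fun p =>
    ⟨fun h i => h i i.2, fun h i hi => h ⟨i, hi⟩⟩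
  simp only [List.all_eq_true, List.mem_range, hfin, Bool.and_eq_true, Bool.or_eq_true,
    Bool.not_eq_true', Bool.eq_false_iff, Ne, zeq_iff, Nat.cast_inj, h1, h2, h3, h4,
    Fin.val_inj, forall_and]
  rw [← forall_and]
  refine and_congr_right fun hd => ?_
  rw [key fun i => (hd i).1]
  push Not
  rw [← forall_and]

lemma encodeSystem_mkSystem (hx : x.Valid (s + k) Δ s k) (hh : h ∈ x.box) :
    encodeSystem (toSystem (s + k) (mkSystem (s + k) x.δ x.A τ h c₀)) =
      enc (mkSystem (s + k) x.δ x.A τ h c₀) := by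
  have h1 := hx.hnf.length
  have h2 := ((hx.mem_box h).1 hh).1
  refine encodeSystem_toSystem (by simp [mkSystem, h1]) (fun a ha => ?_) (by simp [mkSystem, h2])
  rw [mkSystem, List.mem_append, List.mem_singleton] at ha
  rcases ha with ha | rfl
  · exact hx.hnf.row_length a ha
  · simp

end leaves

/-! ### Soundness and completeness of the two families. -/

section families
variable {n s k Δ : ℕ} {x : Node} {r : List (List ℤ) × List ℤ}

lemma Node.mem_leafS : r ∈ x.leafS ↔ x.m = x.n ∧ ∃ τ ∈ x.taus, ∃ h ∈ x.box, ∃ j < 2 * x.Δ + 1,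
    emptyOk x τ h ((j : ℤ) - x.Δ) = true ∧ r = mkSystem x.n x.δ x.A τ h ((j : ℤ) - x.Δ) := by
  rw [Node.leafS]
  by_cases hm : zeq (x.m : ℤ) x.n = true
  · rw [hm, cond_true, and_iff_right (Nat.cast_inj.1 ((zeq_iff _ _).1 hm))]
    simp only [List.mem_flatMap, List.mem_range]
    refine exists_congr fun τ => and_congr_right fun _ => exists_congr fun h =>
      and_congr_right fun _ => exists_congr fun j => and_congr_right fun _ => ?_
    cases emptyOk x τ h ((j : ℤ) - x.Δ) <;> simp
  · have hm' : ¬ x.m = x.n := fun h => hm ((zeq_iff _ _).2 (by exact_mod_cast h))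
    rw [Bool.not_eq_true] at hm
    simp [hm, hm']

lemma Node.mem_leafL : r ∈ x.leafL ↔ x.m = x.n ∧ ∃ τ ∈ x.taus, ∃ j < x.Δ + 1,
    latticeOk x τ (List.replicate x.n 0) j = true ∧
      r = mkSystem x.n x.δ x.A τ (List.replicate x.n 0) j := by
  rw [Node.leafL]
  by_cases hm : zeq (x.m : ℤ) x.n = true
  · rw [hm, cond_true, and_iff_right (Nat.cast_inj.1 ((zeq_iff _ _).1 hm))]
    simp only [List.mem_flatMap, List.mem_range]
    refine exists_congr fun τ => and_congr_right fun _ => exists_congr fun j =>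
      and_congr_right fun _ => ?_
    cases latticeOk x τ (List.replicate x.n 0) j <;> simp
  · have hm' : ¬ x.m = x.n := fun h => hm ((zeq_iff _ _).2 (by exact_mod_cast h))
    rw [Bool.not_eq_true] at hm
    simp [hm, hm']

lemma Node.Valid.of_mem_leafS (hn : 1 ≤ n) (hx : x.Valid n Δ s k) (hr : r ∈ x.leafS) :
    encodeSystem (toSystem n r) = enc r ∧ IsEmptySimplex (toSystem n r).solutions ∧
      IsDeltaModular Δ (toSystem n r).mat ∧ (toSystem n r).IsNormalized Δ := by
  obtain ⟨hm, τ, hτ, h, hh, j, -, hok, rfl⟩ := Node.mem_leafS.1 hr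
  obtain rfl : n = s + k := by rw [← hx.n_eq, ← hm, hx.m_eq]
  rw [emptyOk_iff hn hx hτ hh] at hok
  rw [hx.n_eq]
  have hc := isCanonical_mkSystem (c₀ := (j : ℤ) - x.Δ) hx hτ hh
  exact ⟨encodeSystem_mkSystem hx hh, hok.2.2, hc.isDeltaModular, hc.isNormalized hok.2.1⟩

lemma Node.Valid.of_mem_leafL (hn : 1 ≤ n) (hx : x.Valid n Δ s k) (hr : r ∈ x.leafL) :
    encodeSystem (toSystem n r) = enc r ∧ IsEmptyLatticeSimplex (toSystem n r).solutions ∧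
      IsDeltaModular Δ (toSystem n r).mat ∧ (toSystem n r).IsNormalized Δ := by
  obtain ⟨hm, τ, hτ, j, -, hok, rfl⟩ := Node.mem_leafL.1 hr
  obtain rfl : n = s + k := by rw [← hx.n_eq, ← hm, hx.m_eq]
  rw [hx.n_eq] at hok ⊢
  rw [latticeOk_iff hn hx hτ rfl] at hok
  have hc := isCanonical_mkSystem (c₀ := (j : ℤ)) hx hτ (replicate_mem_box hx)
  exact ⟨encodeSystem_mkSystem hx (replicate_mem_box hx), hok.2.2, hc.isDeltaModular,
    hc.isNormalized hok.2.1⟩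

variable {σ : IneqSystem n} {δ : ℤ} {τ : Fin n → ℤ}

/-- The matrix of a canonical system is found. -/
lemma IneqSystem.IsCanonical.exists_node (hΔ : 1 ≤ Δ) (hσ : σ.IsCanonical Δ δ τ) :
    ∃ s k, s + k = n ∧ ∃ x, Relation.ReflTransGen (fun a b => b ∈ Node.expand a) (Node.root n Δ) x ∧
      x.Valid n Δ s k ∧ x.δ = δ ∧ List.ofFn τ ∈ x.taus ∧ List.ofFn σ.h ∈ x.box ∧
      toSystem n (mkSystem n x.δ x.A (List.ofFn τ) (List.ofFn σ.h) (σ.rhs (Fin.last n))) = σ := by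
  obtain ⟨s, k, rfl, h1, h2, h3⟩ := hσ.block
  simp only [Fin.cast_eq_self] at h1 h2 h3
  set H : ℕ → ℕ → ℤ := fun i j => if h : i < s + k ∧ j < s + k then σ.H ⟨i, h.1⟩ ⟨j, h.2⟩ else 0
    with hHdef
  have hH : ∀ i j : Fin (s + k), H i j = σ.H i j := fun i j => by
    simp [hHdef]
  obtain ⟨x, hx, hval, hent⟩ := exists_reachable_node (S := s) (K := k) hΔ H
    (fun i j hij hi => by
      have := hσ.reduced ⟨i, hi⟩ ⟨j, hij.trans hi⟩ hij
      rwa [← hH, ← hH] at this)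
    (fun i j hij hj => by
      have := hσ.lower ⟨i, hij.trans hj⟩ ⟨j, hj⟩ hij
      rwa [← hH] at this)
    (fun i hi => by
      have := h1 ⟨i, hi⟩
      rwa [← hH] at this)
    (fun i hi hi' => by
      have := h2 ⟨i - s, by omega⟩
      rw [← hH] at this
      simpa [Nat.add_sub_cancel' hi] using this)
    (fun j j' hj hj' => by
      have := h3 (a := ⟨j, hj.trans_lt hj'⟩) (b := ⟨j', hj'⟩) hj
      simp only [← hH] at this
      exact this)
    (by
      rw [Finset.prod_range]
      simp only [hH]
      rw [hσ.prod_diag]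
      exact hσ.det_le)
  have hmat : toMat (s + k) x.A = σ.H := by
    ext i j
    rw [toMat, of_apply, hent i j i.2 j.2, hH]
  have hδ : (x.δ : ℤ) = δ := by rw [← hval.det, hmat, hσ.slacks.det]
  have hpos := hσ.slacks.pos
  have hgz : ∀ (v : Fin (s + k) → ℤ) (i : Fin (s + k)), gz (List.ofFn v) i = v i := fun v i =>
    congrFun (toVec_ofFn v) i
  have hent' : ∀ i j : Fin (s + k), ent x.A i j = σ.H i j := fun i j => congrFun (congrFun hmat i) j
  have hcol : ∀ j : Fin (s + k), colDot (s + k) x.A j (List.ofFn τ) = -(δ * σ.c j) := fun j => by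
    rw [colDot_eq, hσ.slacks.c_eq, neg_neg]
    exact Finset.sum_congr rfl fun i _ => by rw [hgz, hent']
  refine ⟨s, k, rfl, x, hx, hval, hδ, (hval.mem_taus _).2 ⟨by simp, fun i hi => ?_, fun j hj => ?_⟩,
    (hval.mem_box _).2 ⟨by simp, fun i hi => ?_⟩, ?_⟩
  · rw [hgz τ ⟨i, hi⟩, hδ]
    exact ⟨hσ.slacks.one_le _, hσ.slacks.le _⟩
  · rw [hcol ⟨j, hj⟩, hδ]
    exact (dvd_mul_right _ _).neg_right
  · rw [hgz σ.h ⟨i, hi⟩, hent' ⟨i, hi⟩ ⟨i, hi⟩]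
    exact hσ.rhs_reduced _
  · refine IneqSystem.ext_parts ?_ ?_ ?_ ?_
    · rw [toSystem_mkSystem_H hval.hnf.length, hmat]
    · funext j
      rw [toSystem_mkSystem_c hval.hnf.length, hcol, hδ, ← mul_neg,
        Int.mul_ediv_cancel_left _ hpos.ne', neg_neg]
    · rw [toSystem_mkSystem_h (by simp), toVec_ofFn]
    · rw [toSystem_mkSystem_last (by simp)]

lemma IneqSystem.IsCanonical.exists_leafS (hn : 1 ≤ n) (hΔ : 1 ≤ Δ) (hσ : σ.IsCanonical Δ δ τ)
    (hp : σ.IsPrimitive) (he : IsEmptySimplex σ.solutions) :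
    ∃ x, Relation.ReflTransGen (fun a b => b ∈ Node.expand a) (Node.root n Δ) x ∧
      ∃ r ∈ x.leafS, toSystem n r = σ := by
  obtain ⟨s, k, rfl, x, hx, hval, hδ, hτ, hh, hsys⟩ := hσ.exists_node hΔ
  have hR := hσ.slacks.bound_pos (he.1.nontrivial hn)
  -- The origin has slack vector `h`. As it lies outside the simplex, `R < τ h`, which means `c₀ <
  -- 0`.
  have h1 := (hσ.slacks.isEmptySimplex_iff hR).1 he σ.h (fun i => (hσ.rhs_reduced i).1)
    ⟨0, by simp⟩
  set c₀ := σ.rhs (Fin.last (s + k)) with hc₀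
  have hbound : σ.bound δ τ = δ * c₀ + ∑ i, τ i * σ.h i := rfl
  have hpos := hσ.slacks.pos
  have hle := hσ.det_le
  have h2 : c₀ < 0 := by nlinarith
  have h3 : ∑ i, τ i * σ.h i ≤ δ * (δ - 1) := by
    calc ∑ i, τ i * σ.h i ≤ ∑ i, δ * (σ.H i i - 1) := Finset.sum_le_sum fun i _ =>
          mul_le_mul (hσ.slacks.le i) (by have := (hσ.rhs_reduced i).2; omega)
            (hσ.rhs_reduced i).1 hpos.le
      _ = δ * ∑ i, (σ.H i i - 1) := (Finset.mul_sum _ _ _).symm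
      _ ≤ δ * (δ - 1) := by
          refine mul_le_mul_of_nonneg_left ?_ hpos.le
          have := one_add_sum_sub_one_le_prod Finset.univ hσ.diag_pos
          rw [hσ.prod_diag] at this
          linarith
  -- From `0 < δ c₀ + τ h` and `τ h ≤ δ (δ - 1)`; so `c₀` lies in the range tested by `Node.leafS`.
  have h4 : -(Δ : ℤ) ≤ c₀ := by nlinarith
  have hk : (((c₀ + Δ).toNat : ℕ) : ℤ) - x.Δ = c₀ := by rw [hval.Δ_eq]; omega
  refine ⟨x, hx, _, Node.mem_leafS.2 ⟨by rw [hval.m_eq, hval.n_eq], _, hτ, _, hh,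
    (c₀ + Δ).toNat, by rw [hval.Δ_eq]; omega, ?_, rfl⟩, ?_⟩
  · rw [hk, emptyOk_iff hn hval hτ hh, hsys, toVec_ofFn, hδ]
    exact ⟨hR, hp, he⟩
  · rw [hk, hval.n_eq, hsys]

/-- By induction along the rows: once the earlier coordinates vanish, entry `i` is `H_ii u_i`, and
the only multiple of `H_ii` in `[0, H_ii)` is `0`. -/
lemma eq_zero_of_reduced {H : Matrix (Fin n) (Fin n) ℤ} (lower : ∀ i j, i < j → H i j = 0)
    {u : Fin n → ℤ} (h : ∀ i, 0 ≤ (H *ᵥ u) i ∧ (H *ᵥ u) i < H i i) : u = 0 := by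
  funext i
  induction i using WellFoundedLT.induction with
  | ind i ih =>
    have e : (H *ᵥ u) i = H i i * u i := by
      refine Finset.sum_eq_single i (fun j _ hj => ?_) fun h => absurd (Finset.mem_univ i) h
      rcases lt_or_gt_of_ne hj with hj | hj
      · rw [ih j hj, Pi.zero_apply, mul_zero]
      · exact mul_eq_zero_of_left (lower i j hj) _
    obtain ⟨h1, h2⟩ := h i
    rw [e] at h1 h2
    rw [Pi.zero_apply]
    by_contra hne
    rcases lt_or_gt_of_ne hne with hlt | hlt <;> nlinarith

/-- The vertex with zero slacks is integral, so `h` belongs to the lattice; being reduced, it is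
zero. -/
lemma IneqSystem.IsCanonical.h_eq_zero (hn : 1 ≤ n) (hσ : σ.IsCanonical Δ δ τ)
    (he : IsEmptyLatticeSimplex σ.solutions) : σ.h = 0 := by
  have hR := hσ.slacks.bound_pos (he.1.1.nontrivial hn)
  have h1 := he.1.2
  rw [hσ.slacks.extremePoints_eq hR] at h1
  obtain ⟨u, hu⟩ := (hσ.slacks.mem_integerPoints_iff _).1 (h1 ⟨0, rfl⟩)
  rw [hσ.slacks.slacks_vertex_zero] at hu
  have h2 : σ.h = σ.H *ᵥ u := by
    funext i
    have := congrFun hu i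
    rw [Pi.zero_apply, eq_comm, Int.cast_eq_zero, Pi.sub_apply] at this
    omega
  have h3 : u = 0 := eq_zero_of_reduced hσ.lower fun i => by
    rw [← h2]; exact hσ.rhs_reduced i
  rw [h2, h3, mulVec_zero]

lemma IneqSystem.IsCanonical.exists_leafL (hn : 1 ≤ n) (hΔ : 1 ≤ Δ) (hσ : σ.IsCanonical Δ δ τ)
    (hp : σ.IsPrimitive) (he : IsEmptyLatticeSimplex σ.solutions) :
    ∃ x, Relation.ReflTransGen (fun a b => b ∈ Node.expand a) (Node.root n Δ) x ∧
      ∃ r ∈ x.leafL, toSystem n r = σ := by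
  obtain ⟨s, k, rfl, x, hx, hval, hδ, hτ, hh, hsys⟩ := hσ.exists_node hΔ
  have hR := hσ.slacks.bound_pos (he.1.1.nontrivial hn)
  have h0 := hσ.h_eq_zero hn he
  obtain ⟨h1, h2⟩ := (hσ.slacks.isEmptyLatticeSimplex_iff hR h0).1 he
  set c₀ := σ.rhs (Fin.last (s + k)) with hc₀
  have hbound : σ.bound δ τ = δ * c₀ := by
    rw [IneqSystem.bound, h0]; simp [hc₀]
  have hpos := hσ.slacks.pos
  have hle := hσ.det_le
  have h3 : 0 < c₀ := by
    rw [hbound] at hR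
    exact pos_of_mul_pos_right hR hpos.le
  -- The vector `δ e_i` always belongs to the lattice. For `c₀ > Δ ≥ τ_i` its value `τ_i δ` is below
  -- `δ c₀ = R`, so it lies strictly between the vertices `0` and `(R / τ_i) e_i`.
  have h4 : c₀ ≤ Δ := by
    set i : Fin (s + k) := ⟨0, hn⟩
    have hτi := hσ.slacks.le i
    have hτi' := hσ.slacks.one_le i
    have h5 : ∑ l, τ l * (Pi.single i δ : Fin (s + k) → ℤ) l = τ i * δ := by
      rw [Finset.sum_eq_single i (fun l _ hl => by rw [Pi.single_eq_of_ne hl, mul_zero]) (by simp),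
        Pi.single_eq_same]
    by_contra! hlt
    have h6 : τ i * δ < σ.bound δ τ := by rw [hbound]; nlinarith
    have h10 : ∀ l, 0 ≤ (Pi.single i δ : Fin (s + k) → ℤ) l := fun l => by
      rcases eq_or_ne l i with rfl | hl
      · rw [Pi.single_eq_same]; exact hpos.le
      · rw [Pi.single_eq_of_ne hl]
    have h11 : σ.H *ᵥ (σ.H.adjugate *ᵥ Pi.single i 1) = Pi.single i δ := by
      rw [mulVec_mulVec, mul_adjugate, smul_mulVec, one_mulVec, hσ.slacks.det, ← Pi.single_smul,
        smul_eq_mul, mul_one]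
    rcases h2 (Pi.single i δ) h10 ⟨_, h11⟩ (h5 ▸ h6.le) with h7 | ⟨l, hl⟩
    · have := congrFun h7 i
      rw [Pi.single_eq_same] at this
      exact hpos.ne' this
    · have h8 := congrFun hl i
      rcases eq_or_ne i l with rfl | hne
      · rw [Pi.single_eq_same, Pi.single_eq_same] at h8
        have h9 := Int.mul_ediv_cancel' (h1 i).1
        rw [← h8] at h9
        exact h6.ne h9
      · rw [Pi.single_eq_same, Pi.single_eq_of_ne hne] at h8
        exact hpos.ne' h8
  have hh' : List.ofFn σ.h = List.replicate (s + k) 0 := by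
    rw [h0]; exact List.ofFn_const _ _
  have hk : ((c₀.toNat : ℕ) : ℤ) = c₀ := by omega
  refine ⟨x, hx, _, Node.mem_leafL.2 ⟨by rw [hval.m_eq, hval.n_eq], _, hτ,
    c₀.toNat, by rw [hval.Δ_eq]; omega, ?_, rfl⟩, ?_⟩
  · rw [hk, hval.n_eq, latticeOk_iff hn hval hτ rfl, ← hh', hsys, toVec_ofFn, hδ]
    exact ⟨hR, hp, he⟩
  · rw [hk, hval.n_eq, ← hh', hsys]

end families
end EmptySimplices

namespace EmptySimplices
open Matrix

/-! ### Hermite normal form -/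

section hnf
variable {n : ℕ} {H : Matrix (Fin n) (Fin n) ℤ}

/-- The pivot is the least positive entry `i` of lattice vectors that vanish before `i`. It exists
because `|det H| e_i` is in the lattice; it divides all other such entries by division with
remainder. -/
lemma exists_pivot (hdet : H.det ≠ 0) (i : Fin n) : ∃ w : Fin n → ℤ, InLattice H w ∧
    (∀ j < i, w j = 0) ∧ 0 < w i ∧ ∀ y, InLattice H y → (∀ j < i, y j = 0) → w i ∣ y i := by
  have hex : ∃ m : ℕ, 0 < m ∧ ∃ w, InLattice H w ∧ (∀ j < i, w j = 0) ∧ w i = m := by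
    refine ⟨H.det.natAbs, Int.natAbs_pos.2 hdet, Pi.single i (H.det.natAbs : ℤ), ?_, ?_, ?_⟩
    · refine ⟨H.adjugate *ᵥ Pi.single i H.det.sign, ?_⟩
      rw [mulVec_mulVec, mul_adjugate, smul_mulVec, one_mulVec, ← Pi.single_smul, smul_eq_mul,
        mul_comm, Int.sign_mul_self_eq_natAbs]
    · exact fun j hj => Pi.single_eq_of_ne hj.ne _
    · exact Pi.single_eq_same _ _
  classical
  obtain ⟨hpos, w, hw, hw0, hwi⟩ := Nat.find_spec hex
  refine ⟨w, hw, hw0, by rw [hwi]; exact_mod_cast hpos, fun y hy hy0 => ?_⟩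
  rw [Int.dvd_iff_emod_eq_zero]
  by_contra hne
  have hwpos : 0 < w i := by rw [hwi]; exact_mod_cast hpos
  have h1 := Int.emod_nonneg (y i) hwpos.ne'
  have h2 := Int.emod_lt_of_pos (y i) hwpos
  have h3 := Int.emod_add_mul_ediv (y i) (w i)
  obtain ⟨u, rfl⟩ := hw
  have hmin := Nat.find_min hex (m := (y i % (H *ᵥ u) i).toNat) (by omega)
  refine hmin ⟨by omega, y + -(H *ᵥ ((y i / (H *ᵥ u) i) • u)), hy.add (InLattice.neg ⟨_, rfl⟩), ?_, ?_⟩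
  · intro j hj
    rw [mulVec_smul, Pi.add_apply, Pi.neg_apply, Pi.smul_apply, hw0 j hj, hy0 j hj]
    simp
  · rw [mulVec_smul, Pi.add_apply, Pi.neg_apply, Pi.smul_apply, smul_eq_mul, mul_comm,
      Int.toNat_of_nonneg h1]
    omega

lemma mulVec_single_col (M : Matrix (Fin n) (Fin n) ℤ) (i : Fin n) (c : ℤ) (j : Fin n) :
    (M *ᵥ Pi.single i c) j = c * M j i := by
  rw [mulVec_single]
  simp [mul_comm]

lemma inLattice_mulVec {W : Matrix (Fin n) (Fin n) ℤ} (hW : ∀ i, InLattice H fun j => W j i)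
    (z : Fin n → ℤ) : InLattice H (W *ᵥ z) := by
  choose u hu using hW
  refine ⟨∑ i, z i • u i, ?_⟩
  rw [mulVec_sum]
  simp only [mulVec_smul, hu]
  funext j
  simp [mulVec, dotProduct, mul_comm]

/-- Elimination from the top: the remainder vanishes before the current entry, so the pivot divides
this entry. -/
lemma exists_mulVec_eq_of_pivots {W : Matrix (Fin n) (Fin n) ℤ}
    (hW : ∀ i, InLattice H fun j => W j i) (lower : ∀ i j, i < j → W i j = 0)
    (hdvd : ∀ i y, InLattice H y → (∀ j < i, y j = 0) → W i i ∣ y i) {y : Fin n → ℤ}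
    (hy : InLattice H y) : ∃ z, W *ᵥ z = y := by
  suffices h : ∀ m ≤ n, ∃ z, ∀ j : Fin n, j.val < m → (y - W *ᵥ z) j = 0 by
    obtain ⟨z, hz⟩ := h n le_rfl
    refine ⟨z, funext fun j => ?_⟩
    have := hz j j.2
    rw [Pi.sub_apply] at this
    omega
  intro m
  induction m with
  | zero => exact fun _ => ⟨0, by simp⟩
  | succ m ih =>
    intro hm
    obtain ⟨z, hz⟩ := ih (by omega)
    set p : Fin n := ⟨m, hm⟩
    obtain ⟨q, hq⟩ := hdvd p (y - W *ᵥ z) (by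
      rw [sub_eq_add_neg]; exact hy.add (inLattice_mulVec hW z).neg) fun j hj => hz j hj
    refine ⟨z + Pi.single p q, fun j hj => ?_⟩
    rw [mulVec_add, Pi.sub_apply, Pi.add_apply, mulVec_single_col, ← sub_sub, ← Pi.sub_apply]
    rcases Nat.lt_succ_iff_lt_or_eq.1 hj with hj | hj
    · rw [hz j hj, lower j p hj, mul_zero, sub_zero]
    · obtain rfl : j = p := Fin.ext hj
      rw [hq]; ring

/-- The pivot vectors are the columns of a triangular matrix. Subtracting combinations of later
columns reduces the entries below the diagonal and leaves the pivots alone, so the resulting columns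
still generate the lattice. Then `H = H V Z`, and cancelling `det H` shows that `V` is unimodular.
-/
lemma exists_hermite (hdet : H.det ≠ 0) : ∃ V : Matrix (Fin n) (Fin n) ℤ, IsUnit V.det ∧
    (∀ i j, i < j → (H * V) i j = 0) ∧ (∀ i, 0 < (H * V) i i) ∧
    ∀ i j, j < i → 0 ≤ (H * V) i j ∧ (H * V) i j < (H * V) i i := by
  choose w hw hw0 hwpos hwdvd using exists_pivot hdet
  set W : Matrix (Fin n) (Fin n) ℤ := .of fun i j => w j i with hWdef
  have hWl : ∀ i j, i < j → W i j = 0 := fun i j hij => hw0 j i hij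
  choose u hu0 hu using fun j : Fin n => exists_reduce hWl (fun i => hwpos i) (w j) (j.val + 1)
  have hWu : ∀ i j, i ≤ j → (W *ᵥ u j) i = 0 := fun i j hij => by
    change ∑ l, W i l * u j l = 0
    refine Finset.sum_eq_zero fun l _ => ?_
    rcases lt_or_ge i l with hl | hl
    · exact mul_eq_zero_of_left (hWl i l hl) _
    · exact mul_eq_zero_of_right _ (hu0 j l (Nat.lt_succ_of_le (hl.trans hij)))
  have hWz := inLattice_mulVec (H := H) (W := W) hw
  have hlat : ∀ j, InLattice H (w j - W *ᵥ u j) := fun j => by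
    rw [sub_eq_add_neg]; exact (hw j).add (hWz _).neg
  choose v hv using hlat
  set V : Matrix (Fin n) (Fin n) ℤ := .of fun i j => v j i with hVdef
  have hHV : ∀ i j, (H * V) i j = w j i - (W *ᵥ u j) i := fun i j => by
    rw [← Pi.sub_apply, ← hv]; rfl
  have hdiag : ∀ i, (H * V) i i = w i i := fun i => by rw [hHV, hWu i i le_rfl, sub_zero]
  have hlow : ∀ i j, i < j → (H * V) i j = 0 := fun i j hij => by
    rw [hHV, hWu i j hij.le, hw0 j i hij, sub_zero]
  refine ⟨V, ?_, hlow, fun i => by rw [hdiag]; exact hwpos i, fun i j hij => ?_⟩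
  · have hcol : ∀ j, ∃ z, (H * V) *ᵥ z = fun i => H i j := fun j => by
      refine exists_mulVec_eq_of_pivots (H := H) (W := H * V) (fun i => ⟨v i, rfl⟩) hlow (fun i y hy hy0 => ?_)
        ⟨Pi.single j 1, ?_⟩
      · rw [hdiag]; exact hwdvd i y hy hy0
      · funext i
        rw [mulVec_single_col, one_mul]
    choose z hz using hcol
    set Z : Matrix (Fin n) (Fin n) ℤ := .of fun i j => z j i with hZdef
    have h1 : (H * V) * Z = H := by
      ext i j
      exact congrFun (hz j) i
    have h2 := congrArg det h1
    rw [det_mul, det_mul, mul_assoc] at h2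
    exact IsUnit.of_mul_eq_one _ (mul_left_cancel₀ hdet (h2.trans (mul_one _).symm))
  · rw [hdiag, hHV]
    exact hu j i hij

end hnf

/-! ### Changing coordinates and permuting inequalities -/

section admissible
variable {n : ℕ} {σ : IneqSystem n} {δ : ℤ} {τ : Fin n → ℤ}

/-- Primitive systems `H x ≤ h`, `-(Hᵀ τ / δ) x ≤ c₀` with `|det H| = δ > 0` and `τ ∈ [1, δ]ⁿ`. -/
structure IneqSystem.IsAdmissible (σ : IneqSystem n) (δ : ℤ) (τ : Fin n → ℤ) : Prop where
  abs_det : |σ.H.det| = δ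
  pos : 0 < δ
  one_le : ∀ i, 1 ≤ τ i
  le : ∀ i, τ i ≤ δ
  c_eq : ∀ j, δ * σ.c j = -∑ i, σ.H i j * τ i
  primitive : σ.IsPrimitive

lemma IneqSystem.isPrimitive_iff : σ.IsPrimitive ↔
    ∀ i (d : ℤ), (∀ j, d ∣ σ.mat i j) → d ∣ σ.rhs i → d ∣ 1 := by
  refine forall_congr' fun i => ?_
  constructor
  · intro h d h1 h2
    have := Int.dvd_coe_gcd (Finset.dvd_gcd (s := Finset.univ) fun j _ => h1 j) h2
    rwa [h, Nat.cast_one] at this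
  · intro h
    have := h (Int.gcd (Finset.univ.gcd (σ.mat i)) (σ.rhs i))
      (fun j => (Int.gcd_dvd_left _ _).trans (Finset.gcd_dvd (Finset.mem_univ j)))
      (Int.gcd_dvd_right _ _)
    exact Nat.dvd_one.1 (by exact_mod_cast this)

/-- The system in the coordinates `y` with `x = U y + x₀`. -/
def IneqSystem.transform (σ : IneqSystem n) (U : Matrix (Fin n) (Fin n) ℤ) (x₀ : Fin n → ℤ) :
    IneqSystem n := ⟨σ.mat * U, σ.rhs - σ.mat *ᵥ x₀⟩

lemma IneqSystem.transform_H (U : Matrix (Fin n) (Fin n) ℤ) (x₀ : Fin n → ℤ) :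
    (σ.transform U x₀).H = σ.H * U := rfl

lemma IneqSystem.transform_c (U : Matrix (Fin n) (Fin n) ℤ) (x₀ : Fin n → ℤ) (j : Fin n) :
    (σ.transform U x₀).c j = ∑ l, σ.c l * U l j := rfl

lemma IneqSystem.mem_solutions_transform (U : Matrix (Fin n) (Fin n) ℤ) (x₀ : Fin n → ℤ)
    (y : Fin n → ℝ) : y ∈ (σ.transform U x₀).solutions ↔ uniMap U x₀ y ∈ σ.solutions := by
  simp only [solutions, Set.mem_ofPred_eq]
  refine forall_congr' fun i => ?_
  have e : ∑ j, (σ.mat i j : ℝ) * uniMap U x₀ y j =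
      ∑ j, ((σ.transform U x₀).mat i j : ℝ) * y j + ((σ.mat *ᵥ x₀) i : ℤ) := by
    simp only [uniMap, transform, Matrix.mul_apply, mulVec, dotProduct]
    push_cast
    simp only [mul_add, Finset.sum_add_distrib, Finset.mul_sum, Finset.sum_mul]
    rw [Finset.sum_comm]
    congr 1
    exact Finset.sum_congr rfl fun j _ => Finset.sum_congr rfl fun l _ => by ring
  rw [e]
  simp only [transform, Pi.sub_apply]
  push_cast
  exact le_sub_iff_add_le

lemma IneqSystem.unimodularEquiv_transform {U : Matrix (Fin n) (Fin n) ℤ} (hU : IsUnit U.det)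
    (x₀ : Fin n → ℤ) : UnimodularEquiv σ.solutions (σ.transform U x₀).solutions := by
  refine UnimodularEquiv.symm (unimodularEquiv_iff.2 ⟨U, x₀, hU, ?_⟩)
  ext x
  constructor
  · rintro ⟨y, hy, rfl⟩
    exact (mem_solutions_transform U x₀ y).1 hy
  · intro hx
    refine ⟨_, ?_, uniMap_uniMap_inv hU x₀ x⟩
    rw [mem_solutions_transform, uniMap_uniMap_inv hU x₀ x]
    exact hx

lemma IneqSystem.IsAdmissible.transform (h : σ.IsAdmissible δ τ) {U : Matrix (Fin n) (Fin n) ℤ}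
    (hU : IsUnit U.det) (x₀ : Fin n → ℤ) : (σ.transform U x₀).IsAdmissible δ τ where
  abs_det := by
    rw [transform_H, det_mul, abs_mul, h.abs_det, Int.isUnit_iff_abs_eq.1 hU, mul_one]
  pos := h.pos
  one_le := h.one_le
  le := h.le
  c_eq := fun j => by
    rw [transform_c, Finset.mul_sum, transform_H]
    simp only [← mul_assoc, h.c_eq, Matrix.mul_apply, neg_mul, Finset.sum_neg_distrib,
      Finset.sum_mul]
    rw [Finset.sum_comm]
    congr 1
    exact Finset.sum_congr rfl fun i _ => Finset.sum_congr rfl fun l _ => by ring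
  primitive := by
    have hp := isPrimitive_iff.1 h.primitive
    rw [isPrimitive_iff]
    intro i d h1 h2
    have h3 : ∀ j, d ∣ σ.mat i j := fun j => by
      have e : σ.mat = (σ.transform U x₀).mat * U⁻¹ := by
        change _ = σ.mat * U * U⁻¹
        rw [Matrix.mul_assoc, mul_nonsing_inv _ hU, Matrix.mul_one]
      rw [e, Matrix.mul_apply]
      exact Finset.dvd_sum fun l _ => Dvd.dvd.mul_right (h1 l) _
    refine hp i d h3 ?_
    have e : σ.rhs i = (σ.transform U x₀).rhs i + ∑ j, σ.mat i j * x₀ j :=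
      (sub_add_cancel _ _).symm
    rw [e]
    exact dvd_add h2 (Finset.dvd_sum fun j _ => Dvd.dvd.mul_right (h3 j) _)

/-- The system with its first `n` inequalities permuted. -/
def IneqSystem.permute (σ : IneqSystem n) (π : Equiv.Perm (Fin n)) : IneqSystem n :=
  ⟨σ.mat.submatrix (Fin.lastCases (Fin.last n) fun i => (π i).castSucc) id,
    fun i => σ.rhs (Fin.lastCases (Fin.last n) (fun i => (π i).castSucc) i : Fin (n + 1))⟩

lemma IneqSystem.permute_H (π : Equiv.Perm (Fin n)) : (σ.permute π).H = σ.H.submatrix π id := by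
  ext i j
  simp [permute, IneqSystem.H]

lemma IneqSystem.permute_c (π : Equiv.Perm (Fin n)) : (σ.permute π).c = σ.c := by
  funext i
  simp [permute, IneqSystem.c]

lemma IneqSystem.solutions_permute (π : Equiv.Perm (Fin n)) :
    (σ.permute π).solutions = σ.solutions := by
  ext x
  simp only [solutions, permute, Set.mem_ofPred_eq, Fin.forall_fin_succ', submatrix_apply, id,
    Fin.lastCases_castSucc, Fin.lastCases_last]
  exact and_congr_left fun _ => ⟨fun h i => by simpa using h (π.symm i), fun h i => h (π i)⟩

lemma IneqSystem.IsAdmissible.permute (h : σ.IsAdmissible δ τ) (π : Equiv.Perm (Fin n)) :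
    (σ.permute π).IsAdmissible δ (τ ∘ π) where
  abs_det := by
    rw [permute_H, Int.abs_eq_natAbs, natAbs_det_submatrix_of_injective _ π.injective,
      ← Int.abs_eq_natAbs, h.abs_det]
  pos := h.pos
  one_le := fun i => h.one_le _
  le := fun i => h.le _
  c_eq := fun j => by
    rw [permute_H, permute_c, h.c_eq]
    congr 1
    exact (Equiv.sum_comp π fun i => σ.H i j * τ i).symm
  primitive := fun i => h.primitive _

lemma IneqSystem.IsAdmissible.hasSlacks (h : σ.IsAdmissible δ τ) (hdet : 0 ≤ σ.H.det) :
    σ.HasSlacks δ τ :=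
  ⟨by rw [← h.abs_det, abs_of_nonneg hdet], h.pos, h.one_le, h.le, h.c_eq⟩

end admissible
end EmptySimplices

namespace EmptySimplices
open Matrix

/-! ### Normalization -/

section normalization
variable {n : ℕ}

/-- Such a `v` is a recession direction: from any solution one can move along it arbitrarily far,
which boundedness excludes unless `v = 0`. -/
lemma IneqSystem.eq_zero_of_mulVec_nonpos {σ : IneqSystem n} (hne : σ.solutions.Nonempty)
    (hb : Bornology.IsBounded σ.solutions) {v : Fin n → ℤ} (hv : ∀ i, (σ.mat *ᵥ v) i ≤ 0) :
    v = 0 := by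
  obtain ⟨x, hx⟩ := hne
  obtain ⟨C, hC⟩ := isBounded_iff_forall_norm_le.1 hb
  have hmem : ∀ t : ℕ, (fun j => x j + t * (v j : ℝ)) ∈ σ.solutions := fun t i => by
    have h1 := hx i
    have h2 : ∑ j, (σ.mat i j : ℝ) * v j ≤ 0 := by exact_mod_cast hv i
    have h3 : ∑ j, (σ.mat i j : ℝ) * (x j + t * v j) =
        ∑ j, (σ.mat i j : ℝ) * x j + t * ∑ j, (σ.mat i j : ℝ) * v j := by
      rw [Finset.mul_sum, ← Finset.sum_add_distrib]
      exact Finset.sum_congr rfl fun j _ => by ring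
    rw [h3]
    have h4 : (0 : ℝ) ≤ t := t.cast_nonneg
    nlinarith
  funext j
  by_contra hne
  rw [Pi.zero_apply] at hne
  obtain ⟨t, ht⟩ := exists_nat_gt (C + |x j|)
  have h1 : |x j + t * (v j : ℝ)| ≤ C :=
    (norm_le_pi_norm (fun j => x j + t * (v j : ℝ)) j).trans (hC _ (hmem t))
  have h2 : (1 : ℝ) ≤ |(v j : ℝ)| := by exact_mod_cast Int.one_le_abs hne
  have h3 : |(t : ℝ) * v j| ≤ |x j + t * (v j : ℝ)| + |x j| := by
    have := abs_sub (x j + t * (v j : ℝ)) (x j)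
    rwa [add_sub_cancel_left] at this
  rw [abs_mul, Nat.abs_cast] at h3
  have h4 : (0 : ℝ) ≤ t := t.cast_nonneg
  nlinarith

/-- By multilinearity in the rows, `det (Aᵀ A)` is a combination of the determinants of choices of
`n` rows of `A`. If all of them vanish, some `v ≠ 0` has `Aᵀ A v = 0`, hence `|A v|² = 0`. -/
lemma exists_det_submatrix_ne_zero {m : ℕ} {A : Matrix (Fin m) (Fin n) ℤ}
    (hA : ∀ v, A *ᵥ v = 0 → v = 0) : ∃ f : Fin n → Fin m, (A.submatrix f id).det ≠ 0 := by
  by_contra! hall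
  have h1 : (Aᵀ * A).det = 0 := by
    have e : Aᵀ * A = fun i => ∑ l, A l i • A l := by
      ext i j
      simp [Matrix.mul_apply]
    have h2 := (detRowAlternating (R := ℤ) (n := Fin n)).toMultilinearMap.map_sum
      fun i l => A l i • A l
    rw [e]
    refine Eq.trans h2 (Finset.sum_eq_zero fun r _ => ?_)
    rw [MultilinearMap.map_smul_univ]
    have h3 : (detRowAlternating (R := ℤ) (n := Fin n)).toMultilinearMap (fun i => A (r i)) = 0 :=
      hall r
    rw [h3, smul_zero]
  obtain ⟨v, hv, hv0⟩ := exists_mulVec_eq_zero_iff.2 h1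
  refine hv (hA v (dotProduct_self_eq_zero.1 ?_))
  rw [dotProduct_mulVec, vecMul_mulVec, ← dotProduct_mulVec, hv0, dotProduct_zero]

/-- The case `a' = 0` is excluded because a zero inequality with zero right-hand side has gcd `0`.
The matrix of a simplex turns out to have no zero row. -/
lemma exists_primitive_row (a : Fin n → ℤ) (b : ℤ) : ∃ (g : ℤ) (a' : Fin n → ℤ) (b' : ℤ), 1 ≤ g ∧
    (∀ j, a j = g * a' j) ∧ b = g * b' ∧
      (a' ≠ 0 → ∀ d, (∀ j, d ∣ a' j) → d ∣ b' → d ∣ 1) := by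
  set g := Int.gcd (Finset.univ.gcd a) b with hg
  rcases Nat.eq_zero_or_pos g with h0 | hpos
  · refine ⟨1, a, b, le_rfl, fun j => (one_mul _).symm, (one_mul _).symm, fun hne => absurd ?_ hne⟩
    have h1 := (Int.gcd_eq_zero_iff.1 h0).1
    funext j
    exact Finset.gcd_eq_zero_iff.1 h1 j (Finset.mem_univ j)
  · have h1 : ∀ j, (g : ℤ) ∣ a j := fun j =>
      (Int.gcd_dvd_left _ _).trans (Finset.gcd_dvd (Finset.mem_univ j))
    have h2 : (g : ℤ) ∣ b := Int.gcd_dvd_right _ _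
    choose a' ha' using h1
    obtain ⟨b', hb'⟩ := h2
    refine ⟨g, a', b', by exact_mod_cast hpos, ha', hb', fun _ d hd hd' => ?_⟩
    have h3 : (g : ℤ) * d ∣ g := by
      refine Int.dvd_coe_gcd (Finset.dvd_gcd (s := Finset.univ) fun j _ => ?_) ?_
      · rw [ha']; exact mul_dvd_mul_left _ (hd j)
      · rw [hb']; exact mul_dvd_mul_left _ hd'
    exact (mul_dvd_mul_iff_left (by exact_mod_cast hpos.ne' : (g : ℤ) ≠ 0)).1 (by rwa [mul_one])

lemma IneqSystem.exists_primitive (σ : IneqSystem n) : ∃ σ' : IneqSystem n,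
    σ'.solutions = σ.solutions ∧
    (∀ f : Fin n → Fin (n + 1),
      (σ'.mat.submatrix f id).det.natAbs ≤ (σ.mat.submatrix f id).det.natAbs) ∧
    ((∀ i, σ'.mat i ≠ 0) → σ'.IsPrimitive) := by
  choose g a b hg ha hb hp using fun i => exists_primitive_row (σ.mat i) (σ.rhs i)
  refine ⟨⟨.of a, b⟩, ?_, fun f => ?_, fun h => isPrimitive_iff.2 fun i => hp i (h i)⟩
  · ext x
    refine forall_congr' fun i => ?_
    have hgi : (0 : ℝ) < g i := by exact_mod_cast hg i
    have e : ∑ j, (σ.mat i j : ℝ) * x j = g i * ∑ j, (a i j : ℝ) * x j := by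
      rw [Finset.mul_sum]
      exact Finset.sum_congr rfl fun j _ => by rw [ha]; push_cast; ring
    rw [e, hb i]
    push_cast
    exact (mul_le_mul_iff_right₀ hgi).symm
  · have e : σ.mat.submatrix f id =
        .of fun i j => g (f i) * ((Matrix.of a).submatrix f id : Matrix (Fin n) (Fin n) ℤ) i j := by
      ext i j
      exact ha _ _
    rw [e, det_mul_column, Int.natAbs_mul]
    refine Nat.le_mul_of_pos_left _ (Int.natAbs_pos.2 ?_)
    exact Finset.prod_ne_zero_iff.2 fun i _ => by have := hg (f i); omega

lemma IneqSystem.exists_admissible (hn : 1 ≤ n) (σ : IneqSystem n) (hne : σ.solutions.Nonempty)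
    (hb : Bornology.IsBounded σ.solutions) : ∃ (σ' : IneqSystem n) (δ : ℤ) (τ : Fin n → ℤ),
    σ'.IsAdmissible δ τ ∧ δ ≤ bigDelta σ.mat ∧ σ'.solutions = σ.solutions := by
  obtain ⟨σ₁, hsol, hdet, hprim⟩ := σ.exists_primitive
  have hrec : ∀ v : Fin n → ℤ, (∀ i, (σ₁.mat *ᵥ v) i ≤ 0) → v = 0 := fun v =>
    IneqSystem.eq_zero_of_mulVec_nonpos (hsol ▸ hne) (hsol ▸ hb)
  obtain ⟨f₀, hf₀⟩ := exists_det_submatrix_ne_zero (A := σ₁.mat) fun v hv =>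
    hrec v fun i => (congrFun hv i).le
  have : Nonempty (Fin n → Fin (n + 1)) := ⟨f₀⟩
  -- The rows of `H` are those of a minor of maximal absolute value; `p` is the row left over.
  obtain ⟨f, hf⟩ := Finite.exists_max fun f : Fin n → Fin (n + 1) =>
    (σ₁.mat.submatrix f id).det.natAbs
  set d := (σ₁.mat.submatrix f id).det with hd
  have hd0 : d ≠ 0 := by
    have := hf f₀
    have := Int.natAbs_pos.2 hf₀
    exact Int.natAbs_pos.1 (by omega)
  have hfinj : Function.Injective f := by
    by_contra h
    exact hd0 (det_submatrix_eq_zero _ h)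
  obtain ⟨p, hp⟩ : ∃ p, ∀ i, f i ≠ p := by
    by_contra! h
    have := Fintype.card_le_of_surjective f h
    simp at this
  set g : Fin (n + 1) → Fin (n + 1) := Fin.lastCases p f with hg
  have hgs : Function.Surjective g := by
    refine Finite.injective_iff_surjective.1 fun i j => ?_
    refine Fin.lastCases ?_ (fun i => ?_) i <;> refine Fin.lastCases ?_ (fun j => ?_) j
    · exact fun _ => rfl
    · simp only [hg, Fin.lastCases_last, Fin.lastCases_castSucc]
      exact fun h => absurd h.symm (hp j)
    · simp only [hg, Fin.lastCases_last, Fin.lastCases_castSucc]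
      exact fun h => absurd h (hp i)
    · simp only [hg, Fin.lastCases_castSucc]
      exact fun h => congrArg _ (hfinj h)
  set σ₂ : IneqSystem n := ⟨σ₁.mat.submatrix g id, σ₁.rhs ∘ g⟩ with hσ₂
  have hsol₂ : σ₂.solutions = σ₁.solutions := by
    ext x
    exact (hgs.forall (p := fun i => ∑ j, (σ₁.mat i j : ℝ) * x j ≤ σ₁.rhs i)).symm
  have hH : σ₂.H = σ₁.mat.submatrix f id := by
    ext i j
    simp [hσ₂, IneqSystem.H, hg]
  have hc : σ₂.c = σ₁.mat p := by
    funext j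
    simp [hσ₂, IneqSystem.c, hg]
  have hHd : σ₂.H.det = d := by rw [hH]
  set D : Fin n → ℤ := fun i => (σ₂.H.updateRow i σ₂.c).det with hD
  -- Replacing row `i` of `H` by `c` gives another choice of `n` rows, so maximality of `d` applies.
  have hDle : ∀ i, |D i| ≤ |d| := fun i => by
    have e : σ₂.H.updateRow i σ₂.c = σ₁.mat.submatrix (Function.update f i p) id := by
      ext q j
      rcases eq_or_ne q i with rfl | hq
      · simp [hc]
      · simp [hq, hH]
    simp only [hD, e]
    rw [Int.abs_eq_natAbs, Int.abs_eq_natAbs]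
    exact_mod_cast hf _
  have hcramer : ∀ j, d * σ₂.c j = ∑ i, σ₂.H i j * D i := fun j => by
    have h1 := congrFun (mulVec_cramer σ₂.Hᵀ σ₂.c) j
    rw [det_transpose, hHd, Pi.smul_apply, smul_eq_mul] at h1
    rw [← h1]
    change ∑ i, σ₂.H i j * cramer σ₂.Hᵀ σ₂.c i = _
    exact Finset.sum_congr rfl fun i _ => by rw [cramer_transpose_apply]
  have hsd : d.sign * d = |d| := by rw [Int.sign_mul_self_eq_abs]
  have hc_eq : ∀ j, |d| * σ₂.c j = -∑ i, σ₂.H i j * (-d.sign * D i) := fun j => by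
    rw [← hsd, mul_assoc, hcramer, Finset.mul_sum, ← Finset.sum_neg_distrib]
    exact Finset.sum_congr rfl fun i _ => by ring
  have hdpos : 0 < |d| := abs_pos.2 hd0
  -- Otherwise the nonzero vector `v` with `H v = -|d| e_i` also satisfies `c v ≤ 0`, and would be a
  -- recession direction.
  have hone : ∀ i, 1 ≤ -d.sign * D i := by
    intro i
    by_contra! hlt
    set v : Fin n → ℤ := σ₂.H.adjugate *ᵥ Pi.single i (-d.sign) with hv
    have hHv : σ₂.H *ᵥ v = Pi.single i (-|d|) := by
      rw [hv, mulVec_mulVec, mul_adjugate, smul_mulVec, one_mulVec, ← Pi.single_smul, smul_eq_mul,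
        hHd, ← hsd]
      congr 1
      ring
    have hv0 : v = 0 := by
      refine hrec v fun i' => ?_
      obtain ⟨i', rfl⟩ := hgs i'
      revert i'
      rw [Fin.forall_fin_succ']
      constructor
      · intro l
        have e : (σ₁.mat *ᵥ v) (g l.castSucc) = (σ₂.H *ᵥ v) l := rfl
        rw [e, hHv]
        rcases eq_or_ne l i with rfl | hl
        · rw [Pi.single_eq_same]; omega
        · rw [Pi.single_eq_of_ne hl]
      · have e : (σ₁.mat *ᵥ v) (g (Fin.last n)) = ∑ j, σ₂.c j * v j := rfl
        rw [e]
        have e2 : |d| * ∑ j, σ₂.c j * v j = -∑ l, (-d.sign * D l) * (σ₂.H *ᵥ v) l := by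
          simp only [mulVec, dotProduct, Finset.mul_sum, ← mul_assoc, hc_eq, neg_mul,
            Finset.sum_neg_distrib, Finset.sum_mul]
          rw [Finset.sum_comm]
          congr 1
          simp only [← Finset.sum_neg_distrib]
          exact Finset.sum_congr rfl fun l _ => Finset.sum_congr rfl fun j _ => by ring
        have e3 : ∑ l, (-d.sign * D l) * (σ₂.H *ᵥ v) l = (-d.sign * D i) * -|d| := by
          rw [hHv, Finset.sum_eq_single i (fun l _ hl => by rw [Pi.single_eq_of_ne hl, mul_zero])
            (by simp), Pi.single_eq_same]
        rw [e3] at e2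
        nlinarith
    have h1 := congrFun hHv i
    rw [hv0, mulVec_zero, Pi.single_eq_same, Pi.zero_apply] at h1
    omega
  refine ⟨σ₂, |d|, fun i => -d.sign * D i, ⟨by rw [hHd], hdpos, hone, fun i => ?_, hc_eq, ?_⟩, ?_,
    hsol₂.trans hsol⟩
  · refine le_trans (le_abs_self _) ?_
    rw [abs_mul, abs_neg, Int.abs_sign_of_ne_zero hd0, one_mul]
    exact hDle i
  -- No row is zero: `det H ≠ 0` for the first `n`, and `D_0 ≠ 0` for the last one.
  · have hprim' : σ₁.IsPrimitive := by
      refine hprim fun i => ?_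
      obtain ⟨i, rfl⟩ := hgs i
      revert i
      rw [Fin.forall_fin_succ']
      constructor
      · intro i h0
        refine hd0 ?_
        rw [← hHd]
        exact det_eq_zero_of_row_eq_zero i fun j => congrFun h0 j
      · intro h0
        have h1 := hone ⟨0, hn⟩
        have h2 : D ⟨0, hn⟩ = 0 := det_eq_zero_of_row_eq_zero ⟨0, hn⟩ fun j => by
          rw [updateRow_self]; exact congrFun h0 j
        rw [h2] at h1
        omega
    exact fun i => hprim' (g i)
  · have h1 : (σ.mat.submatrix f id).det ≠ 0 := by
      have := hdet f
      have := Int.natAbs_pos.2 hd0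
      exact Int.natAbs_pos.1 (by omega)
    rw [bigDelta, rank_eq_of_det_submatrix_ne_zero h1, Int.abs_eq_natAbs]
    exact_mod_cast (hdet f).trans (natAbs_det_le_maxMinor σ.mat f)

lemma exists_threshold {P : Fin n → Prop} (hP : ∀ i j, i ≤ j → P j → P i) :
    ∃ s ≤ n, ∀ i : Fin n, P i ↔ i.val < s := by
  classical
  have hex : ∃ m, ∀ h : m < n, ¬ P ⟨m, h⟩ := ⟨n, fun h => absurd h (lt_irrefl n)⟩
  refine ⟨Nat.find hex, Nat.find_min' hex fun h => absurd h (lt_irrefl n), fun i => ⟨fun hi => ?_,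
    fun hi => ?_⟩⟩
  · by_contra! hle
    exact Nat.find_spec hex (hle.trans_lt i.2) (hP _ i hle hi)
  · have := Nat.find_min hex hi
    push Not at this
    exact this.2

/-- The unit columns can be moved to the front and sorted. -/
lemma exists_sorting {H : Matrix (Fin n) (Fin n) ℤ} (lower : ∀ i j, i < j → H i j = 0)
    (pos : ∀ i, 0 < H i i) (reduced : ∀ i j, j < i → 0 ≤ H i j ∧ H i j < H i i) :
    ∃ π : Equiv.Perm (Fin n), (∀ i j, i < j → H (π i) (π j) = 0) ∧
      (∀ i j, j < i → 0 ≤ H (π i) (π j) ∧ H (π i) (π j) < H (π i) (π i)) ∧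
      ∃ (s k : ℕ) (hsk : s + k = n),
        (∀ i : Fin s, H (π (Fin.cast hsk (i.castAdd k))) (π (Fin.cast hsk (i.castAdd k))) = 1) ∧
        (∀ i : Fin k, 2 ≤ H (π (Fin.cast hsk (i.natAdd s))) (π (Fin.cast hsk (i.natAdd s)))) ∧
        Monotone fun j : Fin s => toLex fun i : Fin k =>
          H (π (Fin.cast hsk (i.natAdd s))) (π (Fin.cast hsk (j.castAdd k))) := by
  have hred : ∀ a b, a ≠ b → 0 ≤ H a b ∧ H a b < H a a := fun a b hab => by
    rcases lt_or_gt_of_ne hab with h | h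
    · rw [lower a b h]; exact ⟨le_rfl, pos a⟩
    · exact reduced a b h
  -- For a unit index, its column with the unit rows blanked out; for other indices a constant. The
  -- sorting key is thus decided by the unit test, then by the tail of the column, then by the
  -- original position.
  set col : Fin n → Lex (Fin n → ℤ) := fun i => toLex fun r =>
    if H i i = 1 then if H r r = 1 then 0 else H r i else 0 with hcol
  set key : Fin n → Lex (ℕ × Lex (Lex (Fin n → ℤ) × Fin n)) := fun i =>
    toLex (if H i i = 1 then 0 else 1, toLex (col i, i)) with hkey
  have hkinj : Function.Injective key := fun i j h => by
    have h1 := congrArg (fun a => (ofLex (ofLex a).2).2) h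
    exact h1
  set π := Tuple.sort key
  have hmono : StrictMono (key ∘ π) :=
    (Tuple.monotone_sort key).strictMono_of_injective (hkinj.comp π.injective)
  -- Indices with diagonal entry different from `1` come last and keep their original order.
  have hlt : ∀ i j, i < j → H (π i) (π i) ≠ 1 → H (π j) (π j) ≠ 1 ∧ π i < π j := by
    intro i j hij hi
    have h1 := hmono hij
    simp only [Function.comp_apply, hkey, Prod.Lex.toLex_lt_toLex, hcol, hi, if_false] at h1
    by_cases hj : H (π j) (π j) = 1
    · simp [hj] at h1
    · simp only [hj, if_false, lt_irrefl, true_and, false_or] at h1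
      exact ⟨hj, h1⟩
  obtain ⟨s, hs, hP⟩ := exists_threshold (P := fun i => H (π i) (π i) = 1) fun i j hij hj => by
    rcases hij.eq_or_lt with rfl | hij
    · exact hj
    · by_contra hi
      exact (hlt i j hij hi).1 hj
  refine ⟨π, fun i j hij => ?_, fun i j hij => hred _ _ (π.injective.ne hij.ne'), s, n - s,
    by omega, fun i => (hP _).2 i.2, fun i => ?_, fun j j' hjj => ?_⟩
  -- A row with diagonal entry `1` has entries in `[0, 1)` off the diagonal, so it may be moved
  -- freely.
  · by_cases hi : H (π i) (π i) = 1
    · have := hred (π i) (π j) (π.injective.ne hij.ne)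
      omega
    · exact lower _ _ (hlt i j hij hi).2
  · have h1 := mt (hP (Fin.cast (by omega) (i.natAdd s))).1 (by simp)
    have h2 := pos (π (Fin.cast (by omega) (i.natAdd s)))
    omega
  · set ι : Fin (n - s) → Fin n := fun i => Fin.cast (by omega) (i.natAdd s) with hι
    set a : Fin n := Fin.cast (by omega) (j.castAdd (n - s)) with ha
    set b : Fin n := Fin.cast (by omega) (j'.castAdd (n - s)) with hb
    have hab : a ≤ b := hjj
    have ha1 : H (π a) (π a) = 1 := (hP a).2 j.2
    have hb1 : H (π b) (π b) = 1 := (hP b).2 j'.2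
    have hι1 : ∀ i, H (π (ι i)) (π (ι i)) ≠ 1 := fun i => mt (hP (ι i)).1 (by simp [hι])
    change toLex (fun i => H (π (ι i)) (π a)) ≤ toLex (fun i => H (π (ι i)) (π b))
    have h1 : col (π a) ≤ col (π b) := by
      have h1 := hmono.monotone hab
      simp only [Function.comp_apply, hkey, Prod.Lex.toLex_le_toLex, ha1, hb1, if_true,
        lt_irrefl, true_and, false_or] at h1
      exact h1.elim le_of_lt fun h => h.1.le
    have hval : ∀ c : Fin n, H (π c) (π c) = 1 → ∀ r, col (π c) r =
        if H r r = 1 then 0 else H r (π c) := fun c hc r => by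
      simp only [hcol, hc, if_true]; rfl
    rcases h1.eq_or_lt with heq | hlt'
    · refine le_of_eq (congrArg toLex (funext fun i => ?_))
      have := congrFun heq (π (ι i))
      rwa [hval a ha1, hval b hb1, if_neg (hι1 i), if_neg (hι1 i)] at this
    -- The first difference of the two columns occurs in a non-unit row. As `π` preserves the order
    -- of these rows, it is also the first difference after the permutation.
    · obtain ⟨r, hr, hr'⟩ := hlt'
      refine le_of_lt ?_
      have hr1 : H r r ≠ 1 := fun h => by
        rw [hval a ha1, hval b hb1, if_pos h, if_pos h] at hr'
        exact lt_irrefl _ hr'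
      have hq : s ≤ (π.symm r).val := by
        by_contra! h
        have := (hP (π.symm r)).2 h
        rw [π.apply_symm_apply] at this
        exact hr1 this
      set i : Fin (n - s) := ⟨(π.symm r).val - s, by omega⟩ with hi
      have hir : π (ι i) = r := by
        have : ι i = π.symm r := Fin.ext (Nat.add_sub_cancel' hq)
        rw [this, π.apply_symm_apply]
      refine ⟨i, fun l hl => ?_, ?_⟩
      · have h2 : π (ι l) < r := by
          rw [← hir]
          exact (hlt (ι l) (ι i) (Nat.add_lt_add_left hl s) (hι1 l)).2
        have h3 := hr _ h2
        rwa [hval a ha1, hval b hb1, if_neg (hι1 l), if_neg (hι1 l)] at h3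
      · rw [hval a ha1, hval b hb1, if_neg hr1, if_neg hr1, ← hir] at hr'
        exact hr'

lemma exists_isCanonical {Δ : ℕ} (hn : 1 ≤ n) {X : Set (Fin n → ℝ)} (hX : IsSimplex X)
    (hΔ : IsDeltaModularSet Δ X) : ∃ (σ : IneqSystem n) (δ : ℤ) (τ : Fin n → ℤ),
      σ.IsCanonical Δ δ τ ∧ σ.IsPrimitive ∧ UnimodularEquiv X σ.solutions := by
  obtain ⟨σ₀, hmod, rfl⟩ := hΔ
  obtain ⟨σ₁, δ, τ, h₁, hδ, hsol₁⟩ := σ₀.exists_admissible hn (hX.nontrivial hn).nonempty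
    hX.isBounded
  have hd₁ : σ₁.H.det ≠ 0 := by
    rw [← abs_pos, h₁.abs_det]; exact h₁.pos
  obtain ⟨V, hV, lower, pos, reduced⟩ := exists_hermite hd₁
  have h₂ := h₁.transform hV 0
  set σ₂ := σ₁.transform V 0
  obtain ⟨π, lower', reduced', block⟩ := exists_sorting (H := σ₂.H) lower pos reduced
  have h₃ := h₂.permute π
  set σ₃ := σ₂.permute π
  -- Permuting the inequalities by `π` spoils the triangular shape; the unimodular `W` permutes the
  -- coordinates accordingly and restores it.
  set W : Matrix (Fin n) (Fin n) ℤ := (1 : Matrix (Fin n) (Fin n) ℤ).submatrix id π with hWdef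
  have hW : IsUnit W.det := by
    rw [hWdef, det_permute', det_one, mul_one]
    exact (Equiv.Perm.sign π).isUnit
  have h₄ := h₃.transform hW 0
  set σ₄ := σ₃.transform W 0
  have hH₄ : σ₄.H = σ₂.H.submatrix π π := by
    rw [IneqSystem.transform_H, IneqSystem.permute_H, hWdef]
    exact mul_submatrix_one (Equiv.refl _) π _
  have lower₄ : ∀ i j, i < j → σ₄.H i j = 0 := by rw [hH₄]; exact lower'
  have pos₄ : ∀ i, 0 < σ₄.H i i := by rw [hH₄]; exact fun i => pos _
  obtain ⟨u, -, hu⟩ := exists_reduce lower₄ pos₄ σ₄.h 0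
  have h1 : IsUnit (1 : Matrix (Fin n) (Fin n) ℤ).det := by simp
  have h₅ := h₄.transform h1 u
  set σ₅ := σ₄.transform 1 u
  have hH₅ : σ₅.H = σ₂.H.submatrix π π := by
    rw [← hH₄, IneqSystem.transform_H, mul_one]
  have hdet : 0 ≤ σ₅.H.det := by
    rw [hH₅, ← hH₄, det_of_isLowerTriangular (M := σ₄.H) fun i j hij => lower₄ i j hij]
    exact Finset.prod_nonneg fun i _ => (pos₄ i).le
  refine ⟨σ₅, δ, _, ⟨h₅.hasSlacks hdet, hδ.trans (by exact_mod_cast hmod), ?_, ?_, ?_, ?_⟩,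
    h₅.primitive, ?_⟩
  · rw [hH₅]; exact lower'
  · rw [hH₅]; exact reduced'
  · rw [hH₅]; exact block
  · rw [hH₅, ← hH₄]; exact fun i => hu i (Nat.zero_le _)
  · rw [← hsol₁]
    refine (IneqSystem.unimodularEquiv_transform hV 0).trans ?_
    rw [← IneqSystem.solutions_permute π]
    exact (IneqSystem.unimodularEquiv_transform hW 0).trans
      (IneqSystem.unimodularEquiv_transform h1 u)

end normalization
end EmptySimplices

namespace EmptySimplices
open EmptySimplices.Enc (enc)

/-! ### The algorithm and its running time -/

lemma encodeList_congr {α : Type} {e e' : α → Datum} {l : List α} (h : ∀ a ∈ l, e a = e' a) :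
    encodeList e l = encodeList e' l := by
  induction l with
  | nil => rfl
  | cons a l ih =>
    rw [encodeList, encodeList, h a List.mem_cons_self,
      ih fun b hb => h b (List.mem_cons_of_mem _ hb)]

/-- The quotient of the two binomial coefficients is `(n + Δ) / Δ ≤ n + 1`; this factor is absorbed
by the polynomial. -/
lemma choose_add_le (n Δ : ℕ) (hΔ : 1 ≤ Δ) :
    (n + Δ).choose Δ ≤ (n + 1) * (n + Δ - 1).choose (Δ - 1) := by
  obtain ⟨d, rfl⟩ : ∃ d, Δ = d + 1 := ⟨Δ - 1, by omega⟩
  have h := Nat.add_one_mul_choose_eq (n + d) d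
  rw [show n + (d + 1) - 1 = n + d by omega, Nat.add_sub_cancel]
  refine Nat.le_of_mul_le_mul_right (c := d + 1) ?_ (Nat.succ_pos d)
  rw [← add_assoc, ← h, mul_right_comm]
  exact Nat.mul_le_mul_right _ (by nlinarith)

/-- The algorithm, with a bound for its running time. -/
theorem exists_program : ∃ (P : Program) (D : ℕ), ∀ n Δ : ℕ, 1 ≤ n → 1 ≤ Δ →
    ∃ (S LS : List (IneqSystem n)) (t : ℕ),
      Runs P (.pair (.num n) (.num Δ))
        (.pair (encodeList encodeSystem S) (encodeList encodeSystem LS)) t ∧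
      t ≤ (n + Δ - 1).choose (Δ - 1) * Δ ^ Nat.log 2 Δ * (n + Δ) ^ D ∧
      (∀ σ ∈ S, IsDeltaModular Δ σ.mat ∧ σ.IsNormalized Δ ∧ IsEmptySimplex σ.solutions) ∧
      (∀ X : Set (Fin n → ℝ), IsEmptySimplex X → IsDeltaModularSet Δ X →
        ∃ σ ∈ S, UnimodularEquiv X σ.solutions) ∧
      (∀ σ ∈ LS, IsDeltaModular Δ σ.mat ∧ σ.IsNormalized Δ ∧
        IsEmptyLatticeSimplex σ.solutions) ∧
      (∀ X : Set (Fin n → ℝ), IsEmptyLatticeSimplex X → IsDeltaModularSet Δ X →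
        ∃ σ ∈ LS, UnimodularEquiv X σ.solutions) := by
  obtain ⟨P, C, hP⟩ := exists_program_search polyTime_expand polyTime_leafS polyTime_leafL
  obtain ⟨Q, T, hT, -, hQ⟩ := polyTime_root
  have hbdd : PolyBdd fun p : ℕ × ℕ =>
      ((p.2 + 1) * (p.1 + 1) + 1) * (sizeBound p.1 p.2 + 1) ^ C + T p + 1 := by
    have h1 : PolyBdd fun p : ℕ × ℕ => p.1 := PolyBdd.self.mono fun p => by
      rw [show sz p = sz p.1 + sz p.2 + 1 from rfl, sz_nat]; omega
    have h2 : PolyBdd fun p : ℕ × ℕ => p.2 := PolyBdd.self.mono fun p => by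
      rw [show sz p = sz p.1 + sz p.2 + 1 from rfl, sz_nat, sz_nat]; omega
    have h3 : PolyBdd fun p : ℕ × ℕ => sizeBound p.1 p.2 :=
      (((PolyBdd.const 4).mul (((h1.add h2).mul ((h1.mul (h2.add (.const 2))).add (.const 2))).add
        (.const 1))).add ((PolyBdd.const 2).mul (h1.add h2))).add (.const 30)
    exact (((((h2.add (.const 1)).mul (h1.add (.const 1))).add (.const 1)).mul
      ((h3.add (.const 1)).pow C)).add hT).add (.const 1)
  obtain ⟨D, hD⟩ := hbdd
  refine ⟨.seq Q P, 3 * D, fun n Δ hn hΔ => ?_⟩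
  have hdesc : ∀ x, (∃ s k, Node.Valid n Δ s k x) → ∀ y ∈ x.expand, ∃ s k, y.Valid n Δ s k := by
    rintro x ⟨s, k, h⟩ y hy
    exact h.expand hy
  obtain ⟨S, LS, t, hrun, ht, hS, hLS⟩ := hP (fun x => ∃ s k, x.Valid n Δ s k) (Node.pot n Δ)
    (sizeBound n Δ) (fun x ⟨s, k, h⟩ => h.sz_le) hdesc (fun x ⟨s, k, h⟩ => h.pot) (Node.root n Δ)
    ⟨0, 0, Node.valid_root hΔ⟩
  obtain ⟨t₀, ht₀, hrun₀⟩ := hQ (n, Δ)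
  have hS' : ∀ r ∈ S, encodeSystem (toSystem n r) = enc r ∧
      IsEmptySimplex (toSystem n r).solutions ∧ IsDeltaModular Δ (toSystem n r).mat ∧
      (toSystem n r).IsNormalized Δ := fun r hr => by
    obtain ⟨x, hx, hr⟩ := (hS r).1 hr
    obtain ⟨s, k, hval⟩ := Node.valid_of_reachable hΔ hx
    exact hval.of_mem_leafS hn hr
  have hLS' : ∀ r ∈ LS, encodeSystem (toSystem n r) = enc r ∧
      IsEmptyLatticeSimplex (toSystem n r).solutions ∧ IsDeltaModular Δ (toSystem n r).mat ∧
      (toSystem n r).IsNormalized Δ := fun r hr => by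
    obtain ⟨x, hx, hr⟩ := (hLS r).1 hr
    obtain ⟨s, k, hval⟩ := Node.valid_of_reachable hΔ hx
    exact hval.of_mem_leafL hn hr
  refine ⟨S.map (toSystem n), LS.map (toSystem n), t₀ + t + 1, ?_, ?_, ?_, ?_, ?_, ?_⟩
  · have h := Runs.seq hrun₀ hrun
    have e : ∀ L : List (List (List ℤ) × List ℤ), (∀ r ∈ L, encodeSystem (toSystem n r) = enc r) →
        encodeList encodeSystem (L.map (toSystem n)) = enc L := fun L hL => by
      rw [encodeList_map]
      exact encodeList_congr hL
    rw [e S fun r hr => (hS' r hr).1, e LS fun r hr => (hLS' r hr).1]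
    exact h
  · have h1 := hD (n, Δ)
    simp only at h1
    -- The left side is `n + Δ + 4`, and `n + Δ ≥ 2`.
    have hsz : sz (n, Δ) + 1 ≤ (n + Δ) ^ 3 := by
      rw [sz_prod, sz_nat, sz_nat]
      have h2 : 2 ^ 2 ≤ (n + Δ) ^ 2 := Nat.pow_le_pow_left (by omega) 2
      nlinarith
    have h2 : (sz (n, Δ) + 1) ^ D ≤ (n + Δ) ^ (3 * D) := by
      rw [pow_mul]; exact Nat.pow_le_pow_left hsz D
    set K := (n + Δ - 1).choose (Δ - 1) * Δ ^ Nat.log 2 Δ with hK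
    have hK1 : 1 ≤ K := Nat.mul_pos (Nat.choose_pos (by omega)) (Nat.pow_pos (by omega))
    have hpot : (Node.root n Δ).pot n Δ + 1 ≤ K * ((Δ + 1) * (n + 1) + 1) := by
      have e : (Node.root n Δ).pot n Δ =
          (Nat.log 2 Δ + 1) * Δ ^ Nat.log 2 Δ * (n + Δ).choose Δ := by
        simp [Node.pot, Node.root]
      rw [e, mul_add, mul_one]
      refine add_le_add ?_ hK1
      calc (Nat.log 2 Δ + 1) * Δ ^ Nat.log 2 Δ * (n + Δ).choose Δ
          ≤ (Δ + 1) * Δ ^ Nat.log 2 Δ * ((n + 1) * (n + Δ - 1).choose (Δ - 1)) :=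
            Nat.mul_le_mul (Nat.mul_le_mul_right _ (Nat.succ_le_succ (Nat.log_le_self 2 Δ)))
              (choose_add_le n Δ hΔ)
        _ = K * ((Δ + 1) * (n + 1)) := by rw [hK]; ring
    calc t₀ + t + 1 ≤ T (n, Δ) + K * ((Δ + 1) * (n + 1) + 1) * (sizeBound n Δ + 1) ^ C + 1 := by
          have := ht.trans (Nat.mul_le_mul_right _ hpot)
          omega
      _ ≤ K * (((Δ + 1) * (n + 1) + 1) * (sizeBound n Δ + 1) ^ C + T (n, Δ) + 1) := by
          generalize ((Δ + 1) * (n + 1) + 1) = a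
          generalize (sizeBound n Δ + 1) ^ C = b
          have e : K * (a * b + T (n, Δ) + 1) = K * T (n, Δ) + K * a * b + K := by ring
          have := Nat.le_mul_of_pos_left (T (n, Δ)) hK1
          omega
      _ ≤ K * (n + Δ) ^ (3 * D) := Nat.mul_le_mul_left _ (h1.trans h2)
  · simp only [List.mem_map]
    rintro σ ⟨r, hr, rfl⟩
    obtain ⟨-, h1, h2, h3⟩ := hS' r hr
    exact ⟨h2, h3, h1⟩
  · intro X hX hmod
    obtain ⟨σ, δ, τ, hσ, hp, hequiv⟩ := exists_isCanonical hn hX.1 hmod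
    have he : IsEmptySimplex σ.solutions :=
      ⟨hσ.slacks.isSimplex (hσ.slacks.bound_pos (hequiv.nontrivial (hX.1.nontrivial hn))),
        hequiv.inter_integerPoints_eq_empty hX.2⟩
    obtain ⟨x, hx, r, hr, rfl⟩ := hσ.exists_leafS hn hΔ hp he
    exact ⟨_, List.mem_map_of_mem ((hS r).2 ⟨x, hx, hr⟩), hequiv⟩
  · simp only [List.mem_map]
    rintro σ ⟨r, hr, rfl⟩
    obtain ⟨-, h1, h2, h3⟩ := hLS' r hr
    exact ⟨h2, h3, h1⟩
  · intro X hX hmod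
    obtain ⟨σ, δ, τ, hσ, hp, hequiv⟩ := exists_isCanonical hn hX.1.1 hmod
    have he : IsEmptyLatticeSimplex σ.solutions :=
      ⟨⟨hσ.slacks.isSimplex (hσ.slacks.bound_pos (hequiv.nontrivial (hX.1.1.nontrivial hn))),
        hequiv.extremePoints_subset hX.1.2⟩, hequiv.inter_integerPoints_eq_extremePoints hX.2⟩
    obtain ⟨x, hx, r, hr, rfl⟩ := hσ.exists_leafL hn hΔ hp he
    exact ⟨_, List.mem_map_of_mem ((hLS r).2 ⟨x, hx, hr⟩), hequiv⟩

/-! ### Explicit bounds -/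

lemma succ_sq_le_four_mul_two_pow (l : ℕ) : (l + 1) ^ 2 ≤ 4 * 2 ^ l := by
  induction l with
  | zero => norm_num
  | succ l ih =>
    rcases l with _ | _ | l
    · norm_num
    · norm_num
    · have h : (l + 1 + 1 + 1 + 1) ^ 2 ≤ 2 * (l + 1 + 1 + 1) ^ 2 := by ring_nf; nlinarith
      rw [pow_succ 2 (l + 1 + 1)]
      linarith

/-- With `l` the integer logarithm, the exponent of `2` is at most `(l + 1)² (D + 1)`, and `(l + 1)²
≤ 4 · 2 ^ l ≤ 4 Δ`. -/
lemma pow_log_add_le {Δ : ℕ} (hΔ : 1 ≤ Δ) (D : ℕ) :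
    Δ ^ (Nat.log 2 Δ + D) ≤ (2 ^ (4 * (D + 1))) ^ Δ := by
  have h1 : Δ ≤ 2 ^ (Nat.log 2 Δ + 1) := (Nat.lt_pow_succ_log_self one_lt_two Δ).le
  have h2 : 2 ^ Nat.log 2 Δ ≤ Δ := Nat.pow_log_le_self 2 (by omega)
  have h3 := succ_sq_le_four_mul_two_pow (Nat.log 2 Δ)
  calc Δ ^ (Nat.log 2 Δ + D) ≤ (2 ^ (Nat.log 2 Δ + 1)) ^ (Nat.log 2 Δ + D) :=
        Nat.pow_le_pow_left h1 _
    _ = 2 ^ ((Nat.log 2 Δ + 1) * (Nat.log 2 Δ + D)) := (pow_mul _ _ _).symm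
    _ ≤ 2 ^ (4 * (D + 1) * Δ) := by
        refine Nat.pow_le_pow_right two_pos ?_
        calc (Nat.log 2 Δ + 1) * (Nat.log 2 Δ + D)
            ≤ (Nat.log 2 Δ + 1) * ((Nat.log 2 Δ + 1) * (D + 1)) :=
              Nat.mul_le_mul_left _ (by nlinarith)
          _ = (Nat.log 2 Δ + 1) ^ 2 * (D + 1) := by ring
          _ ≤ 4 * Δ * (D + 1) := Nat.mul_le_mul_right _ (h3.trans (Nat.mul_le_mul_left _ h2))
          _ = 4 * (D + 1) * Δ := by ring
    _ = _ := pow_mul _ _ _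

/-- The binomial coefficient is at most `(n + Δ) ^ (Δ - 1) / (Δ - 1)!`, and `Δ ^ (Δ - 1) / (Δ - 1)!`
is a term of the series of `exp Δ`. -/
lemma choose_le_exp {n Δ : ℕ} (hΔ : 1 ≤ Δ) : ((n + Δ - 1).choose (Δ - 1) : ℝ) ≤
    Real.exp Δ * (((n : ℝ) + Δ) / Δ) ^ (Δ - 1) := by
  have hpos : (0 : ℝ) < Δ := by exact_mod_cast hΔ
  have h1 : ((n + Δ - 1).choose (Δ - 1) : ℝ) ≤ ((n + Δ - 1 : ℕ) : ℝ) ^ (Δ - 1) / (Δ - 1).factorial :=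
    Nat.choose_le_pow_div _ _
  have h2 := Real.pow_div_factorial_le_exp _ hpos.le (Δ - 1)
  have hf : (0 : ℝ) < (Δ - 1).factorial := by exact_mod_cast Nat.factorial_pos _
  have h3 : ((n + Δ - 1 : ℕ) : ℝ) ^ (Δ - 1) ≤ ((n : ℝ) + Δ) ^ (Δ - 1) := by
    refine pow_le_pow_left₀ (Nat.cast_nonneg _) ?_ _
    exact_mod_cast Nat.sub_le _ _
  calc _ ≤ ((n : ℝ) + Δ) ^ (Δ - 1) / (Δ - 1).factorial :=
        h1.trans (div_le_div_of_nonneg_right h3 hf.le)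
    _ = (Δ : ℝ) ^ (Δ - 1) / (Δ - 1).factorial * (((n : ℝ) + Δ) / Δ) ^ (Δ - 1) := by
        rw [div_pow]; field_simp
    _ ≤ _ := mul_le_mul_of_nonneg_right h2 (by positivity)

lemma exists_exponential_bound (D : ℕ) : ∃ C : ℕ, ∀ n Δ : ℕ, 1 ≤ n → 1 ≤ Δ →
    (((n + Δ - 1).choose (Δ - 1) * Δ ^ Nat.log 2 Δ * (n + Δ) ^ D : ℕ) : ℝ) ≤
      C * (C * (((n : ℝ) + Δ) / Δ)) ^ (Δ - 1) * (n : ℝ) ^ C := by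
  set B : ℕ := 2 ^ (4 * (D + 1)) with hB
  -- The base `3 * B` takes care of `exp Δ` and `Δ ^ (log Δ + D)`, the factor `2 ^ D` comes from `n
  -- + Δ ≤ 2 n Δ`, and `+ D` makes the exponent of `n` large enough.
  refine ⟨3 * B * 2 ^ D + D, fun n Δ hn hΔ => ?_⟩
  set C : ℕ := 3 * B * 2 ^ D + D with hC
  set ρ : ℝ := ((n : ℝ) + Δ) / Δ with hρ
  have hρ0 : 0 ≤ ρ := by positivity
  have hn' : (1 : ℝ) ≤ n := by exact_mod_cast hn
  have h1 := choose_le_exp (n := n) hΔ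
  have h2 : ((n + Δ : ℕ) : ℝ) ^ D ≤ 2 ^ D * (n : ℝ) ^ D * (Δ : ℝ) ^ D := by
    rw [← mul_pow, ← mul_pow]
    refine pow_le_pow_left₀ (Nat.cast_nonneg _) ?_ _
    have : n + Δ ≤ 2 * n * Δ := by nlinarith
    exact_mod_cast this
  have h3 : (Δ : ℝ) ^ Nat.log 2 Δ * (Δ : ℝ) ^ D ≤ (B : ℝ) ^ Δ := by
    rw [← pow_add]
    exact_mod_cast pow_log_add_le hΔ D
  have h4 : Real.exp Δ ≤ 3 ^ Δ := by
    rw [← Real.exp_one_pow]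
    exact pow_le_pow_left₀ (Real.exp_pos _).le (Real.exp_one_lt_d9.le.trans (by norm_num)) _
  have hB1 : (1 : ℝ) ≤ 2 ^ D := one_le_pow₀ one_le_two
  have hBpos : (0 : ℝ) ≤ B := Nat.cast_nonneg _
  have hC1 : (3 * B : ℝ) ≤ C := by
    rw [hC]; push_cast
    have : (0 : ℝ) ≤ D := Nat.cast_nonneg _
    nlinarith
  have hC2 : (3 * B * 2 ^ D : ℝ) ≤ C := by
    rw [hC]; push_cast
    exact le_add_of_nonneg_right (Nat.cast_nonneg _)
  have hΔ' : (3 * B : ℝ) ^ Δ = (3 * B) * (3 * B) ^ (Δ - 1) := by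
    rw [← pow_succ', Nat.sub_add_cancel hΔ]
  rw [Nat.cast_mul, Nat.cast_mul, Nat.cast_pow, Nat.cast_pow]
  calc ((n + Δ - 1).choose (Δ - 1) : ℝ) * (Δ : ℝ) ^ Nat.log 2 Δ * ((n + Δ : ℕ) : ℝ) ^ D
      ≤ (3 ^ Δ * ρ ^ (Δ - 1)) * (Δ : ℝ) ^ Nat.log 2 Δ * (2 ^ D * (n : ℝ) ^ D * (Δ : ℝ) ^ D) := by
        refine mul_le_mul (mul_le_mul_of_nonneg_right (h1.trans ?_) (by positivity)) h2
          (by positivity) (by positivity)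
        exact mul_le_mul_of_nonneg_right h4 (by positivity)
    _ = 3 ^ Δ * ((Δ : ℝ) ^ Nat.log 2 Δ * (Δ : ℝ) ^ D) * (2 ^ D * ρ ^ (Δ - 1) * (n : ℝ) ^ D) := by
        ring
    _ ≤ 3 ^ Δ * (B : ℝ) ^ Δ * (2 ^ D * ρ ^ (Δ - 1) * (n : ℝ) ^ D) :=
        mul_le_mul_of_nonneg_right (mul_le_mul_of_nonneg_left h3 (by positivity)) (by positivity)
    _ = (3 * B * 2 ^ D) * ((3 * B) * ρ) ^ (Δ - 1) * (n : ℝ) ^ D := by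
        rw [← mul_pow, hΔ', mul_pow _ ρ]; ring
    _ ≤ C * (C * ρ) ^ (Δ - 1) * (n : ℝ) ^ C := by
        refine mul_le_mul (mul_le_mul hC2 ?_ (by positivity) (by positivity)) ?_ (by positivity)
          (by positivity)
        · exact pow_le_pow_left₀ (by positivity) (mul_le_mul_of_nonneg_right hC1 hρ0) _
        · exact pow_le_pow_right₀ hn' (by omega)

lemma exists_polynomial_bound (D Δ : ℕ) (hΔ : 1 ≤ Δ) : ∃ q : Polynomial ℕ, ∀ n : ℕ, 1 ≤ n →
    (n + Δ - 1).choose (Δ - 1) * Δ ^ Nat.log 2 Δ * (n + Δ) ^ D ≤ q.eval n := by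
  refine ⟨(.X + .C Δ) ^ Δ * .C (Δ ^ Nat.log 2 Δ) * (.X + .C Δ) ^ D, fun n hn => ?_⟩
  simp only [Polynomial.eval_mul, Polynomial.eval_pow, Polynomial.eval_add, Polynomial.eval_X,
    Polynomial.eval_C]
  refine Nat.mul_le_mul_right _ (Nat.mul_le_mul_right _ ?_)
  calc (n + Δ - 1).choose (Δ - 1) ≤ (n + Δ - 1) ^ (Δ - 1) := Nat.choose_le_pow _ _
    _ ≤ (n + Δ) ^ (Δ - 1) := Nat.pow_le_pow_left (by omega) _
    _ ≤ (n + Δ) ^ Δ := Nat.pow_le_pow_right (by omega) (by omega)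

/-! ### The number of classes -/

/-- The height of a datum. -/
def Datum.height : Datum → ℕ
  | .num _ => 0
  | .pair a b => max a.height b.height + 1

/-- Shared references may make a datum exponentially large as a tree, but its height grows by at
most one per step. The height bounds the length of an encoded list. -/
lemma Runs.height_le {P : Program} {x y : Datum} {t : ℕ} (h : Runs P x y t) :
    y.height ≤ x.height + t := by
  induction h <;> (try simp only [Datum.height] at *) <;> omega

lemma length_le_height {α : Type} (e : α → Datum) (l : List α) :
    l.length ≤ (encodeList e l).height := by
  induction l with
  | nil => exact Nat.zero_le _
  | cons a l ih =>
    simp only [encodeList, Datum.height, List.length_cons]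
    omega

/-- Unimodular equivalence is symmetric and transitive, so each class is that of some member of the
list. -/
lemma encard_emptyLatticeSimplexClasses_le {n Δ : ℕ} {LS : List (IneqSystem n)}
    (h : ∀ X : Set (Fin n → ℝ), IsEmptyLatticeSimplex X → IsDeltaModularSet Δ X →
      ∃ σ ∈ LS, UnimodularEquiv X σ.solutions) :
    (emptyLatticeSimplexClasses n Δ).encard ≤ LS.length := by
  classical
  have hsub : emptyLatticeSimplexClasses n Δ ⊆
      (fun σ : IneqSystem n => {S' | UnimodularEquiv σ.solutions S'}) '' (LS.toFinset : Set _) := by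
    rintro K ⟨X, hX, hmod, rfl⟩
    obtain ⟨σ, hσ, hequiv⟩ := h X hX hmod
    refine ⟨σ, by simpa using hσ, ?_⟩
    ext Y
    exact ⟨fun hY => hequiv.trans hY, fun hY => hequiv.symm.trans hY⟩
  refine (Set.encard_le_encard hsub).trans ((Set.encard_image_le _ _).trans ?_)
  rw [Set.encard_coe_eq_coe_finsetCard]
  exact_mod_cast LS.toFinset_card_le

end EmptySimplices

theorem lemma4 :
    (∃ (P : Program) (S LS : (n Δ : ℕ) → List (IneqSystem n)) (time : ℕ → ℕ → ℕ),
      -- on input `(n, Δ)` the algorithm outputs the two families in `time n Δ` steps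
      (∀ n Δ : ℕ, 1 ≤ n → 1 ≤ Δ →
        Runs P (.pair (.num n) (.num Δ))
          (.pair (encodeList encodeSystem (S n Δ)) (encodeList encodeSystem (LS n Δ)))
          (time n Δ)) ∧
      -- the families
      (∀ n Δ : ℕ, 1 ≤ n → 1 ≤ Δ →
        (∀ σ ∈ S n Δ, IsDeltaModular Δ σ.mat ∧ σ.IsNormalized Δ ∧
          IsEmptySimplex σ.solutions) ∧
        (∀ X : Set (Fin n → ℝ), IsEmptySimplex X → IsDeltaModularSet Δ X →
          ∃ σ ∈ S n Δ, UnimodularEquiv X σ.solutions) ∧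
        (∀ σ ∈ LS n Δ, IsDeltaModular Δ σ.mat ∧ σ.IsNormalized Δ ∧
          IsEmptyLatticeSimplex σ.solutions) ∧
        (∀ X : Set (Fin n → ℝ), IsEmptyLatticeSimplex X → IsDeltaModularSet Δ X →
          ∃ σ ∈ LS n Δ, UnimodularEquiv X σ.solutions)) ∧
      -- the running time
      (∃ p : MvPolynomial (Fin 2) ℕ, ∀ n Δ : ℕ, 1 ≤ n → 1 ≤ Δ →
        (time n Δ : ℝ) ≤ ((n + Δ - 1).choose (Δ - 1) : ℝ) * (Δ : ℝ) ^ Real.logb 2 (Δ : ℝ) *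
          (MvPolynomial.eval ![n, Δ] p : ℕ)) ∧
      (∃ C : ℕ, ∀ n Δ : ℕ, 1 ≤ n → 1 ≤ Δ →
        (time n Δ : ℝ) ≤ C * (C * (((n : ℝ) + Δ) / Δ)) ^ (Δ - 1) * (n : ℝ) ^ C) ∧
      (∀ Δ : ℕ, 1 ≤ Δ → ∃ q : Polynomial ℕ, ∀ n : ℕ, 1 ≤ n → time n Δ ≤ q.eval n)) ∧
    -- the number of classes of `Δ`-modular empty lattice-simplices, for fixed `Δ`
    (∀ Δ : ℕ, 1 ≤ Δ → ∃ q : Polynomial ℕ, ∀ n : ℕ, 1 ≤ n →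
      (emptyLatticeSimplexClasses n Δ).encard ≤ (q.eval n : ℕ)) := by
  obtain ⟨P, D, hP⟩ := exists_program
  have hall : ∀ n Δ : ℕ, ∃ (S LS : List (IneqSystem n)) (t : ℕ), 1 ≤ n → 1 ≤ Δ → _ :=
    fun n Δ => by
      by_cases h : 1 ≤ n ∧ 1 ≤ Δ
      · obtain ⟨S, LS, t, h'⟩ := hP n Δ h.1 h.2
        exact ⟨S, LS, t, fun _ _ => h'⟩
      · exact ⟨[], [], 0, fun h1 h2 => absurd ⟨h1, h2⟩ h⟩
  choose S LS time h using hall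
  have hpoly : ∀ Δ : ℕ, 1 ≤ Δ → ∃ q : Polynomial ℕ, ∀ n : ℕ, 1 ≤ n → time n Δ ≤ q.eval n :=
    fun Δ hΔ => by
      obtain ⟨q, hq⟩ := exists_polynomial_bound D Δ hΔ
      exact ⟨q, fun n hn => (h n Δ hn hΔ).2.1.trans (hq n hn)⟩
  refine ⟨⟨P, S, LS, time, fun n Δ hn hΔ => (h n Δ hn hΔ).1, fun n Δ hn hΔ => (h n Δ hn hΔ).2.2,
    ⟨(.X 0 + .X 1) ^ D, fun n Δ hn hΔ => ?_⟩, ?_, hpoly⟩, fun Δ hΔ => ?_⟩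
  · have h1 : (time n Δ : ℝ) ≤ ((n + Δ - 1).choose (Δ - 1) * Δ ^ Nat.log 2 Δ * (n + Δ) ^ D : ℕ) := by
      exact_mod_cast (h n Δ hn hΔ).2.1
    refine h1.trans ?_
    have hΔ' : (1 : ℝ) ≤ Δ := by exact_mod_cast hΔ
    have h2 : (Δ : ℝ) ^ Nat.log 2 Δ ≤ (Δ : ℝ) ^ Real.logb 2 (Δ : ℝ) := by
      rw [← Real.rpow_natCast]
      exact Real.rpow_le_rpow_of_exponent_le hΔ' (by exact_mod_cast Real.natLog_le_logb Δ 2)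
    have h3 : MvPolynomial.eval ![n, Δ] ((.X 0 + .X 1) ^ D : MvPolynomial (Fin 2) ℕ) =
        (n + Δ) ^ D := by simp
    rw [h3, Nat.cast_mul, Nat.cast_mul, Nat.cast_pow Δ]
    exact mul_le_mul_of_nonneg_right (mul_le_mul_of_nonneg_left h2 (Nat.cast_nonneg _))
      (Nat.cast_nonneg _)
  · obtain ⟨C, hC⟩ := exists_exponential_bound D
    refine ⟨C, fun n Δ hn hΔ => le_trans ?_ (hC n Δ hn hΔ)⟩
    exact_mod_cast (h n Δ hn hΔ).2.1
  · obtain ⟨q, hq⟩ := hpoly Δ hΔ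
    refine ⟨q + 1, fun n hn => ?_⟩
    obtain ⟨hrun, -, -, -, -, hLS⟩ := h n Δ hn hΔ
    refine (encard_emptyLatticeSimplexClasses_le hLS).trans ?_
    have h1 := hrun.height_le
    have h2 := length_le_height encodeSystem (LS n Δ)
    have h3 := hq n hn
    simp only [Datum.height] at h1
    rw [Polynomial.eval_add, Polynomial.eval_one]
    exact_mod_cast (by omega : (LS n Δ).length ≤ q.eval n + 1)
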